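/- **The game.** Two firms race in continuous time on a two-stage project. Stage 1 is solvable with prior probability $\alpha\in(0,1)$; if it is, each firm working on it solves it at Poisson rate $H>0$ (independently of the other), and otherwise it is never solved. A firm that has the solution of stage 1 (its own, or a disclosed one) solves stage 2 at Poisson rate $\mu>0$. A firm in stage 1 pays $c>0$ per unit of time, and stage 2 is free. A firm without a solution may exit at any time, irrevocably and unobserved by its rival. A firm that has solved stage 1 never exits and chooses when to disclose; it also makes its solution public upon completing stage 2. When the solution becomes public, $p_1>0$ is paid to the firm that has solved stage 1, or $p_1/2$ to each if both have, and every firm that has not exited can work on stage 2. The first firm to complete stage 2 receives $p_2>0$, and the game ends. A strategy assigns to every time $t\ge0$ one of the actions "disclose", "withhold", "exit", piecewise constantly with finitely many cutoffs (the action at a cutoff being that of the region starting there): a firm without a solution exits if the action is "exit" and stays otherwise; a firm with an undisclosed solution discloses it if the action is "disclose" and keeps it otherwise. A strategy used by both firms is a (symmetric) equilibrium if at every $t\ge 0$, whether or not a firm has solved stage 1, following it from $t$ on maximizes the firm's expected continuation payoff given that its rival uses it, where expectations are conditional (by Bayes' rule) on the firm's own progress and on nothing having been made public before $t$. **Assumptions.**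 Let $R=\dfrac{H(p_1+p_2)}{p_1H-p_2\mu}$. A1. $\alpha H(p_1+p_2)>c$. A2. $p_1H>p_2\mu$. A3. $$\frac{H(p_1+p_2)\Big[\frac{\frac12H-\mu}{H-\mu}R^{-\frac{H}{H+\mu}}+\frac{\frac12H}{H-\mu}R^{-\frac{\mu}{H+\mu}}\Big]}{c}+\frac{\mu}{H-\mu}R^{-\frac{H}{H+\mu}}-\frac{H}{H-\mu}R^{-\frac{\mu}{H+\mu}}\ \ge\ R^{\frac{H}{H+\mu}},$$ where for $H=\mu$ the left side is replaced by its limit $\frac{H(p_1+p_2)}{c}\big(1+\frac{\ln R}{4}\big)R^{-1/2}-\big(1+\frac{\ln R}{2}\big)R^{-1/2}$. **Theorem.** Under A1–A3 the game has a unique equilibrium. It is the disclose–withhold–exit strategy with cutoffs $0\le t_1<t_2$: a firm discloses a solution of stage 1 when $t\in[0,t_1)$, withholds it when $t\in[t_1,t_2)$, and from $t_2$ on a firm that has not solved stage 1 exits. (Uniqueness is among the strategies in which an exit region extends to infinity; any other equilibrium strategy also coincides with this one on $[0,t_2]$.) The cutoffs are related by $$t_1=\max\{0,\;t_2-\Delta\},\qquad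 \Delta=\frac{1}{H+\mu}\ln\frac{H(p_1+p_2)}{p_1H-p_2\mu},$$ so the withhold region has length $\Delta$ whenever $t_2\ge\Delta$; in particular $t_2-t_1=\Delta$ if $\alpha\ge\frac12$. With $t_1$ so determined by $t_2$, the exit time $t_2$ is the unique solution of the exit-indifference condition $$c=\tilde\lambda(t_2)\,H\,\frac{(p_1+p_2)e^{-H(t_2-t_1)}+\frac{p_1+p_2}{2}I(t_2-t_1)}{e^{-H(t_2-t_1)}+I(t_2-t_1)},\qquad I(u)=\int_0^{u}He^{-Hs}e^{-(u-s)\mu}\,ds,$$ where the belief that stage 1 is solvable is $$\tilde\lambda(t)=\frac{\alpha e^{-2Ht_1-H(t-t_1)}\big(e^{-H(t-t_1)}+I(t-t_1)\big)}{\alpha e^{-2Ht_1-H(t-t_1)}\big(e^{-H(t-t_1)}+I(t-t_1)\big)+1-\alpha}.$$ -/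

import Mathlib

open MeasureTheory ProbabilityTheory
open scoped ENNReal

noncomputable section

namespace RDGame

/-- The primitives of the game: the prior probability `α` that stage 1 is solvable, the Poisson rate
`H` of stage 1 when it is solvable, the Poisson rate `μ` of stage 2, the rewards `p₁`, `p₂` of the
two stages, and the cost `c` per unit of time spent in stage 1. -/
structure Params where
  α : ℝ
  H : ℝ
  μ : ℝ
  p₁ : ℝ
  p₂ : ℝ
  c : ℝ

/-- What a firm does at a given time. A firm without a solution leaves the game under `exit` and
stays otherwise. A firm holding an undisclosed solution discloses it under `disclose` and
keeps it otherwise (such a firm never leaves the game). -/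
inductive Action where
  | disclose : Action
  | withhold : Action
  | exit : Action

/-- A piecewise continuous strategy: there are finitely many cutoffs between which the action does
not change. The action at a cutoff is, by normalization, that of the region which starts there.
Only times `t ≥ 0` matter. -/
structure Strategy where
  act : ℝ → Action
  piecewise : ∃ S : Finset ℝ, ∀ s t : ℝ, 0 ≤ s → s ≤ t → (∀ u ∈ S, u ≤ s ∨ t < u) → act s = act t

/-- The first time from `s` on at which the strategy prescribes the action `k` (`⊤` if there is
none). -/
def Strategy.next (σ : Strategy) (k : Action) (s : EReal) : EReal :=
  sInf ((fun r : ℝ => (r : EReal)) '' {r : ℝ | s ≤ (r : EReal) ∧ σ.act r = k})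

/-- A strategy in which exit is final: an exit region extends to infinity. -/
def Strategy.ExitFinal (σ : Strategy) : Prop :=
  ∀ s t : ℝ, 0 ≤ s → s ≤ t → σ.act s = Action.exit → σ.act t = Action.exit

/-- The disclose-withhold-exit strategy with cutoffs `t₁` and `t₂`. -/
def discloseWithholdExit (t₁ t₂ : ℝ) : Strategy where
  act t := if t < t₁ then Action.disclose else if t < t₂ then Action.withhold else Action.exit
  piecewise := by
    refine ⟨{t₁, t₂}, fun s t _ hst h => ?_⟩
    have h1 := h t₁ (by simp)
    have h2 := h t₂ (by simp)
    have e1 : s < t₁ ↔ t < t₁ := by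
      constructor <;> intro h3 <;> rcases h1 with h1 | h1 <;> linarith
    have e2 : s < t₂ ↔ t < t₂ := by
      constructor <;> intro h3 <;> rcases h2 with h2 | h2 <;> linarith
    simp only [e1, e2]

/-! ### One play of the game

A firm is described by its exit time `τ` (used if it has no solution by then), the time `x`
at which it would solve stage 1 (`⊤` if stage 1 is unsolvable), the time `d` at which it would
disclose the solution found at `x`, and the time `y` that it needs for stage 2. -/

/-- The time at which a firm would make its solution of stage 1 public if its rival never did: at its
planned disclosure time or when it completes stage 2, whichever comes first; `⊤` if it
leaves before solving stage 1. -/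
def announceTime (τ d x : EReal) (y : ℝ) : EReal :=
  if x < τ then min d (x + (y : EReal)) else ⊤

/-- The firm has itself solved stage 1 by the time `a` (before having left the game). -/
def SolvedBy (τ x a : EReal) : Prop := x < τ ∧ x ≤ a

open Classical in
/-- The time at which a firm completes stage 2 if stage 1 becomes public at time `a`: it works on
stage 2 from the moment it solves stage 1, or else from time `a` on provided that it is still
in the game then. -/
def finishTime (τ x : EReal) (y : ℝ) (a : EReal) : EReal :=
  if SolvedBy τ x a then x + (y : EReal) else if a < τ then a + (y : EReal) else ⊤

open Classical in
/-- The total reward of a firm (unprimed data) against a rival (primed data). When stage 1 becomes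
public, `p₁` goes to the firm which has solved it and is split if both have; `p₂` goes
to the first firm which completes stage 2. -/
def reward (P : Params) (τ d x : EReal) (y : ℝ) (τ' d' x' : EReal) (y' : ℝ) : ℝ :=
  let a := min (announceTime τ d x y) (announceTime τ' d' x' y')
  (if SolvedBy τ x a then (if SolvedBy τ' x' a then P.p₁ / 2 else P.p₁) else 0) +
    (if finishTime τ x y a < finishTime τ' x' y' a then P.p₂ else 0)

/-- The time which a firm, being in stage 1 at time `t`, still spends (and pays for) in stage 1:
until it solves stage 1, it leaves, or the rival makes the solution public. -/
def stageOneTime (t : ℝ) (τ x : EReal) (a' : EReal) : ℝ≥0∞ :=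
  (min x (min τ a') - (t : EReal)).toENNReal

/-! ### The law of the arrival times -/

/-- The law of the stage 1 success time of a firm when stage 1 is solvable. -/
def stageOneLaw (P : Params) : Measure EReal :=
  (expMeasure P.H).map (fun x : ℝ => (x : EReal))

/-- The law of the two pairs `(x, y)` of the two firms if `κ` is the law of each `x`. -/
def jointLaw (P : Params) (κ : Measure EReal) : Measure ((EReal × ℝ) × (EReal × ℝ)) :=
  (κ.prod (expMeasure P.μ)).prod (κ.prod (expMeasure P.μ))

/-- The prior law: stage 1 is solvable with probability `α`, and otherwise it is never solved. -/
def prior (P : Params) : Measure ((EReal × ℝ) × (EReal × ℝ)) :=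
  ENNReal.ofReal P.α • jointLaw P (stageOneLaw P) +
    ENNReal.ofReal (1 - P.α) • jointLaw P (Measure.dirac ⊤)

/-- The time at which a rival using the strategy `σ` would make its solution public. -/
def rivalAnnounce (σ : Strategy) (b : EReal × ℝ) : EReal :=
  announceTime (σ.next Action.exit 0) (σ.next Action.disclose b.1) b.1 b.2

/-- The reward of a firm with data `τ`, `d`, `x`, `y` against a rival using `σ` whose arrival
times are `b`. -/
def rewardAgainst (P : Params) (σ : Strategy) (τ d x : EReal) (y : ℝ) (b : EReal × ℝ) : ℝ :=
  reward P τ d x y (σ.next Action.exit 0) (σ.next Action.disclose b.1) b.1 b.2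

/-! ### Continuation payoffs and equilibrium -/

/-- The information of a firm which has not solved stage 1 by time `t`: neither has it solved
stage 1, nor has the rival (which uses `σ`) made a solution public, before `t`. -/
def unsolvedInfo (σ : Strategy) (t : ℝ) : Set ((EReal × ℝ) × (EReal × ℝ)) :=
  {w | (t : EReal) ≤ w.1.1 ∧ (t : EReal) ≤ rivalAnnounce σ w.2}

/-- The expected continuation payoff at time `t` of a firm without a solution which plans to exit
at `τ` and to disclose at `d x` a solution found at `x`, against a rival using `σ`. It is `⊥`
if the expected cost is infinite. -/
def unsolvedPayoff (P : Params) (σ : Strategy) (t : ℝ) (τ : EReal) (d : EReal → EReal) : EReal :=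
  ((∫ w, rewardAgainst P σ τ (d w.1.1) w.1.1 w.1.2 w.2 ∂(cond (prior P) (unsolvedInfo σ t)) : ℝ)
      : EReal) -
    ((ENNReal.ofReal P.c *
      ∫⁻ w, stageOneTime t τ w.1.1 (rivalAnnounce σ w.2)
        ∂(cond (prior P) (unsolvedInfo σ t)) : ℝ≥0∞) : EReal)

/-- The information at time `t` of a firm which holds a solution found at time `s` (so that it
knows stage 1 to be solvable): neither has it completed stage 2, nor has the rival made a
solution public, before `t`. The coordinates are its own `y` and the rival's `(x, y)`. -/
def solvedInfo (σ : Strategy) (s t : ℝ) : Set (ℝ × (EReal × ℝ)) :=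
  {w | t ≤ s + w.1 ∧ (t : EReal) ≤ rivalAnnounce σ w.2}

/-- The expected continuation payoff at time `t` of a firm holding an undisclosed solution found at
time `s` which plans to disclose it at time `d`, against a rival using `σ`. -/
def solvedPayoff (P : Params) (σ : Strategy) (s t : ℝ) (d : EReal) : ℝ :=
  ∫ w, rewardAgainst P σ ⊤ d s w.1 w.2
    ∂(cond ((expMeasure P.μ).prod ((stageOneLaw P).prod (expMeasure P.μ))) (solvedInfo σ s t))

/-- `σ`, used by both firms, is an equilibrium: at every time `t ≥ 0`, whether or not the
firm has solved stage 1, following `σ` from `t` on is at least as good as every other plan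
when the rival uses `σ`. -/
def IsEquilibrium (P : Params) (σ : Strategy) : Prop :=
  (∀ t : ℝ, 0 ≤ t → ∀ (τ : EReal) (d : EReal → EReal), (t : EReal) ≤ τ → Measurable d →
      (∀ x, x ≤ d x) →
      unsolvedPayoff P σ t τ d ≤
        unsolvedPayoff P σ t (σ.next Action.exit t) (σ.next Action.disclose)) ∧
  (∀ s t : ℝ, 0 ≤ s → s ≤ t → ∀ d : EReal, (t : EReal) ≤ d →
      solvedPayoff P σ s t d ≤ solvedPayoff P σ s t (σ.next Action.disclose t))

/-! ### The parameter assumptions and the cutoffs -/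

/-- The ratio `H (p₁ + p₂) / (p₁ H - p₂ μ)`. -/
def ratio (P : Params) : ℝ := P.H * (P.p₁ + P.p₂) / (P.p₁ * P.H - P.p₂ * P.μ)

/-- The third parameter assumption; for `H = μ` it is read as its limit. -/
def A3 (P : Params) : Prop :=
  (P.H ≠ P.μ →
    P.H * (P.p₁ + P.p₂) *
          ((P.H / 2 - P.μ) / (P.H - P.μ) * ratio P ^ (-(P.H / (P.H + P.μ))) +
            (P.H / 2) / (P.H - P.μ) * ratio P ^ (-(P.μ / (P.H + P.μ)))) / P.c +
        P.μ / (P.H - P.μ) * ratio P ^ (-(P.H / (P.H + P.μ))) -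
        P.H / (P.H - P.μ) * ratio P ^ (-(P.μ / (P.H + P.μ))) ≥
      ratio P ^ (P.H / (P.H + P.μ))) ∧
  (P.H = P.μ →
    P.H * (P.p₁ + P.p₂) *
          ((1 + Real.log (ratio P) / 4) * ratio P ^ (-(1 / 2) : ℝ)) / P.c -
        (1 + Real.log (ratio P) / 2) * ratio P ^ (-(1 / 2) : ℝ) ≥
      ratio P ^ (1 / 2 : ℝ))

/-- The length of a full withhold region. -/
def withholdLength (P : Params) : ℝ := Real.log (ratio P) / (P.H + P.μ)

/-- The probability, when stage 1 is solvable, that a firm which starts on stage 1 solves it within a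
time span `u` but does not complete stage 2 within it. -/
def hiddenSuccess (P : Params) (u : ℝ) : ℝ :=
  ∫ s in (0 : ℝ)..u, P.H * Real.exp (-P.H * s) * Real.exp (-(u - s) * P.μ)

/-- The belief, at time `t` in the withhold region starting at `t₁`, that stage 1 is solvable. -/
def belief (P : Params) (t₁ t : ℝ) : ℝ :=
  P.α * Real.exp (-2 * P.H * t₁ - P.H * (t - t₁)) *
      (Real.exp (-P.H * (t - t₁)) + hiddenSuccess P (t - t₁)) /
    (P.α * Real.exp (-2 * P.H * t₁ - P.H * (t - t₁)) *
        (Real.exp (-P.H * (t - t₁)) + hiddenSuccess P (t - t₁)) + 1 - P.α)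

/-- The exit-indifference condition at `t`: the cost per unit of time equals the expected gain
per unit of time from staying. -/
def ExitIndifference (P : Params) (t₁ t : ℝ) : Prop :=
  P.c = belief P t₁ t * P.H *
    (((P.p₁ + P.p₂) * Real.exp (-P.H * (t - t₁)) +
        (P.p₁ + P.p₂) / 2 * hiddenSuccess P (t - t₁)) /
      (Real.exp (-P.H * (t - t₁)) + hiddenSuccess P (t - t₁)))

end RDGame

end

/-!
Payoffs are compared without dividing by the probability of the firm's information, which is
common to all plans. Let `T` be the time at which the rival leaves if it has no solution,
`p = p₁ + p₂`, and `Δ = withholdLength P`.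

*A firm with a solution.* Suppose that it is at time `x < T`. If the rival hides a solution too,
the firms are in the same position and nothing that the firm does matters. If the rival is in
stage 1, disclosing at once is worth `p₁ + p₂ / 2`, since the rival then starts on stage 2 with
the same chances. Disclosing later but before `T` is worse, by the second assumption
(`solvedGain_lt_now`), and keeping the solution until `T` is worth `waitValue P (T - x)`: the firm
takes both prizes unless the rival catches up. The function `waitValue` is strictly antitone and
equals `p₁ + p₂ / 2` at `Δ` (`waitValue_withholdLength`). So the firm discloses if `T - x > Δ` and
withholds if `T - x < Δ`, and this determines the strategy before `T` (`act_eq_of_lt_exit`).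

*A firm without a solution.* By Tonelli's theorem, its gain from staying on `[t, τ)` is the
integral of an explicit function, its `flow` (`integral_flow`), which is a positive multiple of
the expected net gain per unit of time. At `T` the flow is `α * threshold P T - c (1 - α)`, and it
vanishes exactly if the exit-indifference condition holds (`exitIndifference_iff`). The flow is
nonnegative before `T` and nonpositive after it (`isEquilibrium_discloseWithholdExit`). The
difficulty here is that `p H / 2 - c` may be negative, so that the gain from staying can rise as
hidden solutions disappear. Since `μ * hiddenSuccess P u ≤ H`, it rises no faster than
`(c / 2) exp (H u)`, and the third assumption, which says that `exitGain P Δ ≥ c exp (H Δ)`, makes the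
gain, multiplied by the probability `exp (-H u)` that the firm is still in stage 1, decrease
nevertheless (`exp_mul_exitGain_strictAnti`, `exitGain_le_stayGain`).

For the same reason `threshold P` is strictly antitone. It starts above `c (1 - α) / α` by the
first assumption and tends to zero, hence the exit time exists and is unique. At `Δ` it is at
least `c`, so the exit time is at least `Δ` if `α ≥ 1 / 2`.

*Uniqueness.* In an equilibrium a firm without a solution leaves at a finite time `T`, since stage
1 may be unsolvable and never leaving would then cost an infinite amount
(`exists_exit_of_isEquilibrium`). The optimality of disclosure determines the strategy before `T`,
and the deviations to an exit slightly before or after `T` force the flow to vanish at `T`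
(`threshold_of_isEquilibrium`).
-/

namespace RDGame

/-! ### Integrals against exponential laws -/

lemma integral_expMeasure {r : ℝ} (hr : 0 < r) (f : ℝ → ℝ) :
    ∫ x, f x ∂expMeasure r = ∫ x in Set.Ioi 0, r * Real.exp (-r * x) * f x := by
  have h1 : expMeasure r = volume.withDensity (exponentialPDF r) := rfl
  have hm : Measurable (exponentialPDF r) :=
    ENNReal.measurable_ofReal.comp (measurable_exponentialPDFReal r)
  rw [h1, integral_withDensity_eq_integral_toReal_smul hm
    (by simp [exponentialPDF])]
  rw [← integral_Ici_eq_integral_Ioi, ← integral_indicator measurableSet_Ici]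
  congr 1
  ext x
  rw [exponentialPDF_eq]
  by_cases hx : 0 ≤ x
  · rw [Set.indicator_of_mem (by exact hx), if_pos hx, ENNReal.toReal_ofReal (by positivity)]
    simp
  · rw [Set.indicator_of_notMem (by exact hx), if_neg hx]
    simp

lemma ae_pos_expMeasure {r : ℝ} : ∀ᵐ x ∂expMeasure r, 0 < x := by
  have h1 : expMeasure r = volume.withDensity (exponentialPDF r) := rfl
  have hm : Measurable (exponentialPDF r) :=
    ENNReal.measurable_ofReal.comp (measurable_exponentialPDFReal r)
  rw [h1, ae_withDensity_iff hm]
  have h0 : ∀ᵐ x : ℝ, x ≠ 0 := by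
    simp [ae_iff]
  filter_upwards [h0] with x hx h
  by_contra hn
  have hx' : x < 0 := lt_of_le_of_ne (not_lt.1 hn) hx
  exact h (exponentialPDF_of_neg hx')

/-- The memoryless property of the exponential law. -/
lemma integral_expMeasure_memoryless {r : ℝ} (hr : 0 < r) {a : ℝ} (ha : 0 ≤ a) (f : ℝ → ℝ) :
    ∫ x, (if a ≤ x then f x else 0) ∂expMeasure r =
      Real.exp (-r * a) * ∫ x, f (a + x) ∂expMeasure r := by
  rw [integral_expMeasure hr, integral_expMeasure hr, ← integral_const_mul,
    ← integral_Ici_eq_integral_Ioi, ← integral_Ici_eq_integral_Ioi,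
    ← integral_indicator measurableSet_Ici, ← integral_indicator measurableSet_Ici,
    ← integral_add_right_eq_self _ a]
  congr 1
  ext x
  by_cases hx : 0 ≤ x
  · have h1 : Real.exp (-r * (x + a)) = Real.exp (-r * a) * Real.exp (-r * x) := by
      rw [← Real.exp_add]; congr 1; ring
    have h2 : 0 ≤ x + a := by linarith
    have h3 : a ≤ x + a := by linarith
    simp only [Set.indicator, Set.mem_Ici, h2, h3, hx, if_true]
    rw [h1, add_comm x a]
    ring
  · simp [Set.indicator, hx]

lemma integral_expMeasure_Ico {r : ℝ} (hr : 0 < r) {a b : ℝ} (ha : 0 ≤ a) (hab : a ≤ b)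
    (f : ℝ → ℝ) :
    ∫ x, (if a ≤ x ∧ x < b then f x else 0) ∂expMeasure r =
      ∫ x in a..b, r * Real.exp (-r * x) * f x := by
  rw [integral_expMeasure hr, intervalIntegral.integral_of_le hab,
    ← integral_Ico_eq_integral_Ioc, ← integral_Ici_eq_integral_Ioi,
    ← integral_indicator measurableSet_Ici, ← integral_indicator measurableSet_Ico]
  congr 1
  ext x
  by_cases hx : a ≤ x ∧ x < b
  · simp [Set.indicator, hx, ha.trans hx.1]
  · simp [Set.indicator, hx]

lemma integral_exp_expMeasure {r s : ℝ} (hr : 0 < r) (hs : 0 ≤ s) :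
    ∫ x, Real.exp (-s * x) ∂expMeasure r = r / (r + s) := by
  rw [integral_expMeasure hr]
  have h1 : ∀ x : ℝ, r * Real.exp (-r * x) * Real.exp (-s * x) = r * Real.exp (-(r + s) * x) := by
    intro x
    rw [mul_assoc, ← Real.exp_add]; ring_nf
  simp only [h1]
  rw [integral_const_mul, integral_exp_mul_Ioi (by linarith)]
  have h2 : r + s ≠ 0 := by positivity
  have h3 : -(r + s) ≠ 0 := neg_ne_zero.2 h2
  simp only [mul_zero, Real.exp_zero]
  field_simp

lemma integral_expMeasure_lt {r : ℝ} (hr : 0 < r) {b : ℝ} (hb : 0 ≤ b) (A : ℝ) :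
    ∫ x, (if x < b then A else 0) ∂expMeasure r = A * (1 - Real.exp (-r * b)) := by
  have := isProbabilityMeasure_expMeasure hr
  have h1 : ∀ᵐ x ∂expMeasure r, (if x < b then A else 0) = A - (if b ≤ x then A else 0) := by
    refine Filter.Eventually.of_forall fun x => ?_
    by_cases hx : x < b
    · simp [hx, not_le.2 hx]
    · simp [hx, not_lt.1 hx]
  rw [integral_congr_ae h1, integral_sub (integrable_const _), integral_expMeasure_memoryless hr hb]
  · simp; ring
  · exact (integrable_const A).indicator measurableSet_Ici

/-- The probability that two independent exponential variables with the same rate are in a given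
order is `1 / 2`; the lead `b` of one of them enters through the memoryless property. -/
lemma integral_race {r : ℝ} (hr : 0 < r) {b : ℝ} (hb : 0 ≤ b) (A B C : ℝ) :
    ∫ z, ∫ y, (if y < b then A else B + if y < b + z then C else 0) ∂expMeasure r ∂expMeasure r =
      A * (1 - Real.exp (-r * b)) + Real.exp (-r * b) * (B + C / 2) := by
  have := isProbabilityMeasure_expMeasure hr
  have h1 : ∀ᵐ z ∂expMeasure r,
      ∫ y, (if y < b then A else B + if y < b + z then C else 0) ∂expMeasure r =
        (A - B - C) * (1 - Real.exp (-r * b)) + B + C -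
          C * Real.exp (-r * b) * Real.exp (-r * z) := by
    filter_upwards [ae_pos_expMeasure] with z hz
    have h2 : ∀ y : ℝ, (if y < b then A else B + if y < b + z then C else 0) =
        ((if y < b then A - B - C else 0) + (if y < b + z then C else 0)) + B := by
      intro y
      by_cases h : y < b
      · simp [h, h.trans (by linarith : b < b + z)]
      · simp [h]; ring
    simp only [h2]
    rw [integral_add, integral_add, integral_expMeasure_lt hr hb,
      integral_expMeasure_lt hr (by linarith)]
    · have : Real.exp (-r * (b + z)) = Real.exp (-r * b) * Real.exp (-r * z) := by
        rw [← Real.exp_add]; congr 1; ring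
      rw [this]
      simp only [integral_const, probReal_univ, smul_eq_mul, one_mul]
      ring
    · exact (integrable_const (A - B - C)).indicator measurableSet_Iio
    · exact (integrable_const C).indicator measurableSet_Iio
    · exact ((integrable_const (A - B - C)).indicator measurableSet_Iio).add
        ((integrable_const C).indicator measurableSet_Iio)
    · exact integrable_const _
  rw [integral_congr_ae h1, integral_sub (integrable_const _), integral_const_mul,
    integral_exp_expMeasure hr hr.le]
  · simp
    field_simp
    ring
  · refine Integrable.const_mul ?_ _
    refine Integrable.of_bound (C := 1) (by fun_prop) ?_
    filter_upwards [ae_pos_expMeasure] with z hz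
    rw [Real.norm_eq_abs, abs_of_pos (Real.exp_pos _)]
    exact Real.exp_le_one_iff.2 (by nlinarith)

lemma integral_race_behind {r : ℝ} (hr : 0 < r) {a : ℝ} (ha : 0 ≤ a) (B C : ℝ) :
    ∫ z, ∫ y, (if a ≤ z then B + (if a + y < z then C else 0) else 0) ∂expMeasure r ∂expMeasure r =
      Real.exp (-r * a) * (B + C / 2) := by
  have := isProbabilityMeasure_expMeasure hr
  have h1 : ∀ z : ℝ,
      ∫ y, (if a ≤ z then B + (if a + y < z then C else 0) else 0) ∂expMeasure r =
      if a ≤ z then ∫ y, (B + (if a + y < z then C else 0)) ∂expMeasure r else 0 := by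
    intro z
    by_cases h : a ≤ z <;> simp [h]
  simp only [h1]
  rw [integral_expMeasure_memoryless hr ha
    (fun z => ∫ y, (B + (if a + y < z then C else 0)) ∂expMeasure r)]
  have h2 := integral_race hr le_rfl 0 B C
  have h3 : ∀ᵐ z ∂expMeasure r, ∫ y, (B + (if a + y < a + z then C else 0)) ∂expMeasure r =
      ∫ y, (if y < 0 then 0 else B + if y < 0 + z then C else 0) ∂expMeasure r := by
    refine Filter.Eventually.of_forall fun z => integral_congr_ae ?_
    filter_upwards [ae_pos_expMeasure] with y hy
    simp [hy.le]
  rw [integral_congr_ae h3, h2]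
  simp

/-! ### One play of the game -/

lemma announceTime_top (d : EReal) (x y : ℝ) :
    announceTime ⊤ d x y = min d ((x + y : ℝ) : EReal) := by
  simp [announceTime]

lemma announceTime_of_lt {T d : EReal} {x : EReal} (h : x < T) (y : ℝ) :
    announceTime T d x y = min d (x + (y : EReal)) := if_pos h

lemma announceTime_of_le {T d : EReal} {x : EReal} (h : T ≤ x) (y : ℝ) :
    announceTime T d x y = ⊤ := if_neg (not_lt.2 h)

lemma finishTime_of_solvedBy {τ x a : EReal} (h : SolvedBy τ x a) (y : ℝ) :
    finishTime τ x y a = x + (y : EReal) := if_pos h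

lemma finishTime_of_lt {τ x a : EReal} (h : ¬ SolvedBy τ x a) (h' : a < τ) (y : ℝ) :
    finishTime τ x y a = a + (y : EReal) := by
  rw [finishTime, if_neg h, if_pos h']

lemma finishTime_of_le {τ x a : EReal} (h : ¬ SolvedBy τ x a) (h' : τ ≤ a) (y : ℝ) :
    finishTime τ x y a = ⊤ := by
  rw [finishTime, if_neg h, if_neg (not_lt.2 h')]

open Classical in
lemma reward_eq (P : Params) {τ d x τ' d' x' a : EReal} {y y' : ℝ}
    (ha : a = min (announceTime τ d x y) (announceTime τ' d' x' y')) :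
    reward P τ d x y τ' d' x' y' =
      (if SolvedBy τ x a then (if SolvedBy τ' x' a then P.p₁ / 2 else P.p₁) else 0) +
        (if finishTime τ x y a < finishTime τ' x' y' a then P.p₂ else 0) := by
  subst ha
  rfl

/-- If the rival found a solution before `x`, then the two firms are in the same position from `x`
on. -/
lemma reward_of_rival_ahead (P : Params) {x y x' y' : ℝ} {δ T d' : EReal} (hδ : (x : EReal) ≤ δ)
    (hy : 0 < y) (hx' : x' < x) (hT : (x' : EReal) < T) :
    (if (x : EReal) ≤ announceTime T d' x' y' then reward P ⊤ δ x y T d' x' y' else 0) =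
      if (x : EReal) ≤ d' then
        (if x - x' ≤ y' then P.p₁ / 2 + (if x - x' + y < y' then P.p₂ else 0) else 0) else 0 := by
  rw [announceTime_of_lt hT]
  by_cases h1 : (x : EReal) ≤ d'
  swap
  · rw [if_neg h1, if_neg]
    intro h
    exact h1 (h.trans (min_le_left _ _))
  rw [if_pos h1]
  by_cases h2 : x - x' ≤ y'
  swap
  · rw [if_neg h2, if_neg]
    intro h
    have := h.trans (min_le_right _ _)
    rw [← EReal.coe_add, EReal.coe_le_coe_iff] at this
    exact h2 (by linarith)
  have h3 : (x : EReal) ≤ min d' ((x' : EReal) + (y' : EReal)) := by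
    refine le_min h1 ?_
    rw [← EReal.coe_add, EReal.coe_le_coe_iff]
    linarith
  have h4 : (x : EReal) ≤ min (announceTime ⊤ δ x y) (announceTime T d' x' y') := by
    rw [announceTime_top, announceTime_of_lt hT]
    refine le_min (le_min hδ ?_) h3
    rw [EReal.coe_le_coe_iff]
    linarith
  have h5 : SolvedBy ⊤ (x : EReal) (min (announceTime ⊤ δ x y) (announceTime T d' x' y')) :=
    ⟨EReal.coe_lt_top _, h4⟩
  have h6 : SolvedBy T (x' : EReal) (min (announceTime ⊤ δ x y) (announceTime T d' x' y')) :=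
    ⟨hT, le_trans (by exact_mod_cast hx'.le) h4⟩
  rw [if_pos h2, if_pos h3]
  rw [reward_eq P rfl, if_pos h5, if_pos h6, finishTime_of_solvedBy h5, finishTime_of_solvedBy h6]
  congr 1
  refine if_congr ?_ rfl rfl
  rw [← EReal.coe_add, ← EReal.coe_add, EReal.coe_lt_coe_iff]
  constructor <;> intro h <;> linarith

lemma le_announceTime {x x' y' : ℝ} {T d' : EReal} (hd' : (x' : EReal) ≤ d') (hy' : 0 < y')
    (h : x ≤ x' ∨ T ≤ (x' : EReal)) : (x : EReal) ≤ announceTime T d' x' y' := by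
  by_cases hT : (x' : EReal) < T
  · rcases h with h | h
    · rw [announceTime_of_lt hT]
      have : (x : EReal) ≤ (x' : EReal) := by exact_mod_cast h
      refine le_min (this.trans hd') ?_
      rw [← EReal.coe_add, EReal.coe_le_coe_iff]
      linarith
    · exact absurd hT (not_lt.2 h)
  · rw [announceTime_of_le (not_lt.1 hT)]
    exact le_top

/-- If the rival leaves without a solution before the disclosure, then the firm gets both prizes. -/
lemma reward_of_rival_exited (P : Params) {x y x' y' : ℝ} {δ T d' : EReal} (hδ : (x : EReal) ≤ δ)
    (hy : 0 < y) (hy' : 0 < y') (hx' : T ≤ (x' : EReal)) (hδ' : T ≤ δ) :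
    reward P ⊤ δ x y T d' x' y' = P.p₁ + P.p₂ := by
  set a := min (announceTime ⊤ δ x y) (announceTime T d' x' y') with ha
  have ha' : a = min δ ((x + y : ℝ) : EReal) := by
    rw [ha, announceTime_of_le hx', announceTime_top, min_eq_left le_top]
  have h5 : SolvedBy ⊤ (x : EReal) a := by
    refine ⟨EReal.coe_lt_top _, ?_⟩
    rw [ha']
    refine le_min hδ ?_
    rw [EReal.coe_le_coe_iff]
    linarith
  have h6 : ¬ SolvedBy T (x' : EReal) a := fun h => not_lt.2 hx' h.1
  have h7 : (x : EReal) + (y : EReal) < finishTime T x' y' a := by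
    by_cases h : a < T
    · have h8 : ¬ δ ≤ ((x + y : ℝ) : EReal) := by
        intro h8
        rw [ha', min_eq_left h8] at h
        exact not_lt.2 hδ' h
      rw [finishTime_of_lt h6 h, ha', min_eq_right (not_le.1 h8).le, ← EReal.coe_add,
        ← EReal.coe_add, EReal.coe_lt_coe_iff]
      linarith
    · rw [finishTime_of_le h6 (not_lt.1 h), ← EReal.coe_add]
      exact EReal.coe_lt_top _
  rw [reward_eq P ha, if_pos h5, if_neg h6, finishTime_of_solvedBy h5, if_pos h7]

/-- If the planned disclosure precedes the rival's success and exit, the firm earns `p₁` alone and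
then competes for `p₂` from the time of the announcement on. -/
lemma reward_of_disclose_first (P : Params) {x y x' y' δ : ℝ} {T d' : EReal}
    (hd' : (x' : EReal) ≤ d') (hδ : x ≤ δ) (hy : 0 < y) (hy' : 0 < y')
    (hx' : δ < x') (hT : (δ : EReal) < T) :
    reward P ⊤ δ x y T d' x' y' =
      if y < δ - x then P.p₁ + P.p₂ else P.p₁ + if y < δ - x + y' then P.p₂ else 0 := by
  set a := min (announceTime ⊤ δ x y) (announceTime T d' x' y') with ha
  have ha' : a = ((min δ (x + y) : ℝ) : EReal) := by
    rw [ha, announceTime_top, ← EReal.coe_strictMono.monotone.map_min]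
    refine min_eq_left (le_trans ?_ (le_announceTime hd' hy' (Or.inl le_rfl)))
    rw [EReal.coe_le_coe_iff]
    exact (min_le_left _ _).trans hx'.le
  have h5 : SolvedBy ⊤ (x : EReal) a := by
    refine ⟨EReal.coe_lt_top _, ?_⟩
    rw [ha', EReal.coe_le_coe_iff]
    exact le_min hδ (by linarith)
  have h6 : ¬ SolvedBy T (x' : EReal) a := by
    intro h
    have := h.2
    rw [ha', EReal.coe_le_coe_iff] at this
    linarith [min_le_left δ (x + y)]
  have h7 : a < T := by
    refine lt_of_le_of_lt ?_ hT
    rw [ha', EReal.coe_le_coe_iff]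
    exact min_le_left _ _
  rw [reward_eq P ha, if_pos h5, if_neg h6, finishTime_of_solvedBy h5, finishTime_of_lt h6 h7,
    ha', ← EReal.coe_add,
    ← EReal.coe_add]
  simp only [EReal.coe_lt_coe_iff]
  by_cases h : y < δ - x
  · rw [if_pos h, if_pos]
    rw [min_eq_right (by linarith)]
    linarith
  · rw [if_neg h, min_eq_left (by linarith)]
    congr 1
    refine if_congr ?_ rfl rfl
    constructor <;> intro h <;> linarith

/-- If the rival solves stage 1 before the planned disclosure, the firm earns both prizes when it
completes stage 2 before that, and is in the same position as its rival otherwise. -/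
lemma reward_of_rival_success (P : Params) {x y x' y' : ℝ} {δ T d' : EReal}
    (hd' : (x' : EReal) ≤ d') (hxx' : x ≤ x') (hy : 0 < y) (hy' : 0 < y')
    (hx' : (x' : EReal) < T) (hδ : (x' : EReal) ≤ δ) :
    reward P ⊤ δ x y T d' x' y' =
      if y < x' - x then P.p₁ + P.p₂ else P.p₁ / 2 + if y < x' - x + y' then P.p₂ else 0 := by
  set a := min (announceTime ⊤ δ x y) (announceTime T d' x' y') with ha
  have h4 : (x' : EReal) ≤ announceTime T d' x' y' := le_announceTime hd' hy' (Or.inl le_rfl)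
  have h5 : SolvedBy ⊤ (x : EReal) a := by
    refine ⟨EReal.coe_lt_top _, ?_⟩
    have h8 : (x : EReal) ≤ x' := by exact_mod_cast hxx'
    rw [ha, announceTime_top]
    refine le_min (le_min (h8.trans hδ) ?_) (h8.trans h4)
    rw [EReal.coe_le_coe_iff]
    linarith
  rw [reward_eq P ha]
  by_cases h : y < x' - x
  · have h9 : ((x + y : ℝ) : EReal) < x' := by
      rw [EReal.coe_lt_coe_iff]
      linarith
    have ha' : a = ((x + y : ℝ) : EReal) := by
      rw [ha, announceTime_top, min_eq_right (h9.le.trans hδ), min_eq_left (h9.le.trans h4)]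
    have h6 : ¬ SolvedBy T (x' : EReal) a := by
      intro h
      have := h.2
      rw [ha'] at this
      exact not_lt.2 this h9
    have h7 : a < T := by
      rw [ha']
      exact h9.trans hx'
    rw [if_pos h5, if_neg h6, finishTime_of_solvedBy h5, finishTime_of_lt h6 h7,
    ha', ← EReal.coe_add,
      ← EReal.coe_add, if_pos h, if_pos (EReal.coe_lt_coe_iff.2 (by linarith))]
  · have h6 : SolvedBy T (x' : EReal) a := by
      refine ⟨hx', ?_⟩
      rw [ha, announceTime_top]
      refine le_min (le_min hδ ?_) h4
      rw [EReal.coe_le_coe_iff]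
      linarith
    rw [if_pos h5, if_pos h6, finishTime_of_solvedBy h5, finishTime_of_solvedBy h6, if_neg h,
      ← EReal.coe_add, ← EReal.coe_add]
    simp only [EReal.coe_lt_coe_iff]
    congr 1
    refine if_congr ?_ rfl rfl
    constructor <;> intro h <;> linarith

/-! ### Measurability and boundedness of the payoffs -/

lemma Strategy.le_next (σ : Strategy) (k : Action) (s : EReal) : s ≤ σ.next k s := by
  refine le_sInf ?_
  rintro _ ⟨r, hr, rfl⟩
  exact hr.1

lemma Strategy.next_mono (σ : Strategy) (k : Action) : Monotone (σ.next k) := by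
  intro s t hst
  refine sInf_le_sInf (Set.image_mono ?_)
  rintro r ⟨h1, h2⟩
  exact ⟨hst.trans h1, h2⟩

lemma Strategy.measurable_next (σ : Strategy) (k : Action) : Measurable (σ.next k) :=
  (σ.next_mono k).measurable

section Measurability

variable {β : Type*} [MeasurableSpace β]

lemma measurable_announceTime {τ d x : β → EReal} {y : β → ℝ} (hτ : Measurable τ)
    (hd : Measurable d) (hx : Measurable x) (hy : Measurable y) :
    Measurable fun b => announceTime (τ b) (d b) (x b) (y b) := by
  unfold announceTime
  exact Measurable.ite (measurableSet_lt hx hτ) (hd.min (hx.add hy.coe_real_ereal))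
    measurable_const

lemma measurableSet_solvedBy {τ x a : β → EReal} (hτ : Measurable τ) (hx : Measurable x)
    (ha : Measurable a) : MeasurableSet {b | SolvedBy (τ b) (x b) (a b)} :=
  (measurableSet_lt hx hτ).inter (measurableSet_le hx ha)

lemma measurable_finishTime {τ x a : β → EReal} {y : β → ℝ} (hτ : Measurable τ)
    (hx : Measurable x) (hy : Measurable y) (ha : Measurable a) :
    Measurable fun b => finishTime (τ b) (x b) (y b) (a b) := by
  unfold finishTime
  exact Measurable.ite (measurableSet_solvedBy hτ hx ha) (hx.add hy.coe_real_ereal)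
    (Measurable.ite (measurableSet_lt ha hτ) (ha.add hy.coe_real_ereal) measurable_const)

lemma measurable_reward (P : Params) {τ d x τ' d' x' : β → EReal} {y y' : β → ℝ}
    (hτ : Measurable τ) (hd : Measurable d) (hx : Measurable x) (hy : Measurable y)
    (hτ' : Measurable τ') (hd' : Measurable d') (hx' : Measurable x') (hy' : Measurable y') :
    Measurable fun b => reward P (τ b) (d b) (x b) (y b) (τ' b) (d' b) (x' b) (y' b) := by
  have ha : Measurable fun b =>
      min (announceTime (τ b) (d b) (x b) (y b)) (announceTime (τ' b) (d' b) (x' b) (y' b)) :=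
    (measurable_announceTime hτ hd hx hy).min (measurable_announceTime hτ' hd' hx' hy')
  unfold reward
  refine Measurable.add ?_ ?_
  · exact Measurable.ite (measurableSet_solvedBy hτ hx ha)
      (Measurable.ite (measurableSet_solvedBy hτ' hx' ha) measurable_const measurable_const)
      measurable_const
  · exact Measurable.ite (measurableSet_lt (measurable_finishTime hτ hx hy ha)
      (measurable_finishTime hτ' hx' hy' ha)) measurable_const measurable_const

lemma measurable_rivalAnnounce (σ : Strategy) : Measurable (rivalAnnounce σ) :=
  measurable_announceTime measurable_const ((σ.measurable_next _).comp measurable_fst)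
    measurable_fst measurable_snd

lemma measurable_rewardAgainst (P : Params) (σ : Strategy) {τ d x : β → EReal} {y : β → ℝ}
    {b : β → EReal × ℝ} (hτ : Measurable τ) (hd : Measurable d) (hx : Measurable x)
    (hy : Measurable y) (hb : Measurable b) :
    Measurable fun z => rewardAgainst P σ (τ z) (d z) (x z) (y z) (b z) :=
  measurable_reward P hτ hd hx hy measurable_const
    ((σ.measurable_next _).comp (measurable_fst.comp hb)) (measurable_fst.comp hb)
    (measurable_snd.comp hb)

end Measurability

lemma abs_reward_le (P : Params) (τ d x τ' d' x' : EReal) (y y' : ℝ) :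
    |reward P τ d x y τ' d' x' y'| ≤ |P.p₁| + |P.p₂| := by
  rw [reward_eq P rfl]
  refine (abs_add_le _ _).trans (add_le_add ?_ ?_)
  · have h : |P.p₁ / 2| ≤ |P.p₁| := by
      rw [abs_div, abs_two]
      linarith [abs_nonneg P.p₁]
    split_ifs <;> simp [h]
  · split_ifs <;> simp

lemma abs_rewardAgainst_le (P : Params) (σ : Strategy) (τ d x : EReal) (y : ℝ) (b : EReal × ℝ) :
    |rewardAgainst P σ τ d x y b| ≤ |P.p₁| + |P.p₂| := abs_reward_le ..

lemma ae_ne_expMeasure {r : ℝ} (b : ℝ) : ∀ᵐ x ∂expMeasure r, x ≠ b := by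
  have h1 : expMeasure r ≪ volume := withDensity_absolutelyContinuous _ _
  exact h1.ae_le (by simp [mem_ae_iff, Set.compl_ofPred])

lemma integral_expMeasure_le {r : ℝ} (hr : 0 < r) {b : ℝ} (hb : 0 ≤ b) (A : ℝ) :
    ∫ x, (if b ≤ x then A else 0) ∂expMeasure r = A * Real.exp (-r * b) := by
  have := isProbabilityMeasure_expMeasure hr
  rw [integral_expMeasure_memoryless hr hb]
  simp [mul_comm]

lemma integrable_of_measurable_of_bound {β : Type*} [MeasurableSpace β] {m : Measure β}
    [IsFiniteMeasure m] {f : β → ℝ} (hf : Measurable f) (C : ℝ) (hC : ∀ b, |f b| ≤ C) :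
    Integrable f m :=
  Integrable.of_bound hf.aestronglyMeasurable C (Filter.Eventually.of_forall hC)

lemma isProbabilityMeasure_stageOneLaw {P : Params} (hH : 0 < P.H) :
    IsProbabilityMeasure (stageOneLaw P) :=
  have := isProbabilityMeasure_expMeasure hH
  Measure.isProbabilityMeasure_map measurable_coe_real_ereal.aemeasurable

lemma integral_stageOneLaw (P : Params) (f : EReal → ℝ) :
    ∫ x, f x ∂stageOneLaw P = ∫ x : ℝ, f x ∂expMeasure P.H :=
  EReal.measurableEmbedding_coe.integral_map f

/-- Fubini's theorem, in the order in which the payoff of a firm with a solution is computed: the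
arrival time of the rival comes last. -/
lemma integral_solvedLaw {P : Params} (hH : 0 < P.H) (hμ : 0 < P.μ) {f : ℝ × (EReal × ℝ) → ℝ}
    (hf : Measurable f) (C : ℝ) (hC : ∀ b, |f b| ≤ C) :
    ∫ w, f w ∂((expMeasure P.μ).prod ((stageOneLaw P).prod (expMeasure P.μ))) =
      ∫ x' : ℝ, ∫ y', ∫ y, f (y, ((x' : EReal), y')) ∂expMeasure P.μ ∂expMeasure P.μ
        ∂expMeasure P.H := by
  have := isProbabilityMeasure_expMeasure hμ
  have := isProbabilityMeasure_stageOneLaw hH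
  have hi : Integrable f ((expMeasure P.μ).prod ((stageOneLaw P).prod (expMeasure P.μ))) :=
    integrable_of_measurable_of_bound hf C hC
  rw [integral_prod_symm f hi]
  rw [integral_prod _ hi.integral_prod_right, integral_stageOneLaw]

/-! ### The payoff of a firm with a solution -/

/-- The expected reward of a firm which hides a new solution from a rival that is still in stage 1
and leaves after the time span `v` unless it has solved stage 1 by then: both prizes, half of which
are lost if the rival solves stage 1 within `v` and before the firm completes stage 2. -/
noncomputable def waitValue (P : Params) (v : ℝ) : ℝ :=
  (P.p₁ + P.p₂) -
    (P.p₁ + P.p₂) / 2 * (P.H / (P.H + P.μ)) * (1 - Real.exp (-(P.H + P.μ) * v))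

/-- The probability, when stage 1 is solvable, that the rival holds an undisclosed solution at the
time `x` and has not completed stage 2. -/
noncomputable def rivalHidden (P : Params) (σ : Strategy) (x : ℝ) : ℝ :=
  ∫ x' : ℝ, (if x' < x ∧ (x' : EReal) < σ.next Action.exit 0 ∧
    (x : EReal) ≤ σ.next Action.disclose x' then Real.exp (-P.μ * (x - x')) else 0) ∂expMeasure P.H

/-- The expected reward of a firm which finds a solution at time `x` and plans to disclose it at
`δ`, on the event that the rival has announced nothing before `x`. -/
noncomputable def solvedGain (P : Params) (σ : Strategy) (x : ℝ) (δ : EReal) : ℝ :=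
  ∫ w, (if (x : EReal) ≤ rivalAnnounce σ w.2 then rewardAgainst P σ ⊤ δ x w.1 w.2 else 0)
    ∂((expMeasure P.μ).prod ((stageOneLaw P).prod (expMeasure P.μ)))

lemma solvedGain_integral {P : Params} (hH : 0 < P.H) (hμ : 0 < P.μ) (σ : Strategy) (x : ℝ)
    (δ : EReal) :
    solvedGain P σ x δ = ∫ x' : ℝ, ∫ y', ∫ y,
      (if (x : EReal) ≤ announceTime (σ.next Action.exit 0) (σ.next Action.disclose x') x' y' then
        reward P ⊤ δ x y (σ.next Action.exit 0) (σ.next Action.disclose x') x' y' else 0)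
        ∂expMeasure P.μ ∂expMeasure P.μ ∂expMeasure P.H := by
  rw [solvedGain, integral_solvedLaw hH hμ _ (|P.p₁| + |P.p₂|)]
  · rfl
  · intro b
    split_ifs
    · exact abs_rewardAgainst_le ..
    · simp; positivity
  · refine Measurable.ite ?_ ?_ measurable_const
    · exact measurableSet_le measurable_const ((measurable_rivalAnnounce σ).comp measurable_snd)
    · exact measurable_rewardAgainst P σ measurable_const measurable_const measurable_const
        measurable_fst measurable_snd

lemma integral_rival_ahead {P : Params} (hμ : 0 < P.μ) {x x' : ℝ} {δ T d' : EReal}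
    (hδ : (x : EReal) ≤ δ) (hx' : x' < x) (hT : (x' : EReal) < T) :
    ∫ y', ∫ y, (if (x : EReal) ≤ announceTime T d' x' y' then reward P ⊤ δ x y T d' x' y' else 0)
        ∂expMeasure P.μ ∂expMeasure P.μ =
      if (x : EReal) ≤ d' then (P.p₁ + P.p₂) / 2 * Real.exp (-P.μ * (x - x')) else 0 := by
  have h1 : ∀ y', ∫ y, (if (x : EReal) ≤ announceTime T d' x' y' then
        reward P ⊤ δ x y T d' x' y' else 0) ∂expMeasure P.μ =
      ∫ y, (if (x : EReal) ≤ d' then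
        (if x - x' ≤ y' then P.p₁ / 2 + (if x - x' + y < y' then P.p₂ else 0) else 0) else 0)
        ∂expMeasure P.μ := by
    intro y'
    refine integral_congr_ae ?_
    filter_upwards [ae_pos_expMeasure] with y hy
    exact reward_of_rival_ahead P hδ hy hx' hT
  simp only [h1]
  by_cases h : (x : EReal) ≤ d'
  · simp only [if_pos h]
    rw [integral_race_behind hμ (by linarith)]
    ring
  · simp [if_neg h]

lemma integral_rival_exited {P : Params} (hμ : 0 < P.μ) {x x' : ℝ} {δ T d' : EReal}
    (hδ : (x : EReal) ≤ δ) (hd' : (x' : EReal) ≤ d') (hx' : T ≤ (x' : EReal)) (hδ' : T ≤ δ) :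
    ∫ y', ∫ y, (if (x : EReal) ≤ announceTime T d' x' y' then reward P ⊤ δ x y T d' x' y' else 0)
        ∂expMeasure P.μ ∂expMeasure P.μ = P.p₁ + P.p₂ := by
  have := isProbabilityMeasure_expMeasure hμ
  have h1 : ∀ᵐ y' ∂expMeasure P.μ, ∫ y, (if (x : EReal) ≤ announceTime T d' x' y' then
        reward P ⊤ δ x y T d' x' y' else 0) ∂expMeasure P.μ = P.p₁ + P.p₂ := by
    filter_upwards [ae_pos_expMeasure] with y' hy'
    have h2 : ∀ᵐ y ∂expMeasure P.μ, (if (x : EReal) ≤ announceTime T d' x' y' then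
        reward P ⊤ δ x y T d' x' y' else 0) = P.p₁ + P.p₂ := by
      filter_upwards [ae_pos_expMeasure] with y hy
      rw [if_pos (le_announceTime hd' hy' (Or.inr hx')),
        reward_of_rival_exited P hδ hy hy' hx' hδ']
    rw [integral_congr_ae h2]
    simp
  rw [integral_congr_ae h1]
  simp

lemma integral_disclose_first {P : Params} (hμ : 0 < P.μ) {x x' δ : ℝ} {T d' : EReal}
    (hδ : x ≤ δ) (hd' : (x' : EReal) ≤ d') (hx' : δ < x') (hT : (δ : EReal) < T) :
    ∫ y', ∫ y, (if (x : EReal) ≤ announceTime T d' x' y' then reward P ⊤ δ x y T d' x' y' else 0)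
        ∂expMeasure P.μ ∂expMeasure P.μ =
      P.p₁ + P.p₂ - P.p₂ / 2 * Real.exp (-P.μ * (δ - x)) := by
  have h1 : ∀ᵐ y' ∂expMeasure P.μ, ∫ y, (if (x : EReal) ≤ announceTime T d' x' y' then
        reward P ⊤ δ x y T d' x' y' else 0) ∂expMeasure P.μ =
      ∫ y, (if y < δ - x then P.p₁ + P.p₂ else P.p₁ + if y < δ - x + y' then P.p₂ else 0)
        ∂expMeasure P.μ := by
    filter_upwards [ae_pos_expMeasure] with y' hy'
    refine integral_congr_ae ?_
    filter_upwards [ae_pos_expMeasure] with y hy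
    rw [if_pos (le_announceTime hd' hy' (Or.inl (by linarith))),
      reward_of_disclose_first P hd' hδ hy hy' hx' hT]
  rw [integral_congr_ae h1, integral_race hμ (by linarith)]
  ring

lemma integral_rival_success {P : Params} (hμ : 0 < P.μ) {x x' : ℝ} {δ T d' : EReal}
    (hd' : (x' : EReal) ≤ d') (hxx' : x ≤ x') (hx' : (x' : EReal) < T) (hδ : (x' : EReal) ≤ δ) :
    ∫ y', ∫ y, (if (x : EReal) ≤ announceTime T d' x' y' then reward P ⊤ δ x y T d' x' y' else 0)
        ∂expMeasure P.μ ∂expMeasure P.μ =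
      P.p₁ + P.p₂ - (P.p₁ + P.p₂) / 2 * Real.exp (-P.μ * (x' - x)) := by
  have h1 : ∀ᵐ y' ∂expMeasure P.μ, ∫ y, (if (x : EReal) ≤ announceTime T d' x' y' then
        reward P ⊤ δ x y T d' x' y' else 0) ∂expMeasure P.μ =
      ∫ y, (if y < x' - x then P.p₁ + P.p₂ else P.p₁ / 2 + if y < x' - x + y' then P.p₂ else 0)
        ∂expMeasure P.μ := by
    filter_upwards [ae_pos_expMeasure] with y' hy'
    refine integral_congr_ae ?_
    filter_upwards [ae_pos_expMeasure] with y hy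
    rw [if_pos (le_announceTime hd' hy' (Or.inl hxx')),
      reward_of_rival_success P hd' hxx' hy hy' hx' hδ]
  rw [integral_congr_ae h1, integral_race hμ (by linarith)]
  ring

lemma integral_expMeasure_step {H μ : ℝ} (hH : 0 < H) (hμ : 0 < μ) {b : ℝ} (hb : 0 ≤ b)
    (A B C : ℝ) :
    ∫ z, (if z < b then A + B * Real.exp (-μ * z) else C) ∂expMeasure H =
      A * (1 - Real.exp (-H * b)) + B * (H / (H + μ)) * (1 - Real.exp (-(H + μ) * b)) +
        C * Real.exp (-H * b) := by
  have := isProbabilityMeasure_expMeasure hH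
  have hm : Measurable fun z : ℝ => if 0 ≤ z ∧ z < b then B * Real.exp (-μ * z) else 0 :=
    Measurable.ite measurableSet_Ico (by fun_prop) measurable_const
  have h1 : ∀ᵐ z ∂expMeasure H, (if z < b then A + B * Real.exp (-μ * z) else C) =
      ((if z < b then A - C else 0) + C) +
        (if 0 ≤ z ∧ z < b then B * Real.exp (-μ * z) else 0) := by
    filter_upwards [ae_pos_expMeasure] with z hz
    by_cases h : z < b <;> simp [h, hz.le]
  have h2 : ∀ z : ℝ, H * Real.exp (-H * z) * (B * Real.exp (-μ * z)) =
      B * H * Real.exp (-(H + μ) * z) := by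
    intro z
    have : Real.exp (-(H + μ) * z) = Real.exp (-H * z) * Real.exp (-μ * z) := by
      rw [← Real.exp_add]; congr 1; ring
    rw [this]
    ring
  have h3 : -(H + μ) ≠ 0 := by
    have : H + μ ≠ 0 := by positivity
    exact neg_ne_zero.2 this
  rw [integral_congr_ae h1, integral_add, integral_add, integral_expMeasure_lt hH hb,
    integral_expMeasure_Ico hH le_rfl hb]
  · simp only [h2]
    rw [intervalIntegral.integral_const_mul, intervalIntegral.integral_comp_mul_left _ h3,
      integral_exp]
    have h4 : H + μ ≠ 0 := by positivity
    simp only [integral_const, probReal_univ, smul_eq_mul, one_mul, mul_zero, Real.exp_zero]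
    field_simp
    ring
  · exact (integrable_const (A - C)).indicator measurableSet_Iio
  · exact integrable_const _
  · exact ((integrable_const (A - C)).indicator measurableSet_Iio).add (integrable_const _)
  · refine integrable_of_measurable_of_bound hm |B| ?_
    intro z
    split_ifs with h
    · rw [abs_mul, abs_of_pos (Real.exp_pos _)]
      exact mul_le_of_le_one_right (abs_nonneg _) (Real.exp_le_one_iff.2 (by nlinarith [h.1]))
    · simp

lemma integrable_rivalHidden {P : Params} (hH : 0 < P.H) (hμ : 0 < P.μ) (σ : Strategy) (x : ℝ) :
    Integrable (fun x' : ℝ => if x' < x ∧ (x' : EReal) < σ.next Action.exit 0 ∧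
      (x : EReal) ≤ σ.next Action.disclose x' then Real.exp (-P.μ * (x - x')) else 0)
      (expMeasure P.H) := by
  have := isProbabilityMeasure_expMeasure hH
  refine integrable_of_measurable_of_bound (Measurable.ite ?_ (by fun_prop) measurable_const) 1 ?_
  · exact measurableSet_Iio.inter ((measurableSet_lt measurable_coe_real_ereal
      measurable_const).inter (measurableSet_le measurable_const
        ((σ.measurable_next _).comp measurable_coe_real_ereal)))
  · intro b
    split_ifs with h
    · rw [abs_of_pos (Real.exp_pos _)]
      exact Real.exp_le_one_iff.2 (by nlinarith [h.1])
    · simp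

/-- An integral over the rival's success time `x'` splits into the part where the rival holds a
hidden solution at time `x` and the part where it was still in stage 1 at time `x` or left. -/
lemma integral_split_hidden {P : Params} (hH : 0 < P.H) (hμ : 0 < P.μ) {σ : Strategy} {T : ℝ}
    (hT : σ.next Action.exit 0 = (T : EReal)) (x A : ℝ) {f ρ : ℝ → ℝ} (hρ : Measurable ρ) (C : ℝ)
    (hC : ∀ z, |ρ z| ≤ C)
    (h₁ : ∀ x', 0 < x' → x' < x → x' < T → f x' =
      if (x : EReal) ≤ σ.next Action.disclose x' then A * Real.exp (-P.μ * (x - x')) else 0)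
    (h₂ : ∀ x', 0 < x' → x' ≠ T → min x T ≤ x' → f x' = ρ x') :
    ∫ x', f x' ∂expMeasure P.H = A * rivalHidden P σ x +
      ∫ x', (if min x T ≤ x' then ρ x' else 0) ∂expMeasure P.H := by
  have := isProbabilityMeasure_expMeasure hH
  rw [rivalHidden, ← integral_const_mul, ← integral_add]
  · refine integral_congr_ae ?_
    filter_upwards [ae_pos_expMeasure, ae_ne_expMeasure T] with x' hx' hxT
    by_cases h : x' < x ∧ x' < T
    · have h3 : ¬ min x T ≤ x' := not_le.2 (lt_min h.1 h.2)
      have h4 : (x' : EReal) < σ.next Action.exit 0 := by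
        rw [hT]
        exact_mod_cast h.2
      rw [h₁ x' hx' h.1 h.2, if_neg h3]
      simp [h.1, h4]
    · have h3 : min x T ≤ x' := by
        by_contra h4
        exact h (lt_min_iff.1 (not_le.1 h4))
      rw [h₂ x' hx' hxT h3, if_pos h3, if_neg]
      · simp
      · rintro ⟨h5, h6, -⟩
        rw [hT, EReal.coe_lt_coe_iff] at h6
        exact h ⟨h5, h6⟩
  · exact (integrable_rivalHidden hH hμ σ x).const_mul A
  · have h : Integrable ρ (expMeasure P.H) := integrable_of_measurable_of_bound hρ C hC
    exact h.indicator measurableSet_Ici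

/-- Once the rival's exit time has passed, the time of the disclosure does not matter. -/
lemma solvedGain_of_exited {P : Params} (hH : 0 < P.H) (hμ : 0 < P.μ) {σ : Strategy} {T x : ℝ}
    {δ : EReal} (hT : σ.next Action.exit 0 = (T : EReal)) (hT₀ : 0 ≤ T) (hTx : T ≤ x)
    (hδ : (x : EReal) ≤ δ) :
    solvedGain P σ x δ = (P.p₁ + P.p₂) / 2 * rivalHidden P σ x +
      Real.exp (-P.H * T) * (P.p₁ + P.p₂) := by
  rw [solvedGain_integral hH hμ,
    integral_split_hidden hH hμ hT x ((P.p₁ + P.p₂) / 2) (ρ := fun _ => P.p₁ + P.p₂)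
      measurable_const |P.p₁ + P.p₂| (fun _ => le_rfl), min_eq_right hTx,
      integral_expMeasure_le hH hT₀]
  · ring
  · intro x' _ h1 h2
    rw [integral_rival_ahead hμ hδ h1 (by rw [hT]; exact_mod_cast h2)]
  · intro x' _ _ h1
    rw [min_eq_right hTx] at h1
    have h2 : (T : EReal) ≤ x := by exact_mod_cast hTx
    rw [hT]
    exact integral_rival_exited hμ hδ (σ.le_next _ _) (by exact_mod_cast h1) (h2.trans hδ)

/-- The rival, in stage 1 at time `x`, either succeeds before `m`, and then the firm loses half of
the prizes unless it is done with stage 2, or does not, and then the firm loses `C`. -/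
lemma integral_wait_then {P : Params} (hH : 0 < P.H) (hμ : 0 < P.μ) {x m : ℝ} (hx : 0 ≤ x)
    (hm : x ≤ m) (C : ℝ) :
    ∫ x', (if x ≤ x' then (if x' < m then
      P.p₁ + P.p₂ + -((P.p₁ + P.p₂) / 2) * Real.exp (-P.μ * (x' - x)) else P.p₁ + P.p₂ - C) else 0)
        ∂expMeasure P.H =
      Real.exp (-P.H * x) * (waitValue P (m - x) - C * Real.exp (-P.H * (m - x))) := by
  rw [integral_expMeasure_memoryless hH hx (fun x' => if x' < m then
      P.p₁ + P.p₂ + -((P.p₁ + P.p₂) / 2) * Real.exp (-P.μ * (x' - x)) else P.p₁ + P.p₂ - C)]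
  have h1 : ∀ z : ℝ, (if x + z < m then
      P.p₁ + P.p₂ + -((P.p₁ + P.p₂) / 2) * Real.exp (-P.μ * (x + z - x)) else P.p₁ + P.p₂ - C) =
      if z < m - x then P.p₁ + P.p₂ + -((P.p₁ + P.p₂) / 2) * Real.exp (-P.μ * z)
        else P.p₁ + P.p₂ - C := by
    intro z
    rw [add_sub_cancel_left]
    refine if_congr ?_ rfl rfl
    constructor <;> intro h <;> linarith
  simp only [h1]
  rw [integral_expMeasure_step hH hμ (by linarith), waitValue]
  ring

lemma abs_wait_then_le {P : Params} {x C : ℝ} (hμ : 0 < P.μ) (z : ℝ) (q : Prop) [Decidable q] :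
    |if x ≤ z then (if q then
      P.p₁ + P.p₂ + -((P.p₁ + P.p₂) / 2) * Real.exp (-P.μ * (z - x)) else P.p₁ + P.p₂ - C) else 0| ≤
      |P.p₁ + P.p₂| + (|(P.p₁ + P.p₂) / 2| + |C|) := by
  split_ifs with h h2
  · refine (abs_add_le _ _).trans ?_
    rw [abs_mul, abs_neg, abs_of_pos (Real.exp_pos _)]
    have h3 : |(P.p₁ + P.p₂) / 2| * Real.exp (-P.μ * (z - x)) ≤ |(P.p₁ + P.p₂) / 2| :=
      mul_le_of_le_one_right (abs_nonneg _) (Real.exp_le_one_iff.2 (by nlinarith))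
    linarith [abs_nonneg C]
  · refine (abs_sub _ _).trans ?_
    linarith [abs_nonneg ((P.p₁ + P.p₂) / 2)]
  · rw [abs_zero]
    positivity

/-- Disclosing while the rival is still in the game. -/
lemma solvedGain_of_disclose {P : Params} (hH : 0 < P.H) (hμ : 0 < P.μ) {σ : Strategy} {T x δ : ℝ}
    (hT : σ.next Action.exit 0 = (T : EReal)) (hx : 0 ≤ x) (hδ : x ≤ δ) (hδT : δ < T) :
    solvedGain P σ x δ = (P.p₁ + P.p₂) / 2 * rivalHidden P σ x +
      Real.exp (-P.H * x) *
        (waitValue P (δ - x) - P.p₂ / 2 * Real.exp (-(P.H + P.μ) * (δ - x))) := by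
  have hxT : x ≤ T := by linarith
  set C := P.p₂ / 2 * Real.exp (-P.μ * (δ - x)) with hC
  have h0 := integral_wait_then hH hμ hx hδ C
  rw [solvedGain_integral hH hμ,
    integral_split_hidden hH hμ hT x ((P.p₁ + P.p₂) / 2) (ρ := fun x' => if x ≤ x' then
      (if x' ≤ δ then
      P.p₁ + P.p₂ + -((P.p₁ + P.p₂) / 2) * Real.exp (-P.μ * (x' - x)) else P.p₁ + P.p₂ - C) else 0)
      _ (|P.p₁ + P.p₂| + (|(P.p₁ + P.p₂) / 2| + |C|)), min_eq_left hxT]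
  · have h1 : ∀ᵐ x' ∂expMeasure P.H, (if x ≤ x' then (if x ≤ x' then
      (if x' ≤ δ then P.p₁ + P.p₂ + -((P.p₁ + P.p₂) / 2) * Real.exp (-P.μ * (x' - x))
        else P.p₁ + P.p₂ - C) else 0) else 0) = (if x ≤ x' then (if x' < δ then
      P.p₁ + P.p₂ + -((P.p₁ + P.p₂) / 2) * Real.exp (-P.μ * (x' - x)) else P.p₁ + P.p₂ - C)
        else 0) := by
      filter_upwards [ae_ne_expMeasure δ] with x' hne
      have : x' ≤ δ ↔ x' < δ := ⟨fun h => lt_of_le_of_ne h hne, le_of_lt⟩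
      split_ifs <;> simp_all
    rw [integral_congr_ae h1, h0, hC]
    have h2 : Real.exp (-(P.H + P.μ) * (δ - x)) =
        Real.exp (-P.μ * (δ - x)) * Real.exp (-P.H * (δ - x)) := by
      rw [← Real.exp_add]; congr 1; ring
    rw [h2]
    ring
  · exact fun z => abs_wait_then_le hμ z _
  · intro x' _ h1 h2
    rw [integral_rival_ahead hμ (by exact_mod_cast hδ) h1 (by rw [hT]; exact_mod_cast h2)]
  · intro x' _ _ h1
    rw [min_eq_left hxT] at h1
    rw [if_pos h1, hT]
    by_cases h2 : x' ≤ δ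
    · rw [if_pos h2, integral_rival_success hμ (σ.le_next _ _) h1
        (by exact_mod_cast h2.trans_lt hδT) (by exact_mod_cast h2)]
      ring
    · rw [if_neg h2, integral_disclose_first hμ hδ (σ.le_next _ _) (not_le.1 h2)
        (by exact_mod_cast hδT)]
  · refine Measurable.ite measurableSet_Ici (Measurable.ite measurableSet_Iic (by fun_prop)
      measurable_const) measurable_const

/-- Keeping the solution until the rival has left. -/
lemma solvedGain_of_wait {P : Params} (hH : 0 < P.H) (hμ : 0 < P.μ) {σ : Strategy} {T x : ℝ}
    {δ : EReal} (hT : σ.next Action.exit 0 = (T : EReal)) (hx : 0 ≤ x) (hxT : x < T)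
    (hδ : (T : EReal) ≤ δ) :
    solvedGain P σ x δ = (P.p₁ + P.p₂) / 2 * rivalHidden P σ x +
      Real.exp (-P.H * x) * waitValue P (T - x) := by
  have hxδ : (x : EReal) ≤ δ := le_trans (by exact_mod_cast hxT.le) hδ
  have h0 := integral_wait_then hH hμ hx hxT.le 0
  rw [solvedGain_integral hH hμ,
    integral_split_hidden hH hμ hT x ((P.p₁ + P.p₂) / 2) (ρ := fun x' => if x ≤ x' then
      (if x' < T then
      P.p₁ + P.p₂ + -((P.p₁ + P.p₂) / 2) * Real.exp (-P.μ * (x' - x)) else P.p₁ + P.p₂ - 0) else 0)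
      _ _ (fun z => abs_wait_then_le hμ z _), min_eq_left hxT.le]
  · have h9 : waitValue P (T - x) = waitValue P (T - x) - 0 * Real.exp (-P.H * (T - x)) := by ring
    rw [h9, ← h0]
    congr 2
    ext x'
    split_ifs <;> rfl
  · intro x' _ h1 h2
    rw [integral_rival_ahead hμ hxδ h1 (by rw [hT]; exact_mod_cast h2)]
  · intro x' _ _ h1
    rw [min_eq_left hxT.le] at h1
    rw [if_pos h1, hT]
    by_cases h2 : x' < T
    · have h3 : (x' : EReal) ≤ T := by exact_mod_cast h2.le
      rw [if_pos h2, integral_rival_success hμ (σ.le_next _ _) h1 (by exact_mod_cast h2)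
        (h3.trans hδ)]
      ring
    · rw [if_neg h2, integral_rival_exited hμ hxδ (σ.le_next _ _) (by exact_mod_cast not_lt.1 h2)
        hδ, sub_zero]
  · refine Measurable.ite measurableSet_Ici (Measurable.ite measurableSet_Iio (by fun_prop)
      measurable_const) measurable_const

/-- The probability, when stage 1 is solvable, that the rival has announced nothing before `x`. -/
lemma rivalQuiet_eq {P : Params} (hH : 0 < P.H) (hμ : 0 < P.μ) {σ : Strategy} {T x : ℝ}
    (hT : σ.next Action.exit 0 = (T : EReal)) (hT₀ : 0 ≤ T) (hx : 0 ≤ x) :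
    ((stageOneLaw P).prod (expMeasure P.μ)).real {b | (x : EReal) ≤ rivalAnnounce σ b} =
      rivalHidden P σ x + Real.exp (-P.H * min x T) := by
  have := isProbabilityMeasure_expMeasure hμ
  have := isProbabilityMeasure_stageOneLaw hH
  have hm : MeasurableSet {b | (x : EReal) ≤ rivalAnnounce σ b} :=
    measurableSet_le measurable_const (measurable_rivalAnnounce σ)
  rw [← integral_indicator_one hm, integral_prod, integral_stageOneLaw,
    integral_split_hidden hH hμ hT x 1 (ρ := fun _ => 1) measurable_const 1 (by simp),
    integral_expMeasure_le hH (le_min hx hT₀)]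
  · ring
  · intro x' hx' h1 h2
    have h4 : (x' : EReal) < σ.next Action.exit 0 := by
      rw [hT]
      exact_mod_cast h2
    have h3 : ∀ y' : ℝ, {b | (x : EReal) ≤ rivalAnnounce σ b}.indicator (1 : EReal × ℝ → ℝ)
        ((x' : EReal), y') = if (x : EReal) ≤ σ.next Action.disclose x' then
          (if x - x' ≤ y' then 1 else 0) else 0 := by
      intro y'
      have h5 : rivalAnnounce σ ((x' : EReal), y') =
          min (σ.next Action.disclose x') ((x' : EReal) + (y' : EReal)) :=
        announceTime_of_lt h4 y'
      have h6 : (x : EReal) ≤ (x' : EReal) + (y' : EReal) ↔ x - x' ≤ y' := by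
        rw [← EReal.coe_add, EReal.coe_le_coe_iff]
        constructor <;> intro h <;> linarith
      simp only [Set.indicator, Set.mem_ofPred_eq, h5, le_min_iff, h6, Pi.one_apply, ite_and]
    simp only [h3]
    split_ifs
    · rw [integral_expMeasure_le hμ (by linarith)]
    · simp
  · intro x' hx' hne h1
    have h3 : ∀ᵐ y' ∂expMeasure P.μ,
        {b | (x : EReal) ≤ rivalAnnounce σ b}.indicator (1 : EReal × ℝ → ℝ)
        ((x' : EReal), y') = 1 := by
      filter_upwards [ae_pos_expMeasure] with y' hy'
      rw [Set.indicator_of_mem]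
      · rfl
      · refine le_announceTime (σ.le_next _ _) hy' ?_
        rw [hT, EReal.coe_le_coe_iff]
        exact min_le_iff.1 h1
    rw [integral_congr_ae h3]
    simp
  · exact (integrable_const (1 : ℝ)).indicator hm

/-! ### Conditioning on the information -/

lemma integral_cond {β : Type*} [MeasurableSpace β] (m : Measure β) {s : Set β}
    (hs : MeasurableSet s) (f : β → ℝ) :
    ∫ b, f b ∂(cond m s) = (m.real s)⁻¹ * ∫ b, s.indicator f b ∂m := by
  rw [ProbabilityTheory.cond, integral_smul_measure, integral_indicator hs, ENNReal.toReal_inv]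
  rfl

lemma abs_indicator_le {β : Type*} {s : Set β} {f : β → ℝ} {C : ℝ} (hC : 0 ≤ C)
    (h : ∀ b, |f b| ≤ C) (b : β) : |s.indicator f b| ≤ C := by
  by_cases hb : b ∈ s
  · rw [Set.indicator_of_mem hb]
    exact h b
  · rw [Set.indicator_of_notMem hb, abs_zero]
    exact hC

/-- The memoryless property of stage 2: a firm which has spent the time `t - s` on stage 2 without
success is in the same position as one which starts at time `t`. -/
lemma reward_shift (P : Params) {s t y y' : ℝ} {d T d' x' : EReal} (hst : s ≤ t) (hy : 0 < y)
    (hd : (t : EReal) ≤ d) (ha' : (t : EReal) ≤ announceTime T d' x' y') :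
    reward P ⊤ d s (t - s + y) T d' x' y' = reward P ⊤ d t y T d' x' y' := by
  have h1 : announceTime ⊤ d s (t - s + y) = announceTime ⊤ d t y := by
    rw [announceTime_top, announceTime_top]
    congr 2
    ring
  set a := min (announceTime ⊤ d t y) (announceTime T d' x' y') with ha
  have h2 : (t : EReal) ≤ a := by
    refine le_min ?_ ha'
    rw [announceTime_top]
    refine le_min hd ?_
    rw [EReal.coe_le_coe_iff]
    linarith
  have h3 : SolvedBy ⊤ (t : EReal) a := ⟨EReal.coe_lt_top _, h2⟩
  have h4 : SolvedBy ⊤ (s : EReal) a :=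
    ⟨EReal.coe_lt_top _, le_trans (by exact_mod_cast hst) h2⟩
  have h5 : (s : EReal) + ((t - s + y : ℝ) : EReal) = (t : EReal) + (y : EReal) := by
    rw [← EReal.coe_add, ← EReal.coe_add]
    congr 1
    ring
  rw [reward_eq P (a := a) (by rw [h1]), reward_eq P ha, finishTime_of_solvedBy h3,
    finishTime_of_solvedBy h4, if_pos h3, if_pos h4, h5]

/-- By Bayes' rule and the memoryless property of stage 2, the payoff of a firm with a solution does
not depend on the time at which it was found. -/
lemma solvedPayoff_eq {P : Params} (hH : 0 < P.H) (hμ : 0 < P.μ) {σ : Strategy} {T s t : ℝ}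
    {d : EReal} (hT : σ.next Action.exit 0 = (T : EReal)) (hT₀ : 0 ≤ T) (hs : 0 ≤ s) (hst : s ≤ t)
    (hd : (t : EReal) ≤ d) :
    solvedPayoff P σ s t d =
      (rivalHidden P σ t + Real.exp (-P.H * min t T))⁻¹ * solvedGain P σ t d := by
  have := isProbabilityMeasure_expMeasure hμ
  have := isProbabilityMeasure_stageOneLaw hH
  set B : Set (EReal × ℝ) := {b | (t : EReal) ≤ rivalAnnounce σ b} with hB
  have hBm : MeasurableSet B := measurableSet_le measurable_const (measurable_rivalAnnounce σ)
  have hA : solvedInfo σ s t = {y : ℝ | t - s ≤ y} ×ˢ B := by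
    ext w
    simp only [solvedInfo, hB, Set.mem_prod, Set.mem_ofPred_eq]
    refine and_congr_left fun _ => ?_
    constructor <;> intro h <;> linarith
  have hAm : MeasurableSet (solvedInfo σ s t) := by
    rw [hA]
    exact measurableSet_Ici.prod hBm
  have hy : (expMeasure P.μ).real {y : ℝ | t - s ≤ y} = Real.exp (-P.μ * (t - s)) := by
    have h := integral_expMeasure_le hμ (by linarith : 0 ≤ t - s) 1
    rw [one_mul] at h
    have hm : MeasurableSet {y : ℝ | t - s ≤ y} := measurableSet_Ici
    rw [← h, ← integral_indicator_one hm]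
    congr 1
  have hf : Measurable fun w : ℝ × (EReal × ℝ) => rewardAgainst P σ ⊤ d s w.1 w.2 :=
    measurable_rewardAgainst P σ measurable_const measurable_const measurable_const
      measurable_fst measurable_snd
  have hf' : Measurable fun w : ℝ × (EReal × ℝ) => if (t : EReal) ≤ rivalAnnounce σ w.2 then
      rewardAgainst P σ ⊤ d t w.1 w.2 else 0 :=
    Measurable.ite
      (measurableSet_le measurable_const ((measurable_rivalAnnounce σ).comp measurable_snd))
      (measurable_rewardAgainst P σ measurable_const measurable_const measurable_const
        measurable_fst measurable_snd) measurable_const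
  have hb : ∀ w, |(solvedInfo σ s t).indicator
      (fun w : ℝ × (EReal × ℝ) => rewardAgainst P σ ⊤ d s w.1 w.2) w| ≤ |P.p₁| + |P.p₂| := by
    exact abs_indicator_le (by positivity) fun w => abs_rewardAgainst_le ..
  have hb' : ∀ w : ℝ × (EReal × ℝ), |if (t : EReal) ≤ rivalAnnounce σ w.2 then
      rewardAgainst P σ ⊤ d t w.1 w.2 else 0| ≤ |P.p₁| + |P.p₂| := by
    intro w
    split_ifs
    · exact abs_rewardAgainst_le ..
    · simp; positivity
  have key : ∫ w, (solvedInfo σ s t).indicator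
      (fun w : ℝ × (EReal × ℝ) => rewardAgainst P σ ⊤ d s w.1 w.2) w
        ∂((expMeasure P.μ).prod ((stageOneLaw P).prod (expMeasure P.μ))) =
      Real.exp (-P.μ * (t - s)) * solvedGain P σ t d := by
    rw [integral_prod _ (integrable_of_measurable_of_bound (hf.indicator hAm) _ hb), solvedGain,
      integral_prod _ (integrable_of_measurable_of_bound hf' _ hb')]
    have h1 : ∀ y : ℝ, ∫ b, (solvedInfo σ s t).indicator
        (fun w : ℝ × (EReal × ℝ) => rewardAgainst P σ ⊤ d s w.1 w.2) (y, b)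
        ∂((stageOneLaw P).prod (expMeasure P.μ)) =
        if t - s ≤ y then ∫ b, (if (t : EReal) ≤ rivalAnnounce σ b then
          rewardAgainst P σ ⊤ d s y b else 0) ∂((stageOneLaw P).prod (expMeasure P.μ)) else 0 := by
      intro y
      rw [hA]
      by_cases h : t - s ≤ y
      · rw [if_pos h]
        congr 1
        ext b
        have h' : t ≤ y + s := by linarith
        simp [Set.indicator_apply, hB, h']
      · rw [if_neg h]
        have h' : ¬ t ≤ y + s := fun h' => h (by linarith)
        simp [h']
    simp only [h1]
    rw [integral_expMeasure_memoryless hμ (by linarith) (fun y =>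
      ∫ b, (if (t : EReal) ≤ rivalAnnounce σ b then
          rewardAgainst P σ ⊤ d s y b else 0) ∂((stageOneLaw P).prod (expMeasure P.μ)))]
    congr 1
    refine integral_congr_ae ?_
    filter_upwards [ae_pos_expMeasure] with y hy
    congr 1
    ext b
    by_cases h : (t : EReal) ≤ rivalAnnounce σ b
    · rw [if_pos h, if_pos h]
      exact reward_shift P hst hy hd h
    · rw [if_neg h, if_neg h]
  rw [solvedPayoff, integral_cond _ hAm, key, hA, measureReal_prod_prod, hy,
    rivalQuiet_eq hH hμ hT hT₀ (hs.trans hst)]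
  have h0 : Real.exp (-P.μ * (t - s)) ≠ 0 := (Real.exp_pos _).ne'
  rw [mul_inv]
  field_simp

lemma rivalHidden_nonneg (P : Params) (σ : Strategy) (x : ℝ) : 0 ≤ rivalHidden P σ x := by
  refine integral_nonneg fun x' => ?_
  dsimp only
  split_ifs
  · exact (Real.exp_pos _).le
  · exact le_rfl

/-- The comparison of disclosure times does not depend on the probability of the information. -/
lemma solvedPayoff_le_iff {P : Params} (hH : 0 < P.H) (hμ : 0 < P.μ) {σ : Strategy} {T s t : ℝ}
    {d d' : EReal} (hT : σ.next Action.exit 0 = (T : EReal)) (hT₀ : 0 ≤ T) (hs : 0 ≤ s)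
    (hst : s ≤ t) (hd : (t : EReal) ≤ d) (hd' : (t : EReal) ≤ d') :
    solvedPayoff P σ s t d ≤ solvedPayoff P σ s t d' ↔
      solvedGain P σ t d ≤ solvedGain P σ t d' := by
  rw [solvedPayoff_eq hH hμ hT hT₀ hs hst hd, solvedPayoff_eq hH hμ hT hT₀ hs hst hd']
  refine mul_le_mul_iff_right₀ (inv_pos.2 ?_)
  have := rivalHidden_nonneg P σ t
  positivity

/-! ### The payoff of a firm without a solution -/

/-- The probability that neither the firm has solved stage 1 nor the rival has made a solution
public before `r`. -/
noncomputable def infoProb (P : Params) (σ : Strategy) (r : ℝ) : ℝ :=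
  (prior P).real (unsolvedInfo σ r)

/-- The event that a firm which plans to exit at `τ` receives `p₂` without having solved stage 1:
the rival discloses at a time between `t` and `τ`, and the firm is then the first to complete
stage 2. -/
def spillover (σ : Strategy) (t τ : ℝ) : Set ((EReal × ℝ) × (EReal × ℝ)) :=
  {w | (t : EReal) ≤ rivalAnnounce σ w.2 ∧ rivalAnnounce σ w.2 < (τ : EReal) ∧
    rivalAnnounce σ w.2 < w.1.1 ∧ rivalAnnounce σ w.2 + (w.1.2 : EReal) < w.2.1 + (w.2.2 : EReal)}

lemma measurableSet_unsolvedInfo (σ : Strategy) (t : ℝ) : MeasurableSet (unsolvedInfo σ t) :=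
  (measurableSet_le measurable_const (measurable_fst.comp measurable_fst)).inter
    (measurableSet_le measurable_const ((measurable_rivalAnnounce σ).comp measurable_snd))

lemma measurableSet_spillover (σ : Strategy) (t τ : ℝ) : MeasurableSet (spillover σ t τ) := by
  have h1 := (measurable_rivalAnnounce σ).comp
    (measurable_snd : Measurable fun w : (EReal × ℝ) × (EReal × ℝ) => w.2)
  have h2 : Measurable fun w : (EReal × ℝ) × (EReal × ℝ) => w.1.1 :=
    measurable_fst.comp measurable_fst
  have h3 : Measurable fun w : (EReal × ℝ) × (EReal × ℝ) => w.1.2 :=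
    measurable_snd.comp measurable_fst
  have h4 : Measurable fun w : (EReal × ℝ) × (EReal × ℝ) => w.2.1 :=
    measurable_fst.comp measurable_snd
  have h5 : Measurable fun w : (EReal × ℝ) × (EReal × ℝ) => w.2.2 :=
    measurable_snd.comp measurable_snd
  exact (measurableSet_le measurable_const h1).inter ((measurableSet_lt h1 measurable_const).inter
    ((measurableSet_lt h1 h2).inter (measurableSet_lt (h1.add h3.coe_real_ereal)
      (h4.add h5.coe_real_ereal))))

open Classical in
/-- Either the firm finds a solution before the rival's announcement, and is then in the position
of a firm with a solution, or it can only win `p₂` after a disclosure by the rival. -/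
lemma indicator_rewardAgainst (P : Params) (σ : Strategy) {t τ : ℝ} {δ : EReal}
    {w : (EReal × ℝ) × (EReal × ℝ)} (hδ : w.1.1 ≤ δ) (hy : 0 < w.1.2) (hy' : 0 < w.2.2) :
    (unsolvedInfo σ t).indicator (fun w => rewardAgainst P σ τ δ w.1.1 w.1.2 w.2) w =
      (if ((t : EReal) ≤ w.1.1 ∧ w.1.1 < (τ : EReal)) then (if w.1.1 ≤ rivalAnnounce σ w.2 then
        rewardAgainst P σ ⊤ δ w.1.1 w.1.2 w.2 else 0) else 0) +
      (spillover σ t τ).indicator (fun _ => P.p₂) w := by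
  obtain ⟨⟨x, y⟩, ⟨x', y'⟩⟩ := w
  set a' := rivalAnnounce σ (x', y') with ha'
  have hadd : ∀ (z : EReal) {v : ℝ}, 0 < v → z ≤ z + (v : EReal) := by
    intro z v hv
    exact le_add_of_nonneg_right (by exact_mod_cast hv.le)
  have hw : x ≤ min δ (x + (y : EReal)) := le_min hδ (hadd x hy)
  by_cases h1 : x ≤ a'
  · -- the firm finds a solution first, or has left
    have hsp : ((x, y), (x', y')) ∉ spillover σ t τ := fun h => not_lt.2 h1 h.2.2.1
    rw [Set.indicator_of_notMem hsp, add_zero]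
    by_cases h2 : x < (τ : EReal)
    · have hx : x < ⊤ := h2.trans_le le_top
      have ha1 : announceTime τ δ x y = announceTime ⊤ δ x y := by
        rw [announceTime_of_lt h2, announceTime_of_lt hx]
      have e : rewardAgainst P σ τ δ x y (x', y') = rewardAgainst P σ ⊤ δ x y (x', y') := by
        have hxa : x ≤ min (announceTime ⊤ δ x y) a' := by
          rw [announceTime_of_lt hx]
          exact le_min hw h1
        have hs1 : SolvedBy (τ : EReal) x (min (announceTime ⊤ δ x y) a') := ⟨h2, hxa⟩
        have hs2 : SolvedBy ⊤ x (min (announceTime ⊤ δ x y) a') := ⟨hx, hxa⟩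
        rw [rewardAgainst, rewardAgainst, reward_eq P (a := min (announceTime ⊤ δ x y) a')
          (by rw [ha1]; rfl), reward_eq P (a := min (announceTime ⊤ δ x y) a') rfl,
          finishTime_of_solvedBy hs1, finishTime_of_solvedBy hs2, if_pos hs1, if_pos hs2]
      by_cases h3 : (t : EReal) ≤ x
      · have hm : ((x, y), (x', y')) ∈ unsolvedInfo σ t := ⟨h3, h3.trans h1⟩
        rw [Set.indicator_of_mem hm, if_pos ⟨h3, h2⟩, if_pos h1, e]
      · have hm : ((x, y), (x', y')) ∉ unsolvedInfo σ t := fun h => h3 h.1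
        rw [Set.indicator_of_notMem hm, if_neg (fun h => h3 h.1)]
    · rw [if_neg (fun h => h2 h.2)]
      have ha1 : announceTime τ δ x y = ⊤ := announceTime_of_le (not_lt.1 h2) y
      have hs : ¬ SolvedBy (τ : EReal) x a' := fun h => h2 h.1
      rw [Set.indicator_apply]
      refine ite_eq_right_iff.2 fun _ => ?_
      rw [rewardAgainst, reward_eq P (a := a') (by rw [ha1, min_eq_right le_top]; rfl),
        if_neg hs, zero_add]
      rw [finishTime_of_le hs ((not_lt.1 h2).trans h1), if_neg not_top_lt]
  · -- the rival announces first
    rw [not_le] at h1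
    have hown : a' ≤ announceTime τ δ x y := by
      by_cases h2 : x < (τ : EReal)
      · rw [announceTime_of_lt h2]
        exact h1.le.trans hw
      · rw [announceTime_of_le (not_lt.1 h2)]
        exact le_top
    have hs : ¬ SolvedBy (τ : EReal) x a' := fun h => not_lt.2 h.2 h1
    have hx'T : x' < σ.next Action.exit 0 := by
      by_contra h
      have : a' = ⊤ := announceTime_of_le (not_lt.1 h) y'
      rw [this] at h1
      exact not_top_lt h1
    have hs' : SolvedBy (σ.next Action.exit 0) x' a' := by
      refine ⟨hx'T, ?_⟩
      have : a' = min (σ.next Action.disclose x') (x' + (y' : EReal)) := announceTime_of_lt hx'T y'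
      rw [this]
      exact le_min (σ.le_next _ _) (hadd x' hy')
    have e : rewardAgainst P σ τ δ x y (x', y') =
        if a' < (τ : EReal) ∧ a' + (y : EReal) < x' + (y' : EReal) then P.p₂ else 0 := by
      rw [rewardAgainst, reward_eq P (a := a') (min_eq_right hown).symm,
        if_neg hs, zero_add, finishTime_of_solvedBy hs']
      by_cases h2 : a' < (τ : EReal)
      · rw [finishTime_of_lt hs h2]
        simp [h2]
      · rw [finishTime_of_le hs (not_lt.1 h2)]
        simp [h2]
    rw [if_neg (not_le.2 h1), ite_self, zero_add, Set.indicator_apply, Set.indicator_apply, e,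
      ← ite_and]
    refine if_congr ?_ rfl rfl
    constructor
    · rintro ⟨⟨-, h3⟩, h4, h5⟩
      exact ⟨h3, h4, h1, h5⟩
    · rintro ⟨h3, h4, -, h5⟩
      exact ⟨⟨h3.trans h1.le, h3⟩, h4, h5⟩

lemma isProbabilityMeasure_jointLaw {P : Params} (hμ : 0 < P.μ) (κ : Measure EReal)
    [IsProbabilityMeasure κ] : IsProbabilityMeasure (jointLaw P κ) := by
  have := isProbabilityMeasure_expMeasure hμ
  unfold jointLaw
  infer_instance

lemma isProbabilityMeasure_prior {P : Params} (hα₀ : 0 < P.α) (hα₁ : P.α < 1) (hH : 0 < P.H)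
    (hμ : 0 < P.μ) : IsProbabilityMeasure (prior P) := by
  have := isProbabilityMeasure_stageOneLaw hH
  have := isProbabilityMeasure_jointLaw hμ (stageOneLaw P)
  have := isProbabilityMeasure_jointLaw hμ (Measure.dirac (⊤ : EReal))
  constructor
  simp only [prior, Measure.coe_add, Measure.coe_smul, Pi.add_apply, Pi.smul_apply, measure_univ,
    smul_eq_mul, mul_one]
  rw [← ENNReal.ofReal_add hα₀.le (by linarith)]
  simp

lemma ae_jointLaw_dirac (P : Params) (hμ : 0 < P.μ) :
    ∀ᵐ w ∂jointLaw P (Measure.dirac ⊤), w.1.1 = ⊤ ∧ w.2.1 = ⊤ := by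
  have := isProbabilityMeasure_expMeasure hμ
  have h0 : ∀ᵐ x : EReal ∂Measure.dirac ⊤, x = ⊤ := by
    rw [ae_dirac_eq]
    rfl
  have h1 : ∀ᵐ a ∂(Measure.dirac (⊤ : EReal)).prod (expMeasure P.μ), a.1 = ⊤ :=
    Measure.quasiMeasurePreserving_fst.ae h0
  exact (Measure.quasiMeasurePreserving_fst.ae h1).and (Measure.quasiMeasurePreserving_snd.ae h1)

lemma rivalAnnounce_top (σ : Strategy) (y : ℝ) : rivalAnnounce σ (⊤, y) = ⊤ :=
  announceTime_of_le le_top y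

lemma integral_prior {P : Params} (hα₀ : 0 < P.α) (hα₁ : P.α < 1) (hH : 0 < P.H) (hμ : 0 < P.μ)
    {f : (EReal × ℝ) × (EReal × ℝ) → ℝ} (hf : Measurable f) (C : ℝ) (hC : ∀ w, |f w| ≤ C) :
    ∫ w, f w ∂prior P = P.α * ∫ w, f w ∂jointLaw P (stageOneLaw P) +
      (1 - P.α) * ∫ w, f w ∂jointLaw P (Measure.dirac ⊤) := by
  have := isProbabilityMeasure_stageOneLaw hH
  have := isProbabilityMeasure_jointLaw hμ (stageOneLaw P)
  have := isProbabilityMeasure_jointLaw hμ (Measure.dirac (⊤ : EReal))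
  have h1 := integrable_of_measurable_of_bound (m := jointLaw P (stageOneLaw P)) hf C hC
  have h2 := integrable_of_measurable_of_bound (m := jointLaw P (Measure.dirac ⊤)) hf C hC
  rw [prior, integral_add_measure (h1.smul_measure ENNReal.ofReal_ne_top)
    (h2.smul_measure ENNReal.ofReal_ne_top), integral_smul_measure, integral_smul_measure,
    ENNReal.toReal_ofReal hα₀.le, ENNReal.toReal_ofReal (by linarith)]
  rfl

lemma integral_jointLaw {P : Params} (hH : 0 < P.H) (hμ : 0 < P.μ)
    {f : (EReal × ℝ) × (EReal × ℝ) → ℝ} (hf : Measurable f) (C : ℝ) (hC : ∀ w, |f w| ≤ C) :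
    ∫ w, f w ∂jointLaw P (stageOneLaw P) = ∫ x : ℝ, ∫ v, f (((x : EReal), v.1), v.2)
      ∂((expMeasure P.μ).prod ((stageOneLaw P).prod (expMeasure P.μ))) ∂expMeasure P.H := by
  have := isProbabilityMeasure_expMeasure hμ
  have := isProbabilityMeasure_stageOneLaw hH
  have hi : Integrable f (((stageOneLaw P).prod (expMeasure P.μ)).prod
      ((stageOneLaw P).prod (expMeasure P.μ))) := integrable_of_measurable_of_bound hf C hC
  rw [jointLaw, integral_prod _ hi, integral_prod _ hi.integral_prod_left, integral_stageOneLaw]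
  congr 1
  ext x
  rw [integral_prod]
  refine integrable_of_measurable_of_bound ?_ C fun v => hC _
  exact hf.comp (by fun_prop)

/-- If stage 1 is solvable, the firm is in stage 1 with probability `exp (-H r)`, and
independently the rival hides a solution, is in stage 1, or has left. If it is not, nothing is
ever announced. -/
lemma infoProb_eq {P : Params} (hα₀ : 0 < P.α) (hα₁ : P.α < 1) (hH : 0 < P.H) (hμ : 0 < P.μ)
    {σ : Strategy} {T r : ℝ} (hT : σ.next Action.exit 0 = (T : EReal)) (hT₀ : 0 ≤ T)
    (hr : 0 ≤ r) :
    infoProb P σ r = P.α * (Real.exp (-P.H * r) *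
      (rivalHidden P σ r + Real.exp (-P.H * min r T))) + (1 - P.α) := by
  have := isProbabilityMeasure_expMeasure hμ
  have := isProbabilityMeasure_expMeasure hH
  have := isProbabilityMeasure_stageOneLaw hH
  have := isProbabilityMeasure_jointLaw hμ (Measure.dirac (⊤ : EReal))
  have hm := measurableSet_unsolvedInfo σ r
  have hmB : MeasurableSet {b | (r : EReal) ≤ rivalAnnounce σ b} :=
    measurableSet_le measurable_const (measurable_rivalAnnounce σ)
  have h1 : Measurable ((unsolvedInfo σ r).indicator (1 : (EReal × ℝ) × (EReal × ℝ) → ℝ)) :=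
    measurable_one.indicator hm
  have h2 : ∀ w, |(unsolvedInfo σ r).indicator (1 : (EReal × ℝ) × (EReal × ℝ) → ℝ) w| ≤ 1 :=
    abs_indicator_le zero_le_one (by simp)
  rw [infoProb, ← integral_indicator_one hm, integral_prior hα₀ hα₁ hH hμ h1 1 h2]
  have h3 : ∫ w, (unsolvedInfo σ r).indicator (1 : (EReal × ℝ) × (EReal × ℝ) → ℝ) w
      ∂jointLaw P (Measure.dirac ⊤) = 1 := by
    have : ∀ᵐ w ∂jointLaw P (Measure.dirac ⊤),
        (unsolvedInfo σ r).indicator (1 : (EReal × ℝ) × (EReal × ℝ) → ℝ) w = 1 := by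
      filter_upwards [ae_jointLaw_dirac P hμ] with w hw
      rw [Set.indicator_of_mem]
      · rfl
      · obtain ⟨⟨x, y⟩, ⟨x', y'⟩⟩ := w
        obtain ⟨rfl, rfl⟩ := hw
        exact ⟨le_top, by rw [rivalAnnounce_top]; exact le_top⟩
    rw [integral_congr_ae this]
    simp
  have h4 : ∫ w, (unsolvedInfo σ r).indicator (1 : (EReal × ℝ) × (EReal × ℝ) → ℝ) w
      ∂jointLaw P (stageOneLaw P) =
      Real.exp (-P.H * r) * (rivalHidden P σ r + Real.exp (-P.H * min r T)) := by
    rw [integral_jointLaw hH hμ h1 1 h2, ← rivalQuiet_eq hH hμ hT hT₀ hr, mul_comm,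
      ← integral_expMeasure_le hH hr]
    congr 1
    ext x
    rw [← integral_indicator_one hmB]
    by_cases h : r ≤ x
    · rw [if_pos h]
      have h' : (r : EReal) ≤ x := by exact_mod_cast h
      have h5 : ∀ v : ℝ × (EReal × ℝ), (unsolvedInfo σ r).indicator
          (1 : (EReal × ℝ) × (EReal × ℝ) → ℝ) (((x : EReal), v.1), v.2) =
          {b | (r : EReal) ≤ rivalAnnounce σ b}.indicator 1 v.2 := by
        intro v
        simp [Set.indicator_apply, unsolvedInfo, h']
      simp only [h5]
      rw [integral_fun_snd]
      simp
    · rw [if_neg h]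
      have h' : ¬ (r : EReal) ≤ x := by exact_mod_cast h
      simp [unsolvedInfo, h']
  rw [h3, h4, mul_one]

lemma ae_pos_jointLaw (P : Params) (hμ : 0 < P.μ) (κ : Measure EReal) [IsProbabilityMeasure κ] :
    ∀ᵐ w ∂jointLaw P κ, 0 < w.1.2 ∧ 0 < w.2.2 := by
  have := isProbabilityMeasure_expMeasure hμ
  have h1 : ∀ᵐ a ∂κ.prod (expMeasure P.μ), 0 < a.2 :=
    Measure.quasiMeasurePreserving_snd.ae ae_pos_expMeasure
  exact (Measure.quasiMeasurePreserving_fst.ae h1).and (Measure.quasiMeasurePreserving_snd.ae h1)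

lemma rewardAgainst_unsolvable (P : Params) (σ : Strategy) (τ δ : EReal) (y y' : ℝ) :
    rewardAgainst P σ τ δ ⊤ y (⊤, y') = 0 := by
  have h1 : announceTime τ δ ⊤ y = ⊤ := announceTime_of_le le_top y
  have h2 : announceTime (σ.next Action.exit 0) (σ.next Action.disclose ⊤) ⊤ y' = ⊤ :=
    announceTime_of_le le_top y'
  have hs : ∀ T : EReal, ¬ SolvedBy T ⊤ ⊤ := fun T h => not_top_lt h.1
  rw [rewardAgainst, reward_eq P (a := ⊤) (by rw [h1, h2, min_self]), if_neg (hs _),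
    finishTime_of_le (hs _) le_top, finishTime_of_le (hs _) le_top]
  simp

/-- The expected reward of a firm without a solution, on its information at time `t`. -/
lemma integral_rewardAgainst {P : Params} (hα₀ : 0 < P.α) (hα₁ : P.α < 1) (hH : 0 < P.H)
    (hμ : 0 < P.μ) (σ : Strategy) {t τ : ℝ} (ht : 0 ≤ t) (htτ : t ≤ τ) {d : EReal → EReal}
    (hd : Measurable d) (hxd : ∀ x, x ≤ d x) :
    ∫ w, (unsolvedInfo σ t).indicator (fun w => rewardAgainst P σ τ (d w.1.1) w.1.1 w.1.2 w.2) w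
        ∂prior P =
      P.α * ((∫ x in t..τ, P.H * Real.exp (-P.H * x) * solvedGain P σ x (d x)) +
        P.p₂ * (jointLaw P (stageOneLaw P)).real (spillover σ t τ)) := by
  classical
  have := isProbabilityMeasure_expMeasure hμ
  have := isProbabilityMeasure_stageOneLaw hH
  have := isProbabilityMeasure_jointLaw hμ (stageOneLaw P)
  have := isProbabilityMeasure_jointLaw hμ (Measure.dirac (⊤ : EReal))
  have hx : Measurable fun w : (EReal × ℝ) × (EReal × ℝ) => w.1.1 :=
    measurable_fst.comp measurable_fst
  have hy : Measurable fun w : (EReal × ℝ) × (EReal × ℝ) => w.1.2 :=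
    measurable_snd.comp measurable_fst
  have hf : ∀ τ : EReal, Measurable fun w : (EReal × ℝ) × (EReal × ℝ) =>
      rewardAgainst P σ τ (d w.1.1) w.1.1 w.1.2 w.2 := fun τ =>
    measurable_rewardAgainst P σ measurable_const (hd.comp hx) hx hy measurable_snd
  have hC : (0 : ℝ) ≤ |P.p₁| + |P.p₂| := by positivity
  rw [integral_prior hα₀ hα₁ hH hμ ((hf τ).indicator (measurableSet_unsolvedInfo σ t))
    (|P.p₁| + |P.p₂|) (abs_indicator_le hC fun w => abs_rewardAgainst_le ..)]
  have h1 : ∀ᵐ w ∂jointLaw P (Measure.dirac ⊤), (unsolvedInfo σ t).indicator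
      (fun w => rewardAgainst P σ τ (d w.1.1) w.1.1 w.1.2 w.2) w = 0 := by
    filter_upwards [ae_jointLaw_dirac P hμ] with w hw
    obtain ⟨⟨x, y⟩, ⟨x', y'⟩⟩ := w
    obtain ⟨rfl, rfl⟩ := hw
    rw [Set.indicator_apply]
    refine ite_eq_right_iff.2 fun _ => ?_
    exact rewardAgainst_unsolvable ..
  rw [integral_congr_ae h1, integral_zero, mul_zero, add_zero]
  congr 1
  set g : (EReal × ℝ) × (EReal × ℝ) → ℝ := fun w =>
    if ((t : EReal) ≤ w.1.1 ∧ w.1.1 < (τ : EReal)) then (if w.1.1 ≤ rivalAnnounce σ w.2 then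
        rewardAgainst P σ ⊤ (d w.1.1) w.1.1 w.1.2 w.2 else 0) else 0 with hg
  have hgm : Measurable g := by
    refine Measurable.ite ((measurableSet_le measurable_const hx).inter
      (measurableSet_lt hx measurable_const)) (Measurable.ite (measurableSet_le hx
        ((measurable_rivalAnnounce σ).comp measurable_snd)) (hf ⊤) measurable_const)
      measurable_const
  have hgC : ∀ w, |g w| ≤ |P.p₁| + |P.p₂| := by
    intro w
    simp only [hg]
    split_ifs
    · exact abs_rewardAgainst_le ..
    · rwa [abs_zero]
    · rwa [abs_zero]
  have h2 : ∀ᵐ w ∂jointLaw P (stageOneLaw P), (unsolvedInfo σ t).indicator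
      (fun w => rewardAgainst P σ τ (d w.1.1) w.1.1 w.1.2 w.2) w =
      g w + (spillover σ t τ).indicator (fun _ => P.p₂) w := by
    filter_upwards [ae_pos_jointLaw P hμ (stageOneLaw P)] with w hw
    rw [hg, ← indicator_rewardAgainst P σ (hxd w.1.1) hw.1 hw.2]
    simp only [Set.indicator_apply]
  rw [integral_congr_ae h2, integral_add (integrable_of_measurable_of_bound hgm _ hgC)
    ((integrable_const _).indicator (measurableSet_spillover σ t τ)),
    integral_indicator_const _ (measurableSet_spillover σ t τ), smul_eq_mul,
    mul_comm P.p₂, integral_jointLaw hH hμ hgm _ hgC, ← integral_expMeasure_Ico hH ht htτ]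
  congr 2
  ext x
  simp only [hg, solvedGain, EReal.coe_le_coe_iff, EReal.coe_lt_coe_iff]
  by_cases h : t ≤ x ∧ x < τ
  · simp only [h, and_self, if_true]
  · simp only [if_neg h, integral_zero]

lemma stageOneTime_eq_volume {t τ : ℝ} (x a : EReal) (hx : (t : EReal) ≤ x) (ha : (t : EReal) ≤ a)
    (htτ : t ≤ τ) :
    stageOneTime t τ x a =
      volume {r : ℝ | r ∈ Set.Ioc t τ ∧ (r : EReal) ≤ x ∧ (r : EReal) ≤ a} := by
  have h1 : (t : EReal) ≤ min x (min (τ : EReal) a) :=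
    le_min hx (le_min (by exact_mod_cast htτ) ha)
  have h2 : min x (min (τ : EReal) a) ≤ τ := (min_le_right _ _).trans (min_le_left _ _)
  obtain ⟨m, hm⟩ : ∃ m : ℝ, min x (min (τ : EReal) a) = m := by
    refine ⟨(min x (min (τ : EReal) a)).toReal, (EReal.coe_toReal ?_ ?_).symm⟩
    · exact (h2.trans_lt (EReal.coe_lt_top τ)).ne
    · exact ((EReal.bot_lt_coe t).trans_le h1).ne'
  have h3 : {r : ℝ | r ∈ Set.Ioc t τ ∧ (r : EReal) ≤ x ∧ (r : EReal) ≤ a} = Set.Ioc t m := by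
    ext r
    have h4 : r ≤ m ↔ (r : EReal) ≤ x ∧ r ≤ τ ∧ (r : EReal) ≤ a := by
      rw [← EReal.coe_le_coe_iff, ← hm, le_min_iff, le_min_iff, EReal.coe_le_coe_iff]
    simp only [Set.mem_ofPred_eq, Set.mem_Ioc, h4]
    tauto
  rw [h3, stageOneTime, hm, Real.volume_Ioc, ← EReal.coe_sub,
    EReal.toENNReal_of_ne_top (EReal.coe_ne_top _), EReal.toReal_coe]

lemma infoProb_antitone {P : Params} (hα₀ : 0 < P.α) (hα₁ : P.α < 1) (hH : 0 < P.H)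
    (hμ : 0 < P.μ) (σ : Strategy) : Antitone (infoProb P σ) := by
  have := isProbabilityMeasure_prior hα₀ hα₁ hH hμ
  intro r s hrs
  refine measureReal_mono ?_
  rintro w ⟨h1, h2⟩
  have h : (r : EReal) ≤ s := by exact_mod_cast hrs
  exact ⟨h.trans h1, h.trans h2⟩

/-- The expected time in stage 1 is the integral of the probability of still being there. -/
lemma lintegral_stageOneTime {P : Params} (hα₀ : 0 < P.α) (hα₁ : P.α < 1) (hH : 0 < P.H)
    (hμ : 0 < P.μ) (σ : Strategy) {t τ : ℝ} (htτ : t ≤ τ) :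
    ∫⁻ w in unsolvedInfo σ t, stageOneTime t τ w.1.1 (rivalAnnounce σ w.2) ∂prior P =
      ENNReal.ofReal (∫ r in t..τ, infoProb P σ r) := by
  have := isProbabilityMeasure_prior hα₀ hα₁ hH hμ
  have hm := measurableSet_unsolvedInfo σ t
  set E : Set (((EReal × ℝ) × (EReal × ℝ)) × ℝ) :=
    {z | (z.2 : EReal) ≤ z.1.1.1 ∧ (z.2 : EReal) ≤ rivalAnnounce σ z.1.2} with hE
  have hEm : MeasurableSet E := by
    refine (measurableSet_le (measurable_snd.coe_real_ereal) ?_).inter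
      (measurableSet_le (measurable_snd.coe_real_ereal) ?_)
    · exact measurable_fst.comp (measurable_fst.comp measurable_fst)
    · exact (measurable_rivalAnnounce σ).comp (measurable_snd.comp measurable_fst)
  have h1 : ∫⁻ w in unsolvedInfo σ t, stageOneTime t τ w.1.1 (rivalAnnounce σ w.2) ∂prior P =
      ∫⁻ w, (∫⁻ r in Set.Ioc t τ, E.indicator 1 (w, r)) ∂prior P := by
    rw [← lintegral_indicator hm]
    congr 1
    ext w
    have h2 : ∫⁻ r in Set.Ioc t τ, E.indicator (1 : ((EReal × ℝ) × (EReal × ℝ)) × ℝ → ℝ≥0∞) (w, r) =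
        volume {r : ℝ | r ∈ Set.Ioc t τ ∧ (r : EReal) ≤ w.1.1 ∧
          (r : EReal) ≤ rivalAnnounce σ w.2} := by
      have h3 : MeasurableSet {r : ℝ | (w, r) ∈ E} := hEm.preimage measurable_prodMk_left
      have h4 : ∀ r : ℝ, E.indicator (1 : ((EReal × ℝ) × (EReal × ℝ)) × ℝ → ℝ≥0∞) (w, r) =
          {r : ℝ | (w, r) ∈ E}.indicator 1 r := fun r => rfl
      simp only [h4]
      rw [lintegral_indicator_one h3, Measure.restrict_apply h3, Set.inter_comm]
      rfl
    rw [h2]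
    by_cases hw : w ∈ unsolvedInfo σ t
    · rw [Set.indicator_of_mem hw]
      exact stageOneTime_eq_volume _ _ hw.1 hw.2 htτ
    · rw [Set.indicator_of_notMem hw, eq_comm]
      convert! measure_empty (μ := volume)
      ext r
      simp only [Set.mem_ofPred_eq, Set.mem_empty_iff_false, iff_false]
      rintro ⟨h5, h6, h7⟩
      have h8 : (t : EReal) ≤ r := by exact_mod_cast h5.1.le
      exact hw ⟨h8.trans h6, h8.trans h7⟩
  rw [h1, lintegral_lintegral_swap]
  · have h2 : ∀ r : ℝ,
        ∫⁻ w, E.indicator (1 : ((EReal × ℝ) × (EReal × ℝ)) × ℝ → ℝ≥0∞) (w, r) ∂prior P =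
        ENNReal.ofReal (infoProb P σ r) := by
      intro r
      have h4 : ∀ w, E.indicator (1 : ((EReal × ℝ) × (EReal × ℝ)) × ℝ → ℝ≥0∞) (w, r) =
          (unsolvedInfo σ r).indicator 1 w :=
        fun w => rfl
      simp only [h4]
      rw [lintegral_indicator_one (measurableSet_unsolvedInfo σ r), infoProb, ofReal_measureReal]
    simp only [h2]
    rw [intervalIntegral.integral_of_le htτ, ofReal_integral_eq_lintegral_ofReal]
    · exact (infoProb_antitone hα₀ hα₁ hH hμ σ).intervalIntegrable.1
    · exact Filter.Eventually.of_forall fun r => measureReal_nonneg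
  · exact (measurable_one.indicator hEm).aemeasurable

/-- The expected gain of a firm without a solution from the plan `τ`, `d`, on the event
`unsolvedInfo σ t`; it is not divided by the probability of this event. -/
noncomputable def unsolvedGain (P : Params) (σ : Strategy) (t τ : ℝ) (d : EReal → EReal) : ℝ :=
  P.α * ((∫ x in t..τ, P.H * Real.exp (-P.H * x) * solvedGain P σ x (d x)) +
        P.p₂ * (jointLaw P (stageOneLaw P)).real (spillover σ t τ)) -
    P.c * ∫ r in t..τ, infoProb P σ r

lemma infoProb_pos {P : Params} (hα₀ : 0 < P.α) (hα₁ : P.α < 1) (hH : 0 < P.H)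
    (hμ : 0 < P.μ) {σ : Strategy} {T t : ℝ} (hT : σ.next Action.exit 0 = (T : EReal))
    (hT₀ : 0 ≤ T) (ht : 0 ≤ t) : 0 < infoProb P σ t := by
  rw [infoProb_eq hα₀ hα₁ hH hμ hT hT₀ ht]
  have := rivalHidden_nonneg P σ t
  have h : 0 < 1 - P.α := by linarith
  positivity

lemma unsolvedPayoff_coe {P : Params} (hα₀ : 0 < P.α) (hα₁ : P.α < 1) (hH : 0 < P.H)
    (hμ : 0 < P.μ) (hc : 0 < P.c) {σ : Strategy} {T t τ : ℝ}
    (hT : σ.next Action.exit 0 = (T : EReal)) (hT₀ : 0 ≤ T) (ht : 0 ≤ t) (htτ : t ≤ τ)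
    {d : EReal → EReal} (hd : Measurable d) (hxd : ∀ x, x ≤ d x) :
    unsolvedPayoff P σ t τ d = (((infoProb P σ t)⁻¹ * unsolvedGain P σ t τ d : ℝ) : EReal) := by
  have := isProbabilityMeasure_prior hα₀ hα₁ hH hμ
  have hm := measurableSet_unsolvedInfo σ t
  have hZ := infoProb_pos hα₀ hα₁ hH hμ hT hT₀ ht
  have hK : 0 ≤ ∫ r in t..τ, infoProb P σ r :=
    intervalIntegral.integral_nonneg htτ fun r _ => measureReal_nonneg
  have h1 : ∫⁻ w, stageOneTime t τ w.1.1 (rivalAnnounce σ w.2)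
      ∂(cond (prior P) (unsolvedInfo σ t)) =
      ENNReal.ofReal ((infoProb P σ t)⁻¹ * ∫ r in t..τ, infoProb P σ r) := by
    rw [ProbabilityTheory.cond, lintegral_smul_measure,
      lintegral_stageOneTime hα₀ hα₁ hH hμ σ htτ, smul_eq_mul,
      ENNReal.ofReal_mul (inv_nonneg.2 hZ.le), ENNReal.ofReal_inv_of_pos hZ, infoProb,
      ofReal_measureReal]
  rw [unsolvedPayoff, integral_cond _ hm, integral_rewardAgainst hα₀ hα₁ hH hμ σ ht htτ hd hxd,
    h1, ← ENNReal.ofReal_mul hc.le, EReal.coe_ennreal_ofReal, max_eq_left (by positivity),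
    ← EReal.coe_sub, unsolvedGain, infoProb]
  congr 1
  ring

/-- A firm which never exits pays an infinite expected cost, because stage 1 may be unsolvable. -/
lemma unsolvedPayoff_top {P : Params} (hα₀ : 0 < P.α) (hα₁ : P.α < 1) (hH : 0 < P.H)
    (hμ : 0 < P.μ) (hc : 0 < P.c) (σ : Strategy) (t : ℝ) (d : EReal → EReal) :
    unsolvedPayoff P σ t ⊤ d = ⊥ := by
  have := isProbabilityMeasure_prior hα₀ hα₁ hH hμ
  have := isProbabilityMeasure_jointLaw hμ (Measure.dirac (⊤ : EReal))
  have hm := measurableSet_unsolvedInfo σ t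
  set A : Set ((EReal × ℝ) × (EReal × ℝ)) := {w | w.1.1 = ⊤ ∧ w.2.1 = ⊤} with hA
  have hAi : A ⊆ unsolvedInfo σ t := by
    rintro ⟨⟨x, y⟩, ⟨x', y'⟩⟩ ⟨h1, h2⟩
    dsimp only at h1 h2
    subst h1 h2
    exact ⟨le_top, by rw [rivalAnnounce_top]; exact le_top⟩
  have hApos : prior P A ≠ 0 := by
    have h1 : jointLaw P (Measure.dirac ⊤) A = 1 := by
      rw [← prob_compl_eq_zero_iff₀]
      · exact ae_jointLaw_dirac P hμ
      · exact (((measurable_fst.comp measurable_fst) (measurableSet_singleton (⊤ : EReal))).inter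
          ((measurable_fst.comp measurable_snd) (measurableSet_singleton _))).nullMeasurableSet
    rw [prior, Measure.add_apply, Measure.smul_apply, Measure.smul_apply, h1]
    have h2 : ENNReal.ofReal (1 - P.α) ≠ 0 := by
      rw [Ne, ENNReal.ofReal_eq_zero]
      linarith
    simp only [smul_eq_mul, mul_one]
    exact fun h => h2 (add_eq_zero.1 h).2
  have h1 : ∫⁻ w, stageOneTime t ⊤ w.1.1 (rivalAnnounce σ w.2)
      ∂(cond (prior P) (unsolvedInfo σ t)) = ⊤ := by
    have h2 : ∀ w ∈ A, stageOneTime t ⊤ w.1.1 (rivalAnnounce σ w.2) = ⊤ := by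
      rintro ⟨⟨x, y⟩, ⟨x', y'⟩⟩ ⟨h1, h2⟩
      dsimp only at h1 h2
      subst h1 h2
      simp [stageOneTime, rivalAnnounce_top]
    have hAm : MeasurableSet A :=
      ((measurable_fst.comp measurable_fst) (measurableSet_singleton (⊤ : EReal))).inter
          ((measurable_fst.comp measurable_snd) (measurableSet_singleton _))
    have h3 : cond (prior P) (unsolvedInfo σ t) A ≠ 0 := by
      rw [cond_apply hm, Set.inter_eq_right.2 hAi]
      exact mul_ne_zero (ENNReal.inv_ne_zero.2 (measure_ne_top _ _)) hApos
    refine top_unique ?_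
    calc (⊤ : ℝ≥0∞) = ∫⁻ w in A, ⊤ ∂(cond (prior P) (unsolvedInfo σ t)) := by
          rw [setLIntegral_const, ENNReal.top_mul h3]
      _ = ∫⁻ w in A, stageOneTime t ⊤ w.1.1 (rivalAnnounce σ w.2)
            ∂(cond (prior P) (unsolvedInfo σ t)) :=
          (setLIntegral_congr_fun hAm h2).symm
      _ ≤ _ := setLIntegral_le_lintegral _ _
  rw [unsolvedPayoff, h1, ENNReal.mul_top (by simpa using hc)]
  simp

lemma unsolvedPayoff_le_iff {P : Params} (hα₀ : 0 < P.α) (hα₁ : P.α < 1) (hH : 0 < P.H)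
    (hμ : 0 < P.μ) (hc : 0 < P.c) {σ : Strategy} {T t τ τ' : ℝ}
    (hT : σ.next Action.exit 0 = (T : EReal)) (hT₀ : 0 ≤ T) (ht : 0 ≤ t) (htτ : t ≤ τ)
    (htτ' : t ≤ τ') {d d' : EReal → EReal} (hd : Measurable d) (hxd : ∀ x, x ≤ d x)
    (hd' : Measurable d') (hxd' : ∀ x, x ≤ d' x) :
    unsolvedPayoff P σ t τ d ≤ unsolvedPayoff P σ t τ' d' ↔
      unsolvedGain P σ t τ d ≤ unsolvedGain P σ t τ' d' := by
  rw [unsolvedPayoff_coe hα₀ hα₁ hH hμ hc hT hT₀ ht htτ hd hxd,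
    unsolvedPayoff_coe hα₀ hα₁ hH hμ hc hT hT₀ ht htτ' hd' hxd', EReal.coe_le_coe_iff]
  exact mul_le_mul_iff_right₀ (inv_pos.2 (infoProb_pos hα₀ hα₁ hH hμ hT hT₀ ht))

/-! ### A rival which discloses until `t₁` and withholds from then on until it exits -/

lemma integral_lt_prod {P : Params} (hH : 0 < P.H) (hμ : 0 < P.μ) {x' y' : ℝ} (hx' : 0 ≤ x')
    (hy' : 0 ≤ y') :
    ∫ x : ℝ, ∫ y, (if x' < x ∧ y < y' then (1 : ℝ) else 0) ∂expMeasure P.μ ∂expMeasure P.H =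
      Real.exp (-P.H * x') * (1 - Real.exp (-P.μ * y')) := by
  have h1 : ∀ᵐ x ∂expMeasure P.H, ∫ y, (if x' < x ∧ y < y' then (1 : ℝ) else 0) ∂expMeasure P.μ =
      if x' ≤ x then (1 - Real.exp (-P.μ * y')) else 0 := by
    filter_upwards [ae_ne_expMeasure x'] with x hx
    have h2 : x' ≤ x ↔ x' < x := ⟨fun h => lt_of_le_of_ne h hx.symm, le_of_lt⟩
    simp only [h2]
    by_cases h : x' < x
    · simp only [h, true_and, if_true]
      rw [integral_expMeasure_lt hμ hy', one_mul]
    · simp [h]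
  rw [integral_congr_ae h1, integral_expMeasure_le hH hx', mul_comm]

/-- Only a disclosure in `[0, t₁)` lets a firm without a solution win `p₂`: then both firms
start on stage 2 at the same time, and each wins with probability `1 / 2`. -/
lemma jointLaw_spillover {P : Params} (hH : 0 < P.H) (hμ : 0 < P.μ) {σ : Strategy} {T t₁ t τ : ℝ}
    (hT : σ.next Action.exit 0 = (T : EReal)) (ht : 0 ≤ t) (htτ : t ≤ τ) (ht₁T : t₁ ≤ T)
    (h₁ : ∀ x : ℝ, 0 ≤ x → x < t₁ → σ.next Action.disclose x = x)
    (h₂ : ∀ x : ℝ, t₁ ≤ x → x < T → (τ : EReal) ≤ σ.next Action.disclose x) :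
    (jointLaw P (stageOneLaw P)).real (spillover σ t τ) =
      ∫ r in t..τ, P.H * Real.exp (-P.H * r) *
        (if r < t₁ then Real.exp (-P.H * r) / 2 else 0) := by
  classical
  have := isProbabilityMeasure_expMeasure hμ
  have := isProbabilityMeasure_expMeasure hH
  have := isProbabilityMeasure_stageOneLaw hH
  have hm := measurableSet_spillover σ t τ
  have hi : Integrable ((spillover σ t τ).indicator (1 : (EReal × ℝ) × (EReal × ℝ) → ℝ))
      (((stageOneLaw P).prod (expMeasure P.μ)).prod ((stageOneLaw P).prod (expMeasure P.μ))) :=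
    (integrable_const (1 : ℝ)).indicator hm
  rw [← integral_indicator_one hm, jointLaw, integral_prod_symm _ hi,
    integral_prod _ hi.integral_prod_right, integral_stageOneLaw,
    ← integral_expMeasure_Ico hH ht htτ]
  refine integral_congr_ae ?_
  filter_upwards [ae_pos_expMeasure] with x' hx'
  have key : ∀ᵐ y' ∂expMeasure P.μ, ∫ a, (spillover σ t τ).indicator
      (1 : (EReal × ℝ) × (EReal × ℝ) → ℝ) (a, ((x' : EReal), y'))
      ∂((stageOneLaw P).prod (expMeasure P.μ)) =
      if (t ≤ x' ∧ x' < τ) ∧ x' < t₁ then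
        Real.exp (-P.H * x') * (1 - Real.exp (-P.μ * y')) else 0 := by
    filter_upwards [ae_pos_expMeasure] with y' hy'
    rw [integral_prod, integral_stageOneLaw]
    · have h3 : ∀ x : ℝ, ∫ y, (spillover σ t τ).indicator
          (1 : (EReal × ℝ) × (EReal × ℝ) → ℝ) (((x : EReal), y), ((x' : EReal), y'))
          ∂expMeasure P.μ = ∫ y, (if (t ≤ x' ∧ x' < τ) ∧ x' < t₁ then
            (if x' < x ∧ y < y' then (1 : ℝ) else 0) else 0) ∂expMeasure P.μ := by
        intro x
        refine integral_congr_ae ?_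
        filter_upwards [ae_pos_expMeasure] with y hy
        rw [Set.indicator_apply, ← ite_and]
        refine if_congr ?_ rfl rfl
        constructor
        · rintro ⟨e1, e2, e3, e4⟩
          dsimp only at e1 e2 e3 e4
          have hxT : (x' : EReal) < σ.next Action.exit 0 := by
            by_contra h
            have : rivalAnnounce σ ((x' : EReal), y') = ⊤ := announceTime_of_le (not_lt.1 h) y'
            rw [this] at e2
            exact not_top_lt e2
          have ha : rivalAnnounce σ ((x' : EReal), y') =
              min (σ.next Action.disclose x') ((x' + y' : ℝ) : EReal) := by
            rw [EReal.coe_add]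
            exact announceTime_of_lt hxT y'
          have hlt : x' < t₁ := by
            by_contra h
            have h4 := h₂ x' (not_lt.1 h) (by rw [hT] at hxT; exact_mod_cast hxT)
            rw [ha] at e2 e4
            rcases min_lt_iff.1 e2 with h5 | h5
            · exact not_lt.2 h4 h5
            · rw [min_eq_right (h5.le.trans h4)] at e4
              have e5 : ((x' + y' + y : ℝ) : EReal) < ((x' + y' : ℝ) : EReal) := by
                exact_mod_cast e4
              rw [EReal.coe_lt_coe_iff] at e5
              linarith
          have hle : (x' : EReal) ≤ ((x' + y' : ℝ) : EReal) := by
            rw [EReal.coe_le_coe_iff]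
            linarith
          rw [ha, h₁ x' hx'.le hlt, min_eq_left hle] at e1 e2 e3 e4
          have e5 : ((x' + y : ℝ) : EReal) < ((x' + y' : ℝ) : EReal) := by exact_mod_cast e4
          rw [EReal.coe_lt_coe_iff] at e5
          refine ⟨⟨⟨by exact_mod_cast e1, by exact_mod_cast e2⟩, hlt⟩, by exact_mod_cast e3, ?_⟩
          linarith
        · rintro ⟨⟨⟨e1, e2⟩, hlt⟩, e3, e4⟩
          have hxT : (x' : EReal) < σ.next Action.exit 0 := by
            rw [hT]
            exact_mod_cast hlt.trans_le ht₁T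
          have hle : (x' : EReal) ≤ ((x' + y' : ℝ) : EReal) := by
            rw [EReal.coe_le_coe_iff]
            linarith
          have ha : rivalAnnounce σ ((x' : EReal), y') = x' := by
            have : rivalAnnounce σ ((x' : EReal), y') =
                min (σ.next Action.disclose x') ((x' + y' : ℝ) : EReal) := by
              rw [EReal.coe_add]
              exact announceTime_of_lt hxT y'
            rw [this, h₁ x' hx'.le hlt, min_eq_left hle]
          refine ⟨?_, ?_, ?_, ?_⟩
          · rw [ha]
            exact_mod_cast e1
          · rw [ha]
            exact_mod_cast e2
          · rw [ha]
            exact EReal.coe_lt_coe_iff.2 e3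
          · rw [ha]
            dsimp only
            rw [← EReal.coe_add, ← EReal.coe_add, EReal.coe_lt_coe_iff]
            linarith
      simp only [h3]
      by_cases h : (t ≤ x' ∧ x' < τ) ∧ x' < t₁
      · simp only [if_pos h]
        exact integral_lt_prod hH hμ hx'.le hy'.le
      · simp [if_neg h]
    · refine integrable_of_measurable_of_bound ?_ 1 (fun v => abs_indicator_le zero_le_one
        (by simp) _)
      exact (measurable_one.indicator hm).comp (by fun_prop)
  rw [integral_congr_ae key]
  by_cases h : (t ≤ x' ∧ x' < τ)
  · by_cases h' : x' < t₁
    · simp only [h, h', and_self, if_true]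
      rw [integral_const_mul, integral_sub (integrable_const _), integral_exp_expMeasure hμ hμ.le]
      · simp only [integral_const, probReal_univ, smul_eq_mul, one_mul]
        field_simp
        ring
      · refine Integrable.of_bound (C := 1) (by fun_prop) ?_
        filter_upwards [ae_pos_expMeasure] with z hz
        rw [Real.norm_eq_abs, abs_of_pos (Real.exp_pos _)]
        exact Real.exp_le_one_iff.2 (by nlinarith)
    · simp [h']
  · simp [h]

lemma rivalHidden_of_disclose {P : Params} {σ : Strategy} {t₁ x : ℝ}
    (h₁ : ∀ x : ℝ, 0 ≤ x → x < t₁ → σ.next Action.disclose x = x) (hx : x ≤ t₁) :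
    rivalHidden P σ x = 0 := by
  rw [rivalHidden]
  refine integral_eq_zero_of_ae ?_
  filter_upwards [ae_pos_expMeasure] with x' hx'
  rw [if_neg]
  · rfl
  · rintro ⟨h3, -, h4⟩
    rw [h₁ x' hx'.le (h3.trans_le hx), EReal.coe_le_coe_iff] at h4
    linarith

lemma rivalHidden_of_withhold {P : Params} (hH : 0 < P.H) {σ : Strategy} {T t₁ x : ℝ}
    (hT : σ.next Action.exit 0 = (T : EReal)) (ht₁ : 0 ≤ t₁) (ht₁T : t₁ ≤ T) (hx : t₁ ≤ x)
    (h₁ : ∀ x : ℝ, 0 ≤ x → x < t₁ → σ.next Action.disclose x = x)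
    (h₂ : ∀ z : ℝ, t₁ ≤ z → z < T → (x : EReal) ≤ σ.next Action.disclose z) :
    rivalHidden P σ x = Real.exp (-P.H * t₁) * Real.exp (-P.μ * (x - min x T)) *
      hiddenSuccess P (min x T - t₁) := by
  set m := min x T with hm
  have h3 : rivalHidden P σ x =
      ∫ x' : ℝ, (if t₁ ≤ x' ∧ x' < m then Real.exp (-P.μ * (x - x')) else 0) ∂expMeasure P.H := by
    rw [rivalHidden]
    refine integral_congr_ae ?_
    filter_upwards [ae_pos_expMeasure] with x' hx'
    refine if_congr ?_ rfl rfl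
    rw [hT, EReal.coe_lt_coe_iff]
    constructor
    · rintro ⟨h4, h5, h6⟩
      refine ⟨?_, lt_min h4 h5⟩
      by_contra h7
      rw [h₁ x' hx'.le (not_le.1 h7), EReal.coe_le_coe_iff] at h6
      linarith
    · rintro ⟨h4, h5⟩
      have h6 := lt_min_iff.1 h5
      exact ⟨h6.1, h6.2, h₂ x' h4 h6.2⟩
  have h4 := intervalIntegral.integral_comp_add_right
    (fun r => P.H * Real.exp (-P.H * r) * Real.exp (-P.μ * (x - r))) (a := 0) (b := m - t₁) t₁
  rw [h3, integral_expMeasure_Ico hH ht₁ (le_min hx ht₁T), hiddenSuccess,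
    ← intervalIntegral.integral_const_mul]
  rw [zero_add, sub_add_cancel] at h4
  rw [← h4]
  congr 1
  ext s
  have h5 : Real.exp (-P.H * (s + t₁)) = Real.exp (-P.H * t₁) * Real.exp (-P.H * s) := by
    rw [← Real.exp_add]; congr 1; ring
  have h6 : Real.exp (-P.μ * (x - (s + t₁))) =
      Real.exp (-P.μ * (x - m)) * Real.exp (-(m - t₁ - s) * P.μ) := by
    rw [← Real.exp_add]; congr 1; ring
  rw [h5, h6]
  ring

/-! ### The flow of gains of a firm without a solution -/

lemma measurable_solvedGain {P : Params} (hH : 0 < P.H) (hμ : 0 < P.μ) (σ : Strategy)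
    {d : EReal → EReal} (hd : Measurable d) :
    Measurable fun x : ℝ => solvedGain P σ x (d x) := by
  have := isProbabilityMeasure_expMeasure hμ
  have := isProbabilityMeasure_stageOneLaw hH
  have hx : Measurable fun z : ℝ × (ℝ × (EReal × ℝ)) => (z.1 : EReal) :=
    measurable_coe_real_ereal.comp measurable_fst
  have h : Measurable (Function.uncurry fun (x : ℝ) (w : ℝ × (EReal × ℝ)) =>
      if (x : EReal) ≤ rivalAnnounce σ w.2 then rewardAgainst P σ ⊤ (d x) x w.1 w.2 else 0) := by
    refine Measurable.ite (measurableSet_le hx ((measurable_rivalAnnounce σ).comp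
      (measurable_snd.comp measurable_snd))) ?_ measurable_const
    exact measurable_rewardAgainst P σ measurable_const (hd.comp hx) hx
      (measurable_fst.comp measurable_snd) (measurable_snd.comp measurable_snd)
  exact h.stronglyMeasurable.integral_prod_right.measurable

lemma abs_solvedGain_le {P : Params} (hH : 0 < P.H) (hμ : 0 < P.μ) (σ : Strategy) (x : ℝ)
    (δ : EReal) : |solvedGain P σ x δ| ≤ |P.p₁| + |P.p₂| := by
  have := isProbabilityMeasure_expMeasure hμ
  have := isProbabilityMeasure_stageOneLaw hH
  have h := norm_integral_le_of_norm_le_const (μ := (expMeasure P.μ).prod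
    ((stageOneLaw P).prod (expMeasure P.μ))) (C := |P.p₁| + |P.p₂|)
    (f := fun w : ℝ × (EReal × ℝ) => if (x : EReal) ≤ rivalAnnounce σ w.2 then
      rewardAgainst P σ ⊤ δ x w.1 w.2 else 0) (Filter.Eventually.of_forall fun w => by
        rw [Real.norm_eq_abs]
        split_ifs
        · exact abs_rewardAgainst_le ..
        · simp; positivity)
  rw [solvedGain]
  simpa using h

lemma intervalIntegrable_exp_mul {H C a b : ℝ} {f : ℝ → ℝ} (hf : Measurable f)
    (hC : ∀ x, |f x| ≤ C) :
    IntervalIntegrable (fun x => H * Real.exp (-H * x) * f x) volume a b := by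
  have h1 : IntervalIntegrable f volume a b := by
    refine (intervalIntegrable_const (c := C)).mono_fun hf.aestronglyMeasurable ?_
    refine Filter.Eventually.of_forall fun x => ?_
    simp only [Real.norm_eq_abs]
    exact (hC x).trans (le_abs_self C)
  exact h1.continuousOn_mul (by fun_prop)

lemma intervalIntegrable_solvedGain {P : Params} (hH : 0 < P.H) (hμ : 0 < P.μ) (σ : Strategy)
    {d : EReal → EReal} (hd : Measurable d) (a b : ℝ) :
    IntervalIntegrable (fun x : ℝ => P.H * Real.exp (-P.H * x) * solvedGain P σ x (d x))
      volume a b :=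
  intervalIntegrable_exp_mul (measurable_solvedGain hH hμ σ hd)
    (fun x => abs_solvedGain_le hH hμ σ x (d x))

lemma intervalIntegrable_spillover (P : Params) {t₁ a b : ℝ} :
    IntervalIntegrable (fun r : ℝ => P.H * Real.exp (-P.H * r) *
        (if r < t₁ then Real.exp (-P.H * r) / 2 else 0)) volume a b := by
  have h : IntervalIntegrable (fun r : ℝ => if r < t₁ then Real.exp (-P.H * r) / 2 else 0)
      volume a b := by
    have h1 : IntervalIntegrable (fun r : ℝ => Real.exp (-P.H * r) / 2) volume a b :=
      Continuous.intervalIntegrable (by fun_prop) _ _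
    refine h1.mono_fun (Measurable.ite measurableSet_Iio (by fun_prop)
      measurable_const).aestronglyMeasurable ?_
    refine Filter.Eventually.of_forall fun x => ?_
    dsimp only
    split_ifs
    · exact le_rfl
    · rw [norm_zero]
      exact norm_nonneg _
  exact h.continuousOn_mul (by fun_prop)

/-- The expected gain per unit of time, at time `r`, of a firm without a solution which stays in the
game and uses the disclosure plan of `σ`, against a rival which discloses before `t₁` and
withholds from then on. -/
noncomputable def flow (P : Params) (σ : Strategy) (t₁ r : ℝ) : ℝ :=
  P.α * (P.H * Real.exp (-P.H * r) * solvedGain P σ r (σ.next Action.disclose r) +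
    P.p₂ * (P.H * Real.exp (-P.H * r) * (if r < t₁ then Real.exp (-P.H * r) / 2 else 0))) -
    P.c * infoProb P σ r

lemma intervalIntegrable_flow {P : Params} (hα₀ : 0 < P.α) (hα₁ : P.α < 1) (hH : 0 < P.H)
    (hμ : 0 < P.μ) (σ : Strategy) (t₁ a b : ℝ) :
    IntervalIntegrable (flow P σ t₁) volume a b :=
  (((intervalIntegrable_solvedGain hH hμ σ (σ.measurable_next _) a b).add
    ((intervalIntegrable_spillover P).const_mul _)).const_mul _).sub
    ((infoProb_antitone hα₀ hα₁ hH hμ σ).intervalIntegrable.const_mul _)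

/-- The gain of a firm without a solution is the integral of its flow. The hypotheses describe a
rival which discloses on `[0, t₁)` and whose solutions found in `[t₁, T)` stay hidden until `τ`.
-/
lemma integral_flow {P : Params} (hα₀ : 0 < P.α) (hα₁ : P.α < 1) (hH : 0 < P.H)
    (hμ : 0 < P.μ) {σ : Strategy} {T t₁ t τ : ℝ}
    (hT : σ.next Action.exit 0 = (T : EReal)) (ht : 0 ≤ t) (htτ : t ≤ τ) (ht₁T : t₁ ≤ T)
    (h₁ : ∀ x : ℝ, 0 ≤ x → x < t₁ → σ.next Action.disclose x = x)
    (h₂ : ∀ x : ℝ, t₁ ≤ x → x < T → (τ : EReal) ≤ σ.next Action.disclose x) :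
    unsolvedGain P σ t τ (σ.next Action.disclose) = ∫ r in t..τ, flow P σ t₁ r := by
  have i1 := intervalIntegrable_solvedGain hH hμ σ (σ.measurable_next Action.disclose) t τ
  have i2 : IntervalIntegrable (fun r : ℝ => P.p₂ * (P.H * Real.exp (-P.H * r) *
        (if r < t₁ then Real.exp (-P.H * r) / 2 else 0))) volume t τ :=
    (intervalIntegrable_spillover P).const_mul _
  have i3 : IntervalIntegrable (fun r => P.c * infoProb P σ r) volume t τ :=
    (infoProb_antitone hα₀ hα₁ hH hμ σ).intervalIntegrable.const_mul _
  rw [unsolvedGain, jointLaw_spillover hH hμ hT ht htτ ht₁T h₁ h₂]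
  unfold flow
  rw [intervalIntegral.integral_sub ((i1.add i2).const_mul _) i3,
    intervalIntegral.integral_const_mul, intervalIntegral.integral_add i1 i2,
    intervalIntegral.integral_const_mul, intervalIntegral.integral_const_mul]

/-- If the disclosure plan of `σ` is optimal, then no other plan with the same exit time is
better. -/
lemma unsolvedGain_mono {P : Params} (hα₀ : 0 < P.α) (hH : 0 < P.H)
    (hμ : 0 < P.μ) {σ : Strategy} {t τ : ℝ} (htτ : t ≤ τ) {d d' : EReal → EReal}
    (hd : Measurable d) (hd' : Measurable d')
    (h : ∀ x : ℝ, t ≤ x → solvedGain P σ x (d x) ≤ solvedGain P σ x (d' x)) :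
    unsolvedGain P σ t τ d ≤ unsolvedGain P σ t τ d' := by
  have h1 : ∫ x in t..τ, P.H * Real.exp (-P.H * x) * solvedGain P σ x (d x) ≤
      ∫ x in t..τ, P.H * Real.exp (-P.H * x) * solvedGain P σ x (d' x) := by
    refine intervalIntegral.integral_mono_on htτ (intervalIntegrable_solvedGain hH hμ σ hd t τ)
      (intervalIntegrable_solvedGain hH hμ σ hd' t τ) fun x hx => ?_
    exact mul_le_mul_of_nonneg_left (h x hx.1) (by positivity)
  unfold unsolvedGain
  have := mul_le_mul_of_nonneg_left (add_le_add_left h1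
    (P.p₂ * (jointLaw P (stageOneLaw P)).real (spillover σ t τ))) hα₀.le
  linarith

/-- The net gain per unit of time from staying at the common exit time, on the event that stage 1 is
solvable, when a time span `u` has been spent in the withhold region. The two terms are weighted
with the probabilities that the rival is still in stage 1 and that it hides a solution. -/
noncomputable def exitGain (P : Params) (u : ℝ) : ℝ :=
  (P.H * (P.p₁ + P.p₂) - P.c) * Real.exp (-P.H * u) +
    (P.H * ((P.p₁ + P.p₂) / 2) - P.c) * hiddenSuccess P u

/-- The same net gain per unit of time as `exitGain`, but at an earlier time, when a span `u` of a
withhold region of length `U` has passed: a solution found now has to be hidden from a rival in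
stage 1 for the remaining span `U - u`. -/
noncomputable def stayGain (P : Params) (U u : ℝ) : ℝ :=
  (P.H * waitValue P (U - u) - P.c) * Real.exp (-P.H * u) +
    (P.H * ((P.p₁ + P.p₂) / 2) - P.c) * hiddenSuccess P u

lemma stayGain_self (P : Params) (U : ℝ) : stayGain P U U = exitGain P U := by
  simp [stayGain, exitGain, waitValue]

lemma waitValue_zero (P : Params) : waitValue P 0 = P.p₁ + P.p₂ := by
  simp [waitValue]

/-- In the disclosure region no rival hides a solution; a firm gains `p₁ + p₂ / 2` from its own
success and `p₂ / 2` from that of its rival. -/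
lemma flow_of_disclose {P : Params} (hα₀ : 0 < P.α) (hα₁ : P.α < 1) (hH : 0 < P.H)
    (hμ : 0 < P.μ) {σ : Strategy} {T t₁ r : ℝ}
    (hT : σ.next Action.exit 0 = (T : EReal)) (hr : 0 ≤ r) (hrt : r < t₁) (ht₁T : t₁ ≤ T)
    (h₁ : ∀ x : ℝ, 0 ≤ x → x < t₁ → σ.next Action.disclose x = x) :
    flow P σ t₁ r = P.α * Real.exp (-2 * P.H * r) * (P.H * (P.p₁ + P.p₂) - P.c) -
      P.c * (1 - P.α) := by
  have h2 := rivalHidden_of_disclose (P := P) h₁ hrt.le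
  have h3 : Real.exp (-2 * P.H * r) = Real.exp (-P.H * r) * Real.exp (-P.H * r) := by
    rw [← Real.exp_add]; congr 1; ring
  rw [flow, h₁ r hr hrt, infoProb_eq hα₀ hα₁ hH hμ hT (hr.trans (hrt.le.trans ht₁T)) hr,
    solvedGain_of_disclose hH hμ hT hr le_rfl (hrt.trans_le ht₁T), h2, if_pos hrt, sub_self,
    waitValue_zero, min_eq_left (hrt.le.trans ht₁T), h3, mul_zero (-(P.H + P.μ)), Real.exp_zero]
  ring

lemma flow_of_withhold {P : Params} (hα₀ : 0 < P.α) (hα₁ : P.α < 1) (hH : 0 < P.H)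
    (hμ : 0 < P.μ) {σ : Strategy} {T t₁ r : ℝ}
    (hT : σ.next Action.exit 0 = (T : EReal)) (ht₁ : 0 ≤ t₁) (hrt : t₁ ≤ r) (hrT : r < T)
    (h₁ : ∀ x : ℝ, 0 ≤ x → x < t₁ → σ.next Action.disclose x = x)
    (h₂ : ∀ x : ℝ, t₁ ≤ x → x < T → (T : EReal) ≤ σ.next Action.disclose x) :
    flow P σ t₁ r = P.α * (Real.exp (-2 * P.H * t₁) * (Real.exp (-P.H * (r - t₁)) *
      stayGain P (T - t₁) (r - t₁))) - P.c * (1 - P.α) := by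
  have hr : 0 ≤ r := ht₁.trans hrt
  have h2 := rivalHidden_of_withhold hH hT ht₁ (hrt.trans hrT.le) hrt h₁ fun z hz hz' =>
    le_trans (by exact_mod_cast hrT.le) (h₂ z hz hz')
  rw [min_eq_left hrT.le, sub_self, mul_zero, Real.exp_zero, mul_one] at h2
  have h3 : Real.exp (-2 * P.H * t₁) = Real.exp (-P.H * t₁) * Real.exp (-P.H * t₁) := by
    rw [← Real.exp_add]; congr 1; ring
  have h4 : Real.exp (-P.H * r) = Real.exp (-P.H * t₁) * Real.exp (-P.H * (r - t₁)) := by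
    rw [← Real.exp_add]; congr 1; ring
  rw [flow, infoProb_eq hα₀ hα₁ hH hμ hT (hr.trans hrT.le) hr,
    solvedGain_of_wait hH hμ hT hr hrT (h₂ r hrt hrT), h2, if_neg (not_lt.2 hrt),
    min_eq_left hrT.le, h3, h4, stayGain, sub_sub_sub_cancel_right]
  ring

lemma flow_of_exit {P : Params} (hα₀ : 0 < P.α) (hα₁ : P.α < 1) (hH : 0 < P.H)
    (hμ : 0 < P.μ) {σ : Strategy} {T t₁ r : ℝ}
    (hT : σ.next Action.exit 0 = (T : EReal)) (ht₁ : 0 ≤ t₁) (ht₁T : t₁ ≤ T) (hrT : T ≤ r)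
    (h₁ : ∀ x : ℝ, 0 ≤ x → x < t₁ → σ.next Action.disclose x = x)
    (h₂ : ∀ x : ℝ, t₁ ≤ x → x < T → (r : EReal) ≤ σ.next Action.disclose x) :
    flow P σ t₁ r = P.α * (Real.exp (-2 * P.H * t₁) * (Real.exp (-P.H * (r - t₁)) *
      ((P.H * (P.p₁ + P.p₂) - P.c) * Real.exp (-P.H * (T - t₁)) +
        (P.H * ((P.p₁ + P.p₂) / 2) - P.c) * (Real.exp (-P.μ * (r - T)) *
          hiddenSuccess P (T - t₁))))) - P.c * (1 - P.α) := by
  have hT₀ : 0 ≤ T := ht₁.trans ht₁T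
  have hr : 0 ≤ r := hT₀.trans hrT
  have h2 := rivalHidden_of_withhold hH hT ht₁ ht₁T (ht₁T.trans hrT) h₁ h₂
  rw [min_eq_right hrT] at h2
  have h3 : Real.exp (-2 * P.H * t₁) = Real.exp (-P.H * t₁) * Real.exp (-P.H * t₁) := by
    rw [← Real.exp_add]; congr 1; ring
  have h4 : Real.exp (-P.H * r) = Real.exp (-P.H * t₁) * Real.exp (-P.H * (r - t₁)) := by
    rw [← Real.exp_add]; congr 1; ring
  have h5 : Real.exp (-P.H * T) = Real.exp (-P.H * t₁) * Real.exp (-P.H * (T - t₁)) := by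
    rw [← Real.exp_add]; congr 1; ring
  rw [flow, infoProb_eq hα₀ hα₁ hH hμ hT hT₀ hr,
    solvedGain_of_exited hH hμ hT hT₀ hrT (σ.le_next _ _), h2,
    if_neg (not_lt.2 (ht₁T.trans hrT)), min_eq_right hrT, h3, h4, h5]
  ring

/-! ### Piecewise constant strategies -/

lemma Strategy.exists_const_right (σ : Strategy) {r : ℝ} (hr : 0 ≤ r) :
    ∃ ε > 0, ∀ u, r ≤ u → u < r + ε → σ.act u = σ.act r := by
  obtain ⟨S, hS⟩ := σ.piecewise
  have h1 : ∀ᶠ u in nhdsWithin r (Set.Ioi r), ∀ x ∈ S, x ≤ r ∨ u < x := by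
    rw [Filter.eventually_all_finset]
    intro x _
    by_cases hx : x ≤ r
    · exact Filter.Eventually.of_forall fun u => Or.inl hx
    · filter_upwards [nhdsWithin_le_nhds (Iio_mem_nhds (not_le.1 hx))] with u hu
      exact Or.inr hu
  obtain ⟨b, hb, hsub⟩ := (mem_nhdsGT_iff_exists_Ioo_subset).1 h1
  refine ⟨b - r, sub_pos.2 hb, fun u hu hu' => ?_⟩
  rcases hu.eq_or_lt with rfl | hu
  · rfl
  · exact (hS r u hr hu.le (hsub ⟨hu, by linarith⟩)).symm

lemma Strategy.next_le (σ : Strategy) {k : Action} {s : EReal} {r : ℝ} (hs : s ≤ r)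
    (hr : σ.act r = k) : σ.next k s ≤ r :=
  sInf_le ⟨r, ⟨hs, hr⟩, rfl⟩

lemma Strategy.next_eq_self (σ : Strategy) {k : Action} {r : ℝ} (hr : σ.act r = k) :
    σ.next k r = r :=
  le_antisymm (σ.next_le le_rfl hr) (σ.le_next _ _)

lemma Strategy.le_next_of_forall (σ : Strategy) {k : Action} {s : EReal} {b : EReal}
    (h : ∀ u : ℝ, s ≤ u → (u : EReal) < b → σ.act u ≠ k) : b ≤ σ.next k s := by
  refine le_sInf ?_
  rintro _ ⟨r, ⟨h1, h2⟩, rfl⟩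
  by_contra h3
  exact h r h1 (not_le.1 h3) h2

lemma Strategy.act_ne_of_lt_next (σ : Strategy) {k : Action} {s : EReal} {u : ℝ}
    (hs : s ≤ u) (hu : (u : EReal) < σ.next k s) : σ.act u ≠ k :=
  fun h => not_le.2 hu (σ.next_le hs h)

/-- The infimum in the definition of `next` is attained, because strategies are constant on
half-open intervals. -/
lemma Strategy.act_of_next_eq (σ : Strategy) {k : Action} {s : EReal} {r : ℝ} (hr : 0 ≤ r)
    (h : σ.next k s = r) : σ.act r = k := by
  obtain ⟨ε, hε, hc⟩ := σ.exists_const_right hr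
  by_contra hne
  have hs : s ≤ r := h ▸ σ.le_next k s
  have h1 : ((r + ε : ℝ) : EReal) ≤ σ.next k s := by
    refine σ.le_next_of_forall fun u hu hu' => ?_
    have hu'' : u < r + ε := by exact_mod_cast hu'
    by_cases hru : r ≤ u
    · rw [hc u hru hu'']
      exact hne
    · refine σ.act_ne_of_lt_next hu ?_
      rw [h]
      exact_mod_cast not_le.1 hru
  rw [h, EReal.coe_le_coe_iff] at h1
  linarith

lemma Strategy.next_eq_of_le (σ : Strategy) {k : Action} {s t : EReal} (hst : s ≤ t)
    (ht : t ≤ σ.next k s) : σ.next k t = σ.next k s := by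
  refine le_antisymm (le_sInf ?_) (σ.next_mono k hst)
  rintro _ ⟨r, ⟨h1, h2⟩, rfl⟩
  exact σ.next_le (ht.trans (σ.next_le h1 h2)) h2

/-! ### The probability of a hidden success -/

lemma hiddenSuccess_eq_exp_mul (P : Params) (u : ℝ) :
    hiddenSuccess P u =
      Real.exp (-P.μ * u) * ∫ s in (0 : ℝ)..u, P.H * Real.exp ((P.μ - P.H) * s) := by
  rw [hiddenSuccess, ← intervalIntegral.integral_const_mul]
  congr 1
  ext s
  have h : Real.exp (-P.H * s) * Real.exp (-(u - s) * P.μ) =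
      Real.exp (-P.μ * u) * Real.exp ((P.μ - P.H) * s) := by
    rw [← Real.exp_add, ← Real.exp_add]; congr 1; ring
  rw [mul_assoc, h]
  ring

lemma hiddenSuccess_zero (P : Params) : hiddenSuccess P 0 = 0 := by
  simp [hiddenSuccess]

lemma hasDerivAt_hiddenSuccess (P : Params) (u : ℝ) :
    HasDerivAt (hiddenSuccess P) (P.H * Real.exp (-P.H * u) - P.μ * hiddenSuccess P u) u := by
  have h0 : hiddenSuccess P = fun u => Real.exp (-P.μ * u) *
      ∫ s in (0 : ℝ)..u, P.H * Real.exp ((P.μ - P.H) * s) := funext (hiddenSuccess_eq_exp_mul P)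
  have hc : Continuous fun s : ℝ => P.H * Real.exp ((P.μ - P.H) * s) := by fun_prop
  have h1 : HasDerivAt (fun u : ℝ => ∫ s in (0 : ℝ)..u, P.H * Real.exp ((P.μ - P.H) * s))
      (P.H * Real.exp ((P.μ - P.H) * u)) u :=
    intervalIntegral.integral_hasDerivAt_right (hc.intervalIntegrable _ _)
      (hc.stronglyMeasurableAtFilter _ _) hc.continuousAt
  have h2 : HasDerivAt (fun u : ℝ => Real.exp (-P.μ * u)) (Real.exp (-P.μ * u) * -P.μ) u := by
    simpa using ((hasDerivAt_id u).const_mul (-P.μ)).exp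
  have h3 := h2.mul h1
  have h4 : Real.exp (-P.H * u) = Real.exp (-P.μ * u) * Real.exp ((P.μ - P.H) * u) := by
    rw [← Real.exp_add]; congr 1; ring
  rw [hiddenSuccess_eq_exp_mul P u, h0, h4]
  convert! h3 using 1
  ring

lemma continuous_hiddenSuccess (P : Params) : Continuous (hiddenSuccess P) :=
  continuous_iff_continuousAt.2 fun u => (hasDerivAt_hiddenSuccess P u).continuousAt

lemma hiddenSuccess_nonneg {P : Params} (hH : 0 < P.H) {u : ℝ} (hu : 0 ≤ u) :
    0 ≤ hiddenSuccess P u :=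
  intervalIntegral.integral_nonneg hu fun s _ => by positivity

/-- Hidden solutions cannot leak out faster than they arrive. -/
lemma mul_hiddenSuccess_le {P : Params} (hH : 0 < P.H) (hμ : 0 < P.μ) {u : ℝ} (hu : 0 ≤ u) :
    P.μ * hiddenSuccess P u ≤ P.H := by
  have h1 : ∫ s in (0 : ℝ)..u, P.H * Real.exp ((P.μ - P.H) * s) ≤
      ∫ s in (0 : ℝ)..u, P.H * Real.exp (P.μ * s) := by
    refine intervalIntegral.integral_mono_on hu (Continuous.intervalIntegrable (by fun_prop) _ _)
      (Continuous.intervalIntegrable (by fun_prop) _ _) fun s hs => ?_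
    refine mul_le_mul_of_nonneg_left (Real.exp_le_exp.2 ?_) hH.le
    nlinarith [hs.1]
  have h5 : ∫ s in (0 : ℝ)..u, P.H * Real.exp (P.μ * s) =
      P.H * (P.μ⁻¹ * (Real.exp (P.μ * u) - 1)) := by
    rw [intervalIntegral.integral_const_mul, intervalIntegral.integral_comp_mul_left _ hμ.ne',
      integral_exp, mul_zero, Real.exp_zero, smul_eq_mul]
  rw [h5] at h1
  have h2 : Real.exp (-P.μ * u) * Real.exp (P.μ * u) = 1 := by
    rw [← Real.exp_add]; simp
  rw [hiddenSuccess_eq_exp_mul]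
  have h3 := mul_le_mul_of_nonneg_left h1
    (mul_nonneg hμ.le (Real.exp_pos (-P.μ * u)).le)
  have h4 : P.μ * Real.exp (-P.μ * u) * (P.H * (P.μ⁻¹ * (Real.exp (P.μ * u) - 1))) =
      P.H * (Real.exp (-P.μ * u) * Real.exp (P.μ * u) - Real.exp (-P.μ * u)) := by
    field_simp
  rw [h4, h2] at h3
  nlinarith [Real.exp_pos (-P.μ * u)]

lemma hiddenSuccess_of_ne {P : Params} (h : P.H ≠ P.μ) (u : ℝ) :
    hiddenSuccess P u = P.H / (P.H - P.μ) * (Real.exp (-P.μ * u) - Real.exp (-P.H * u)) := by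
  have h0 : P.μ - P.H ≠ 0 := sub_ne_zero.2 h.symm
  have h0' : P.H - P.μ ≠ 0 := sub_ne_zero.2 h
  have h4 : Real.exp (-P.H * u) = Real.exp (-P.μ * u) * Real.exp ((P.μ - P.H) * u) := by
    rw [← Real.exp_add]; congr 1; ring
  rw [hiddenSuccess_eq_exp_mul, intervalIntegral.integral_const_mul,
    intervalIntegral.integral_comp_mul_left _ h0, integral_exp, h4, mul_zero, Real.exp_zero,
    smul_eq_mul]
  have h5 : (P.μ - P.H)⁻¹ = -(P.H - P.μ)⁻¹ := by
    rw [← neg_sub, neg_inv]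
  rw [h5]
  field_simp
  ring

lemma hiddenSuccess_of_eq {P : Params} (h : P.H = P.μ) (u : ℝ) :
    hiddenSuccess P u = P.H * u * Real.exp (-P.H * u) := by
  rw [hiddenSuccess_eq_exp_mul, ← h]
  simp
  ring

section

variable {P : Params}

/-! ### The length of a full withhold region -/

lemma one_lt_ratio (hH : 0 < P.H) (hμ : 0 < P.μ) (hp₂ : 0 < P.p₂)
    (hA2 : P.p₂ * P.μ < P.p₁ * P.H) : 1 < ratio P := by
  rw [ratio, one_lt_div (by linarith)]
  nlinarith [mul_pos hp₂ hμ, mul_pos hH hp₂]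

lemma withholdLength_pos (hH : 0 < P.H) (hμ : 0 < P.μ) (hp₂ : 0 < P.p₂)
    (hA2 : P.p₂ * P.μ < P.p₁ * P.H) : 0 < withholdLength P :=
  div_pos (Real.log_pos (one_lt_ratio hH hμ hp₂ hA2)) (by linarith)

lemma ratio_rpow (hH : 0 < P.H) (hμ : 0 < P.μ) (hp₂ : 0 < P.p₂)
    (hA2 : P.p₂ * P.μ < P.p₁ * P.H) (s : ℝ) :
    ratio P ^ (s / (P.H + P.μ)) = Real.exp (s * withholdLength P) := by
  have h1 : 0 < ratio P := zero_lt_one.trans (one_lt_ratio hH hμ hp₂ hA2)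
  rw [Real.rpow_def_of_pos h1, withholdLength]
  congr 1
  ring

/-- At the start of a full withhold region, the firm is indifferent between disclosing at
once and keeping the solution until the rival exits. -/
lemma waitValue_withholdLength (hH : 0 < P.H) (hμ : 0 < P.μ) (hp₁ : 0 < P.p₁) (hp₂ : 0 < P.p₂)
    (hA2 : P.p₂ * P.μ < P.p₁ * P.H) :
    waitValue P (withholdLength P) = P.p₁ + P.p₂ / 2 := by
  have h0 : P.H + P.μ ≠ 0 := by positivity
  have h1 := ratio_rpow hH hμ hp₂ hA2 (-(P.H + P.μ))
  rw [neg_div, div_self h0, Real.rpow_neg_one] at h1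
  have h2 : P.p₁ * P.H - P.p₂ * P.μ ≠ 0 := by
    have : 0 < P.p₁ * P.H - P.p₂ * P.μ := by linarith
    exact this.ne'
  have h3 : P.p₁ + P.p₂ ≠ 0 := by positivity
  rw [waitValue, ← h1, ratio, inv_div]
  field_simp
  ring

lemma waitValue_strictAnti (hH : 0 < P.H) (hμ : 0 < P.μ) (hp₁ : 0 < P.p₁) (hp₂ : 0 < P.p₂) :
    StrictAnti (waitValue P) := by
  intro u v huv
  have h0 : 0 < P.H + P.μ := by positivity
  have h1 : Real.exp (-(P.H + P.μ) * v) < Real.exp (-(P.H + P.μ) * u) :=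
    Real.exp_lt_exp.2 (by nlinarith)
  have h2 : 0 < (P.p₁ + P.p₂) / 2 * (P.H / (P.H + P.μ)) := by positivity
  unfold waitValue
  nlinarith

/-- While the rival works on stage 1, delaying a disclosure is costly. -/
lemma discloseValue_strictAnti (hH : 0 < P.H) (hμ : 0 < P.μ)
    (hA2 : P.p₂ * P.μ < P.p₁ * P.H) :
    StrictAnti fun v => waitValue P v - P.p₂ / 2 * Real.exp (-(P.H + P.μ) * v) := by
  intro u v huv
  have h0 : 0 < P.H + P.μ := by positivity
  have h1 : Real.exp (-(P.H + P.μ) * v) < Real.exp (-(P.H + P.μ) * u) :=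
    Real.exp_lt_exp.2 (by nlinarith)
  have h2 : ∀ w, waitValue P w - P.p₂ / 2 * Real.exp (-(P.H + P.μ) * w) =
      P.p₁ + P.p₂ - (P.p₁ + P.p₂) / 2 * (P.H / (P.H + P.μ)) +
      (P.p₁ * P.H - P.p₂ * P.μ) / (2 * (P.H + P.μ)) * Real.exp (-(P.H + P.μ) * w) := by
    intro w
    unfold waitValue
    field_simp
    ring
  have h3 : 0 < (P.p₁ * P.H - P.p₂ * P.μ) / (2 * (P.H + P.μ)) :=
    div_pos (by linarith) (by positivity)
  simp only [h2]
  nlinarith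

/-- The third assumption, multiplied by `c` and rewritten in terms of the length `Δ` of a full
withhold region: the powers of the ratio are `exp (± H Δ)` and `exp (-μ Δ)`. -/
lemma cost_exp_le_exitGain_withholdLength (hH : 0 < P.H) (hμ : 0 < P.μ) (hp₂ : 0 < P.p₂)
    (hc : 0 < P.c) (hA2 : P.p₂ * P.μ < P.p₁ * P.H) (hA3 : A3 P) :
    P.c * Real.exp (P.H * withholdLength P) ≤ exitGain P (withholdLength P) := by
  set D := withholdLength P with hD
  have h0 : P.H + P.μ ≠ 0 := by positivity
  have e1 := ratio_rpow hH hμ hp₂ hA2 P.H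
  have e2 := ratio_rpow hH hμ hp₂ hA2 (-P.H)
  have e3 := ratio_rpow hH hμ hp₂ hA2 (-P.μ)
  rw [← hD] at e1 e2 e3
  rw [neg_div] at e2 e3
  by_cases h : P.H = P.μ
  · have h5 := hA3.2 h
    have h6 : P.H / (P.H + P.μ) = 1 / 2 := by
      rw [← h]
      field_simp
      norm_num
    have h7 : Real.log (ratio P) = 2 * (P.H * D) := by
      rw [hD, withholdLength, ← h]
      field_simp
      norm_num
    rw [h6] at e1 e2
    rw [e1, e2, h7] at h5
    rw [exitGain, hiddenSuccess_of_eq h]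
    have h8 := mul_le_mul_of_nonneg_left h5 hc.le
    rw [mul_sub, mul_div_cancel₀ _ hc.ne'] at h8
    nlinarith [h8]
  · have h5 := hA3.1 h
    rw [e1, e2, e3] at h5
    rw [exitGain, hiddenSuccess_of_ne h]
    have h8 := mul_le_mul_of_nonneg_left h5 hc.le
    rw [mul_sub, mul_add, mul_div_cancel₀ _ hc.ne'] at h8
    have h9 : P.H - P.μ ≠ 0 := sub_ne_zero.2 h
    refine h8.trans (le_of_eq ?_)
    field_simp
    ring

lemma hasDerivAt_exp_mul (a u : ℝ) :
    HasDerivAt (fun u : ℝ => Real.exp (a * u)) (a * Real.exp (a * u)) u := by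
  have h := ((hasDerivAt_id u).const_mul a).exp
  simpa [mul_comm] using h

lemma antitoneOn_sub_exp {f f' : ℝ → ℝ} {s : Set ℝ} (hs : Convex ℝ s) (H C : ℝ)
    (hf : ∀ u, HasDerivAt f (f' u) u) (h : ∀ u ∈ s, f' u ≤ C * (H * Real.exp (H * u))) :
    AntitoneOn (fun u => f u - C * Real.exp (H * u)) s := by
  have hd : ∀ u, HasDerivAt (fun u => f u - C * Real.exp (H * u))
      (f' u - C * (H * Real.exp (H * u))) u := fun u =>
    (hf u).sub ((hasDerivAt_exp_mul H u).const_mul C)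
  refine antitoneOn_of_deriv_nonpos hs (fun u _ => (hd u).continuousAt.continuousWithinAt)
    (fun u _ => (hd u).differentiableAt.differentiableWithinAt) fun u hu => ?_
  rw [(hd u).deriv]
  linarith [h u (interior_subset hu)]

/-! ### Monotonicity of the gain from staying -/

/-- The coefficient of `hiddenSuccess` in the gain from staying may be negative, but then it is at
least `-c / 2`; this bounds the rate at which the gain can rise as hidden solutions leak out. -/
lemma hidden_loss_le (hH : 0 < P.H) (hμ : 0 < P.μ) (hc : 0 < P.c)
    (hpc : P.c ≤ P.H * (P.p₁ + P.p₂)) {u : ℝ} (hu : 0 ≤ u) :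
    -(P.H * ((P.p₁ + P.p₂) / 2) - P.c) * (P.μ * hiddenSuccess P u) ≤ P.c / 2 * P.H := by
  have h1 : 0 ≤ P.μ * hiddenSuccess P u := mul_nonneg hμ.le (hiddenSuccess_nonneg hH hu)
  have h2 := mul_hiddenSuccess_le hH hμ hu
  calc -(P.H * ((P.p₁ + P.p₂) / 2) - P.c) * (P.μ * hiddenSuccess P u)
      ≤ P.c / 2 * (P.μ * hiddenSuccess P u) := mul_le_mul_of_nonneg_right (by linarith) h1
    _ ≤ P.c / 2 * P.H := mul_le_mul_of_nonneg_left h2 (by positivity)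

lemma half_cost_le_exp (hH : 0 < P.H) (hc : 0 < P.c) {u : ℝ} (hu : 0 ≤ u) :
    P.c / 2 * P.H ≤ P.c / 2 * (P.H * Real.exp (P.H * u)) := by
  have h : 1 ≤ Real.exp (P.H * u) := Real.one_le_exp (by positivity)
  have h' : P.H ≤ P.H * Real.exp (P.H * u) := le_mul_of_one_le_right hH.le h
  exact mul_le_mul_of_nonneg_left h' (by positivity)

/-- The term with `c / 2` outweighs any increase of `exitGain`. -/
lemma antitoneOn_exitGain_sub_exp (hH : 0 < P.H) (hμ : 0 < P.μ) (hc : 0 < P.c)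
    (hpc : P.c ≤ P.H * (P.p₁ + P.p₂)) :
    AntitoneOn (fun u => exitGain P u - P.c / 2 * Real.exp (P.H * u)) (Set.Ici 0) := by
  refine antitoneOn_sub_exp (convex_Ici 0) P.H (P.c / 2) (f' := fun u =>
    (P.H * (P.p₁ + P.p₂) - P.c) * (-P.H * Real.exp (-P.H * u)) +
    (P.H * ((P.p₁ + P.p₂) / 2) - P.c) * (P.H * Real.exp (-P.H * u) - P.μ * hiddenSuccess P u))
    (fun u => ((hasDerivAt_exp_mul (-P.H) u).const_mul _).add
      ((hasDerivAt_hiddenSuccess P u).const_mul _)) fun u hu => ?_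
  have h1 := hidden_loss_le hH hμ hc hpc hu
  have h2 := half_cost_le_exp hH hc hu
  have h3 : 0 ≤ P.H * (P.p₁ + P.p₂) * (P.H * Real.exp (-P.H * u)) :=
    mul_nonneg (by linarith) (by positivity)
  linarith

lemma hasDerivAt_waitValue (P : Params) (v : ℝ) (h0 : P.H + P.μ ≠ 0) : HasDerivAt (waitValue P)
    (-((P.p₁ + P.p₂) / 2 * P.H * Real.exp (-(P.H + P.μ) * v))) v := by
  have h := (((hasDerivAt_exp_mul (-(P.H + P.μ)) v).const_sub 1).const_mul
    ((P.p₁ + P.p₂) / 2 * (P.H / (P.H + P.μ)))).const_sub (P.p₁ + P.p₂)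
  unfold waitValue
  convert! h using 1
  field_simp

lemma hasDerivAt_stayGain (hH : 0 < P.H) (hμ : 0 < P.μ) (U u : ℝ) :
    HasDerivAt (stayGain P U) (-(P.μ * (P.H * (P.p₁ + P.p₂ - waitValue P (U - u)) *
      Real.exp (-P.H * u) + (P.H * ((P.p₁ + P.p₂) / 2) - P.c) * hiddenSuccess P u))) u := by
  have h0 : P.H + P.μ ≠ 0 := by positivity
  have h1 : HasDerivAt (fun u => waitValue P (U - u))
      ((P.p₁ + P.p₂) / 2 * P.H * Real.exp (-(P.H + P.μ) * (U - u))) u := by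
    have h := (hasDerivAt_waitValue P (U - u) h0).comp u ((hasDerivAt_id u).const_sub U)
    convert! h using 1
    ring
  have h2 := (((h1.const_mul P.H).sub_const P.c).mul (hasDerivAt_exp_mul (-P.H) u)).add
    ((hasDerivAt_hiddenSuccess P u).const_mul (P.H * ((P.p₁ + P.p₂) / 2) - P.c))
  convert! h2 using 1
  rw [waitValue]
  field_simp
  ring

lemma antitoneOn_stayGain_sub_exp (hH : 0 < P.H) (hμ : 0 < P.μ) (hc : 0 < P.c)
    (hp : 0 < P.p₁ + P.p₂) (hpc : P.c ≤ P.H * (P.p₁ + P.p₂)) (U : ℝ) :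
    AntitoneOn (fun u => stayGain P U u - P.c / 2 * Real.exp (P.H * u)) (Set.Icc 0 U) := by
  refine antitoneOn_sub_exp (convex_Icc 0 U) P.H (P.c / 2)
    (fun u => hasDerivAt_stayGain hH hμ U u) fun u hu => ?_
  have h1 := hidden_loss_le hH hμ hc hpc hu.1
  have h2 := half_cost_le_exp hH hc hu.1
  have h3 : 0 ≤ P.p₁ + P.p₂ - waitValue P (U - u) := by
    have h4 : Real.exp (-(P.H + P.μ) * (U - u)) ≤ 1 :=
      Real.exp_le_one_iff.2 (by nlinarith [hu.2, add_pos hH hμ])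
    have h5 : 0 < (P.p₁ + P.p₂) / 2 * (P.H / (P.H + P.μ)) := by positivity
    unfold waitValue
    nlinarith
  have h4 : 0 ≤ P.μ * (P.H * (P.p₁ + P.p₂ - waitValue P (U - u)) * Real.exp (-P.H * u)) := by
    positivity
  linarith

/-- During a withhold region of length `U`, the gain from staying is at least that at the moment of
the exit. -/
lemma exitGain_le_stayGain (hH : 0 < P.H) (hμ : 0 < P.μ) (hc : 0 < P.c) (hp : 0 < P.p₁ + P.p₂)
    (hpc : P.c ≤ P.H * (P.p₁ + P.p₂)) {U u : ℝ} (hu : 0 ≤ u) (huU : u ≤ U)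
    (hU : P.c / 2 * Real.exp (P.H * U) ≤ exitGain P U) :
    Real.exp (-P.H * U) * exitGain P U ≤ Real.exp (-P.H * u) * stayGain P U u := by
  have h1 := antitoneOn_stayGain_sub_exp hH hμ hc hp hpc U ⟨hu, huU⟩ ⟨hu.trans huU, le_rfl⟩ huU
  dsimp only at h1
  rw [stayGain_self] at h1
  have e : ∀ v, Real.exp (-P.H * v) * Real.exp (P.H * v) = 1 := by
    intro v
    rw [← Real.exp_add]; simp
  have h2 : Real.exp (-P.H * U) ≤ Real.exp (-P.H * u) := Real.exp_le_exp.2 (by nlinarith)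
  have h3 : Real.exp (-P.H * U) * (exitGain P U - P.c / 2 * Real.exp (P.H * U)) ≤
      Real.exp (-P.H * u) * (stayGain P U u - P.c / 2 * Real.exp (P.H * u)) :=
    mul_le_mul h2 h1 (by linarith) (Real.exp_pos _).le
  have h4 : ∀ v, Real.exp (-P.H * v) * (P.c / 2 * Real.exp (P.H * v)) = P.c / 2 := by
    intro v
    rw [mul_left_comm, e, mul_one]
  rw [mul_sub, mul_sub, h4, h4] at h3
  linarith

/-- After the exit time, the gain from staying is at most that at the exit time. -/
lemma stay_after_exit_le_exitGain (hH : 0 < P.H) (hμ : 0 < P.μ) (hc : 0 < P.c)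
    (hpc : P.c ≤ P.H * (P.p₁ + P.p₂)) {U s : ℝ} (hU₀ : 0 ≤ U) (hs : 0 ≤ s)
    (hU : P.c / 2 ≤ exitGain P U) :
    Real.exp (-P.H * s) * ((P.H * (P.p₁ + P.p₂) - P.c) * Real.exp (-P.H * U) +
      (P.H * ((P.p₁ + P.p₂) / 2) - P.c) * (Real.exp (-P.μ * s) * hiddenSuccess P U)) ≤
      exitGain P U := by
  have h1 := hidden_loss_le hH hμ hc hpc hU₀
  set B := (P.H * ((P.p₁ + P.p₂) / 2) - P.c) * hiddenSuccess P U with hB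
  have h2 : -B * (1 - Real.exp (-P.μ * s)) ≤ P.c / 2 * (P.H * s) := by
    have e1 : 1 - Real.exp (-P.μ * s) ≤ P.μ * s := by
      have := Real.add_one_le_exp (-P.μ * s)
      linarith
    have e2 : 0 ≤ 1 - Real.exp (-P.μ * s) := by
      have := Real.exp_le_one_iff.2 (by nlinarith : -P.μ * s ≤ 0)
      linarith
    rcases le_total 0 B with h | h
    · have : -B * (1 - Real.exp (-P.μ * s)) ≤ 0 := by nlinarith
      have : 0 ≤ P.c / 2 * (P.H * s) := by positivity
      linarith
    · calc -B * (1 - Real.exp (-P.μ * s)) ≤ -B * (P.μ * s) :=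
            mul_le_mul_of_nonneg_left e1 (by linarith)
        _ = -(P.H * ((P.p₁ + P.p₂) / 2) - P.c) * (P.μ * hiddenSuccess P U) * s := by
            rw [hB]; ring
        _ ≤ P.c / 2 * P.H * s := mul_le_mul_of_nonneg_right h1 hs
        _ = P.c / 2 * (P.H * s) := by ring
  have h3 : P.H * s + 1 ≤ Real.exp (P.H * s) := Real.add_one_le_exp _
  have h4 : P.c / 2 * (P.H * s) ≤ exitGain P U * (Real.exp (P.H * s) - 1) :=
    mul_le_mul hU (by linarith) (by positivity) (by linarith)
  have h5 : (P.H * (P.p₁ + P.p₂) - P.c) * Real.exp (-P.H * U) +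
      (P.H * ((P.p₁ + P.p₂) / 2) - P.c) * (Real.exp (-P.μ * s) * hiddenSuccess P U) =
      exitGain P U + -B * (1 - Real.exp (-P.μ * s)) := by
    rw [exitGain, hB]; ring
  have e : Real.exp (-P.H * s) * Real.exp (P.H * s) = 1 := by
    rw [← Real.exp_add]; simp
  rw [h5]
  calc Real.exp (-P.H * s) * (exitGain P U + -B * (1 - Real.exp (-P.μ * s)))
      ≤ Real.exp (-P.H * s) * (exitGain P U * Real.exp (P.H * s)) :=
        mul_le_mul_of_nonneg_left (by linarith) (Real.exp_pos _).le
    _ = exitGain P U := by rw [mul_left_comm, e, mul_one]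

/-! ### The exit-indifference condition -/

/-- The exit-indifference condition, multiplied by the denominator of the belief. -/
lemma exitIndifference_iff (hα₀ : 0 < P.α) (hα₁ : P.α < 1) (hH : 0 < P.H) {t₁ t : ℝ}
    (ht : t₁ ≤ t) :
    ExitIndifference P t₁ t ↔ P.α * (Real.exp (-2 * P.H * t₁) * (Real.exp (-P.H * (t - t₁)) *
      exitGain P (t - t₁))) = P.c * (1 - P.α) := by
  have h1 := hiddenSuccess_nonneg hH (sub_nonneg.2 ht)
  set e := Real.exp (-P.H * (t - t₁)) with he
  set I := hiddenSuccess P (t - t₁) with hI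
  have he0 : 0 < e := Real.exp_pos _
  have h2 : Real.exp (-2 * P.H * t₁ - P.H * (t - t₁)) = Real.exp (-2 * P.H * t₁) * e := by
    rw [he, ← Real.exp_add]; congr 1; ring
  set w := Real.exp (-2 * P.H * t₁) * e with hw
  have hw0 : 0 < w := by positivity
  have h3 : e + I ≠ 0 := by positivity
  have h4 : P.α * w * (e + I) + 1 - P.α ≠ 0 := by
    have : 0 < P.α * w * (e + I) := by positivity
    have : 0 < P.α * w * (e + I) + 1 - P.α := by linarith
    exact this.ne'
  unfold ExitIndifference belief
  rw [exitGain, ← he, ← hI, h2]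
  rw [← mul_assoc (Real.exp (-2 * P.H * t₁)), ← hw]
  have h5 : P.α * w * (e + I) / (P.α * w * (e + I) + 1 - P.α) * P.H *
      (((P.p₁ + P.p₂) * e + (P.p₁ + P.p₂) / 2 * I) / (e + I)) =
      P.α * w * P.H * ((P.p₁ + P.p₂) * e + (P.p₁ + P.p₂) / 2 * I) /
        (P.α * w * (e + I) + 1 - P.α) := by
    field_simp
  rw [h5, eq_div_iff h4]
  constructor <;> intro h <;> linarith

lemma exitGain_zero (P : Params) : exitGain P 0 = P.H * (P.p₁ + P.p₂) - P.c := by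
  simp [exitGain, hiddenSuccess_zero]

lemma continuous_exitGain (P : Params) : Continuous (exitGain P) := by
  unfold exitGain
  have := continuous_hiddenSuccess P
  fun_prop

/-- In this form, `exp (-H u) * exitGain P u` is a constant plus a product of two antitone factors,
the second of which is positive by the third assumption. -/
lemma exp_mul_exitGain_eq (P : Params) (u : ℝ) : Real.exp (-P.H * u) * exitGain P u =
    P.c / 2 + Real.exp (-P.H * u) * (exitGain P u - P.c / 2 * Real.exp (P.H * u)) := by
  have e : Real.exp (-P.H * u) * Real.exp (P.H * u) = 1 := by
    rw [← Real.exp_add]; simp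
  linear_combination (P.c / 2) * e

lemma le_exitGain_sub_exp (hH : 0 < P.H) (hμ : 0 < P.μ) (hc : 0 < P.c)
    (hpc : P.c ≤ P.H * (P.p₁ + P.p₂))
    (hD : P.c * Real.exp (P.H * withholdLength P) ≤ exitGain P (withholdLength P))
    {u : ℝ} (hu : 0 ≤ u) (huD : u ≤ withholdLength P) :
    P.c / 2 * Real.exp (P.H * withholdLength P) ≤ exitGain P u - P.c / 2 * Real.exp (P.H * u) := by
  have h := antitoneOn_exitGain_sub_exp hH hμ hc hpc hu (hu.trans huD) huD
  dsimp only at h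
  linarith

lemma exp_mul_exitGain_strictAnti (hH : 0 < P.H) (hμ : 0 < P.μ) (hc : 0 < P.c)
    (hpc : P.c ≤ P.H * (P.p₁ + P.p₂))
    (hD : P.c * Real.exp (P.H * withholdLength P) ≤ exitGain P (withholdLength P)) :
    StrictAntiOn (fun u => Real.exp (-P.H * u) * exitGain P u) (Set.Icc 0 (withholdLength P)) := by
  intro u hu v hv huv
  have h1 := antitoneOn_exitGain_sub_exp hH hμ hc hpc hu.1 hv.1 huv.le
  have h2 := le_exitGain_sub_exp hH hμ hc hpc hD hu.1 hu.2
  have h3 : 0 < P.c / 2 * Real.exp (P.H * withholdLength P) := by positivity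
  have h4 : Real.exp (-P.H * v) < Real.exp (-P.H * u) := Real.exp_lt_exp.2 (by nlinarith)
  dsimp only at h1 ⊢
  rw [exp_mul_exitGain_eq P u, exp_mul_exitGain_eq P v]
  have h5 := mul_le_mul_of_nonneg_left h1 (Real.exp_pos (-P.H * v)).le
  have h6 := mul_lt_mul_of_pos_right h4 (h3.trans_le h2)
  linarith

lemma cost_le_exp_mul_exitGain (hH : 0 < P.H) (hμ : 0 < P.μ) (hc : 0 < P.c)
    (hpc : P.c ≤ P.H * (P.p₁ + P.p₂))
    (hD : P.c * Real.exp (P.H * withholdLength P) ≤ exitGain P (withholdLength P))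
    {u : ℝ} (hu : 0 ≤ u) (huD : u ≤ withholdLength P) :
    P.c ≤ Real.exp (-P.H * u) * exitGain P u := by
  have h2 := le_exitGain_sub_exp hH hμ hc hpc hD hu huD
  have h4 : Real.exp (P.H * u) ≤ Real.exp (P.H * withholdLength P) :=
    Real.exp_le_exp.2 (by nlinarith)
  have e : Real.exp (-P.H * u) * Real.exp (P.H * u) = 1 := by
    rw [← Real.exp_add]; simp
  have h5 : P.c / 2 * Real.exp (P.H * u) ≤ exitGain P u - P.c / 2 * Real.exp (P.H * u) := by
    nlinarith
  have h6 := mul_le_mul_of_nonneg_left h5 (Real.exp_pos (-P.H * u)).le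
  rw [exp_mul_exitGain_eq P u]
  linarith [show Real.exp (-P.H * u) * (P.c / 2 * Real.exp (P.H * u)) = P.c / 2 by
    linear_combination (P.c / 2) * e]

/-- The net gain per unit of time from staying at the exit time `t`, on the event that stage 1 is
solvable, when the withhold region before `t` has its equilibrium length. It is `exitGain` weighted
with the probability that the firm itself is still in stage 1 at `t` and that its rival was
still in stage 1 when the withhold region began. -/
noncomputable def threshold (P : Params) (t : ℝ) : ℝ :=
  Real.exp (-2 * P.H * max 0 (t - withholdLength P)) *
    (Real.exp (-P.H * min t (withholdLength P)) * exitGain P (min t (withholdLength P)))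

lemma sub_max_eq_min (t D : ℝ) : t - max 0 (t - D) = min t D := by
  rcases le_total t D with h | h
  · rw [max_eq_left (by linarith), min_eq_left h, sub_zero]
  · rw [max_eq_right (by linarith), min_eq_right h, sub_sub_cancel]

lemma threshold_eq (P : Params) (t : ℝ) : threshold P t =
    Real.exp (-2 * P.H * max 0 (t - withholdLength P)) *
      (Real.exp (-P.H * (t - max 0 (t - withholdLength P))) *
        exitGain P (t - max 0 (t - withholdLength P))) := by
  rw [threshold, sub_max_eq_min]

/-- Postponing the exit lengthens the withhold region as long as it is not full, and the disclosure
region afterwards. In both cases the gain from staying falls. -/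
lemma threshold_strictAnti (hH : 0 < P.H) (hμ : 0 < P.μ) (hc : 0 < P.c)
    (hpc : P.c ≤ P.H * (P.p₁ + P.p₂)) (hD₀ : 0 < withholdLength P)
    (hD : P.c * Real.exp (P.H * withholdLength P) ≤ exitGain P (withholdLength P)) :
    StrictAntiOn (threshold P) (Set.Ici 0) := by
  intro s hs t ht hst
  have hs0 : 0 ≤ min s (withholdLength P) := le_min hs hD₀.le
  have ht0 : 0 ≤ min t (withholdLength P) := le_min ht hD₀.le
  have h1 := (exp_mul_exitGain_strictAnti hH hμ hc hpc hD).antitoneOn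
    ⟨hs0, min_le_right _ _⟩ ⟨ht0, min_le_right _ _⟩ (min_le_min_right _ hst.le)
  have h2 := cost_le_exp_mul_exitGain hH hμ hc hpc hD ht0 (min_le_right _ _)
  unfold threshold
  rcases lt_or_ge s (withholdLength P) with h | h
  · have h3 := exp_mul_exitGain_strictAnti hH hμ hc hpc hD
      ⟨hs0, min_le_right _ _⟩ ⟨ht0, min_le_right _ _⟩
      (lt_min (by rwa [min_eq_left h.le]) (by rwa [min_eq_left h.le]))
    have h4 : Real.exp (-2 * P.H * max 0 (t - withholdLength P)) ≤
        Real.exp (-2 * P.H * max 0 (s - withholdLength P)) := by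
      refine Real.exp_le_exp.2 ?_
      have : max 0 (s - withholdLength P) ≤ max 0 (t - withholdLength P) :=
        max_le_max_left _ (by linarith)
      nlinarith
    dsimp only at h3
    exact mul_lt_mul' h4 h3 (by linarith) (Real.exp_pos _)
  · have h4 : Real.exp (-2 * P.H * max 0 (t - withholdLength P)) <
        Real.exp (-2 * P.H * max 0 (s - withholdLength P)) := by
      refine Real.exp_lt_exp.2 ?_
      rw [max_eq_right (by linarith), max_eq_right (by linarith)]
      nlinarith
    exact mul_lt_mul h4 h1 (by linarith) (Real.exp_pos _).le

lemma continuous_threshold (P : Params) : Continuous (threshold P) := by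
  unfold threshold
  have h := continuous_exitGain P
  have h' : Continuous fun t => exitGain P (min t (withholdLength P)) := h.comp (by fun_prop)
  fun_prop

lemma exists_threshold_eq (hH : 0 < P.H) (hD₀ : 0 < withholdLength P) {K : ℝ}
    (hK₀ : 0 < K) (hK : K < P.H * (P.p₁ + P.p₂) - P.c) :
    ∃ T : ℝ, 0 < T ∧ threshold P T = K := by
  have h0 : threshold P 0 = P.H * (P.p₁ + P.p₂) - P.c := by
    rw [threshold, min_eq_left hD₀.le, max_eq_left (by linarith), exitGain_zero]
    simp
  have h1 : Filter.Tendsto (threshold P) Filter.atTop (nhds 0) := by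
    have h2 : Filter.Tendsto (fun t : ℝ => Real.exp (-2 * P.H * (t - withholdLength P)) *
        (Real.exp (-P.H * withholdLength P) * exitGain P (withholdLength P)))
        Filter.atTop (nhds (0 * (Real.exp (-P.H * withholdLength P) *
          exitGain P (withholdLength P)))) := by
      refine Filter.Tendsto.mul_const _ ?_
      refine Real.tendsto_exp_atBot.comp ?_
      exact (Filter.tendsto_atTop_add_const_right _ _ Filter.tendsto_id).const_mul_atTop_of_neg
        (by linarith)
    rw [zero_mul] at h2
    refine h2.congr' ?_
    filter_upwards [Filter.eventually_ge_atTop (withholdLength P)] with t ht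
    rw [threshold, min_eq_right ht, max_eq_right (by linarith)]
  obtain ⟨b, hb, hb0⟩ := ((h1.eventually (gt_mem_nhds hK₀)).and
    (Filter.eventually_ge_atTop 0)).exists
  obtain ⟨T, hT, hTK⟩ := intermediate_value_Icc' hb0 (continuous_threshold P).continuousOn
    (⟨hb.le, by rw [h0]; exact hK.le⟩ : K ∈ Set.Icc (threshold P b) (threshold P 0))
  refine ⟨T, hT.1.lt_of_ne ?_, hTK⟩
  rintro rfl
  rw [h0] at hTK
  linarith

end

/-! ### The optimal disclosure time -/

section

variable {P : Params}

lemma solvedGain_now (hH : 0 < P.H) (hμ : 0 < P.μ) {σ : Strategy} {T x : ℝ}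
    (hT : σ.next Action.exit 0 = (T : EReal)) (hx : 0 ≤ x) (hxT : x < T) :
    solvedGain P σ x x = (P.p₁ + P.p₂) / 2 * rivalHidden P σ x +
      Real.exp (-P.H * x) * (P.p₁ + P.p₂ / 2) := by
  rw [solvedGain_of_disclose hH hμ hT hx le_rfl hxT, sub_self, waitValue_zero,
    mul_zero (-(P.H + P.μ)), Real.exp_zero]
  ring

lemma solvedGain_lt_now (hH : 0 < P.H) (hμ : 0 < P.μ)
    (hA2 : P.p₂ * P.μ < P.p₁ * P.H) {σ : Strategy} {T x : ℝ} {δ : EReal}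
    (hT : σ.next Action.exit 0 = (T : EReal)) (hx : 0 ≤ x) (hδ : (x : EReal) < δ)
    (hδT : δ < (T : EReal)) : solvedGain P σ x δ < solvedGain P σ x x := by
  lift δ to ℝ using ⟨(hδT.trans (EReal.coe_lt_top T)).ne, ((EReal.bot_lt_coe x).trans hδ).ne'⟩
  rw [EReal.coe_lt_coe_iff] at hδ hδT
  rw [solvedGain_of_disclose hH hμ hT hx hδ.le hδT,
    solvedGain_of_disclose hH hμ hT hx le_rfl (hδ.trans hδT)]
  have h := discloseValue_strictAnti hH hμ hA2 (by linarith : x - x < δ - x)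
  dsimp only at h
  have := mul_lt_mul_of_pos_left h (Real.exp_pos (-P.H * x))
  linarith

lemma solvedGain_le_now (hH : 0 < P.H) (hμ : 0 < P.μ)
    (hA2 : P.p₂ * P.μ < P.p₁ * P.H) {σ : Strategy} {T x : ℝ} {δ : EReal}
    (hT : σ.next Action.exit 0 = (T : EReal)) (hx : 0 ≤ x) (hδ : (x : EReal) ≤ δ)
    (hδT : δ < (T : EReal)) : solvedGain P σ x δ ≤ solvedGain P σ x x := by
  rcases hδ.eq_or_lt with h | h
  · rw [h]
  · exact (solvedGain_lt_now hH hμ hA2 hT hx h hδT).le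

/-- Disclosing at once beats keeping the solution until the rival's exit exactly if the latter is
further away than the length of a full withhold region. -/
lemma solvedGain_wait_lt_now_iff (hH : 0 < P.H) (hμ : 0 < P.μ) (hp₁ : 0 < P.p₁) (hp₂ : 0 < P.p₂)
    (hA2 : P.p₂ * P.μ < P.p₁ * P.H) {σ : Strategy} {T x : ℝ} {δ : EReal}
    (hT : σ.next Action.exit 0 = (T : EReal)) (hx : 0 ≤ x) (hxT : x < T) (hδ : (T : EReal) ≤ δ) :
    solvedGain P σ x δ < solvedGain P σ x x ↔ withholdLength P < T - x := by
  rw [solvedGain_of_wait hH hμ hT hx hxT hδ, solvedGain_now hH hμ hT hx hxT,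
    ← waitValue_withholdLength hH hμ hp₁ hp₂ hA2, add_lt_add_iff_left,
    mul_lt_mul_iff_right₀ (Real.exp_pos _), (waitValue_strictAnti hH hμ hp₁ hp₂).lt_iff_gt]

lemma solvedGain_now_lt_wait_iff (hH : 0 < P.H) (hμ : 0 < P.μ) (hp₁ : 0 < P.p₁) (hp₂ : 0 < P.p₂)
    (hA2 : P.p₂ * P.μ < P.p₁ * P.H) {σ : Strategy} {T x : ℝ} {δ : EReal}
    (hT : σ.next Action.exit 0 = (T : EReal)) (hx : 0 ≤ x) (hxT : x < T) (hδ : (T : EReal) ≤ δ) :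
    solvedGain P σ x x < solvedGain P σ x δ ↔ T - x < withholdLength P := by
  rw [solvedGain_of_wait hH hμ hT hx hxT hδ, solvedGain_now hH hμ hT hx hxT,
    ← waitValue_withholdLength hH hμ hp₁ hp₂ hA2, add_lt_add_iff_left,
    mul_lt_mul_iff_right₀ (Real.exp_pos _), (waitValue_strictAnti hH hμ hp₁ hp₂).lt_iff_gt]

/-! ### Existence -/

lemma next_exit_discloseWithholdExit {t₁ T : ℝ} (h : t₁ ≤ T) (t : ℝ) :
    (discloseWithholdExit t₁ T).next Action.exit t = ((max t T : ℝ) : EReal) := by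
  have hact : ∀ u, (discloseWithholdExit t₁ T).act u = Action.exit ↔ T ≤ u := by
    intro u
    simp only [discloseWithholdExit]
    split_ifs with h1 h2
    · simp
      linarith
    · simp
      linarith
    · simp [not_lt.1 h2]
  refine le_antisymm (Strategy.next_le _ ?_ ((hact _).2 (le_max_right _ _))) ?_
  · exact_mod_cast le_max_left t T
  · refine Strategy.le_next_of_forall _ fun u hu hu' => ?_
    rw [Ne, hact, not_le]
    have h1 : t ≤ u := by exact_mod_cast hu
    have h2 : u < max t T := by exact_mod_cast hu'
    rcases lt_max_iff.1 h2 with h3 | h3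
    · linarith
    · exact h3

lemma next_disclose_of_lt {t₁ T t : ℝ} (h : t < t₁) :
    (discloseWithholdExit t₁ T).next Action.disclose t = t :=
  Strategy.next_eq_self _ (by simp [discloseWithholdExit, h])

lemma next_disclose_of_le {t₁ T t : ℝ} (h : t₁ ≤ t) :
    (discloseWithholdExit t₁ T).next Action.disclose t = ⊤ := by
  refine top_unique (Strategy.le_next_of_forall _ fun u hu _ => ?_)
  have h1 : t₁ ≤ u := h.trans (by exact_mod_cast hu)
  simp only [discloseWithholdExit, if_neg (not_lt.2 h1)]
  split_ifs <;> simp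

/-- The plan of the disclose-withhold-exit strategy is optimal for a firm with a solution. -/
lemma solvedGain_le_of_discloseWithholdExit (hH : 0 < P.H) (hμ : 0 < P.μ) (hp₁ : 0 < P.p₁)
    (hp₂ : 0 < P.p₂) (hA2 : P.p₂ * P.μ < P.p₁ * P.H) {T x : ℝ} (hT₀ : 0 ≤ T) (hx : 0 ≤ x)
    {δ : EReal} (hδ : (x : EReal) ≤ δ) :
    solvedGain P (discloseWithholdExit (max 0 (T - withholdLength P)) T) x δ ≤
      solvedGain P (discloseWithholdExit (max 0 (T - withholdLength P)) T) x
        ((discloseWithholdExit (max 0 (T - withholdLength P)) T).next Action.disclose x) := by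
  have hD := withholdLength_pos hH hμ hp₂ hA2
  set t₁ := max 0 (T - withholdLength P) with ht₁
  have ht₁T : t₁ ≤ T := max_le hT₀ (by linarith)
  set σ := discloseWithholdExit t₁ T with hσ
  have hT : σ.next Action.exit 0 = (T : EReal) := by
    have := next_exit_discloseWithholdExit ht₁T 0
    rwa [max_eq_right hT₀, EReal.coe_zero] at this
  rcases le_or_gt T x with h | hxT
  · rw [solvedGain_of_exited hH hμ hT hT₀ h hδ,
      solvedGain_of_exited hH hμ hT hT₀ h (σ.le_next _ _)]
  rcases lt_or_ge x t₁ with hx₁ | hx₁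
  · rw [hσ, next_disclose_of_lt hx₁, ← hσ]
    rcases lt_or_ge δ (T : EReal) with h | h
    · exact solvedGain_le_now hH hμ hA2 hT hx hδ h
    · refine ((solvedGain_wait_lt_now_iff hH hμ hp₁ hp₂ hA2 hT hx hxT h).2 ?_).le
      rcases lt_max_iff.1 (ht₁ ▸ hx₁) with h1 | h1
      · linarith
      · linarith
  · rw [hσ, next_disclose_of_le hx₁, ← hσ]
    have h1 : T - x ≤ withholdLength P := by
      have := le_max_right 0 (T - withholdLength P)
      linarith
    have h2 := (solvedGain_wait_lt_now_iff hH hμ hp₁ hp₂ hA2 hT hx hxT le_top).not.2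
      (not_lt.2 h1)
    rcases lt_or_ge δ (T : EReal) with h | h
    · exact (solvedGain_le_now hH hμ hA2 hT hx hδ h).trans (not_lt.1 h2)
    · rw [solvedGain_of_wait hH hμ hT hx hxT h, solvedGain_of_wait hH hμ hT hx hxT le_top]

/-- The flow of a firm without a solution is nonnegative before `T` and nonpositive after it, so
that leaving at `T`, or at once if `T` has passed, is optimal. -/
lemma isEquilibrium_discloseWithholdExit (hα₀ : 0 < P.α) (hα₁ : P.α < 1) (hH : 0 < P.H)
    (hμ : 0 < P.μ) (hp₁ : 0 < P.p₁) (hp₂ : 0 < P.p₂) (hc : 0 < P.c)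
    (hpc : P.c ≤ P.H * (P.p₁ + P.p₂)) (hA2 : P.p₂ * P.μ < P.p₁ * P.H)
    (hDc : P.c * Real.exp (P.H * withholdLength P) ≤ exitGain P (withholdLength P)) {T : ℝ}
    (hT₀ : 0 < T) (hthr : P.α * threshold P T = P.c * (1 - P.α)) :
    IsEquilibrium P (discloseWithholdExit (max 0 (T - withholdLength P)) T) := by
  have hD := withholdLength_pos hH hμ hp₂ hA2
  have hopt := fun x hx δ hδ => solvedGain_le_of_discloseWithholdExit hH hμ hp₁ hp₂ hA2 hT₀.le
    (x := x) hx (δ := δ) hδ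
  rw [threshold_eq] at hthr
  set t₁ := max 0 (T - withholdLength P) with ht₁
  have ht₁0 : 0 ≤ t₁ := le_max_left _ _
  have ht₁T : t₁ ≤ T := max_le hT₀.le (by linarith)
  set σ := discloseWithholdExit t₁ T with hσ
  have hT : σ.next Action.exit 0 = (T : EReal) := by
    have := next_exit_discloseWithholdExit ht₁T 0
    rwa [max_eq_right hT₀.le, EReal.coe_zero] at this
  have h₁ : ∀ x : ℝ, 0 ≤ x → x < t₁ → σ.next Action.disclose x = x := fun x _ h =>
    next_disclose_of_lt h
  have h₂ : ∀ b : EReal, ∀ x : ℝ, t₁ ≤ x → x < T → b ≤ σ.next Action.disclose x := by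
    intro b x hx _
    rw [hσ, next_disclose_of_le hx]
    exact le_top
  have hU₀ : 0 ≤ T - t₁ := by linarith
  have hUD : T - t₁ ≤ withholdLength P := by
    rw [ht₁, sub_max_eq_min]
    exact min_le_right _ _
  have hsub := le_exitGain_sub_exp hH hμ hc hpc hDc hU₀ hUD
  have hpos : 0 < P.c / 2 * Real.exp (P.H * withholdLength P) := by positivity
  have hcU : P.c / 2 ≤ exitGain P (T - t₁) := by
    have : P.c / 2 * 1 ≤ P.c / 2 * Real.exp (P.H * (T - t₁)) :=
      mul_le_mul_of_nonneg_left (Real.one_le_exp (by positivity)) (by positivity)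
    linarith
  -- after the exit time, staying does not pay
  have hneg : ∀ r, T ≤ r → flow P σ t₁ r ≤ 0 := by
    intro r hr
    rw [flow_of_exit hα₀ hα₁ hH hμ hT ht₁0 ht₁T hr h₁ (h₂ _)]
    have h3 := stay_after_exit_le_exitGain hH hμ hc hpc hU₀ (sub_nonneg.2 hr) hcU
    have h4 : Real.exp (-P.H * (r - t₁)) =
        Real.exp (-P.H * (T - t₁)) * Real.exp (-P.H * (r - T)) := by
      rw [← Real.exp_add]; congr 1; ring
    have h5 := mul_le_mul_of_nonneg_left h3 (mul_pos hα₀ (mul_pos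
      (Real.exp_pos (-2 * P.H * t₁)) (Real.exp_pos (-P.H * (T - t₁))))).le
    rw [h4]
    linarith
  have hstay : ∀ r, t₁ ≤ r → r ≤ T → P.c * (1 - P.α) ≤ P.α * (Real.exp (-2 * P.H * t₁) *
      (Real.exp (-P.H * (r - t₁)) * stayGain P (T - t₁) (r - t₁))) := by
    intro r hr hrT
    rw [← hthr]
    have h3 := exitGain_le_stayGain hH hμ hc (by linarith) hpc (sub_nonneg.2 hr)
      (by linarith : r - t₁ ≤ T - t₁) (by linarith)
    exact mul_le_mul_of_nonneg_left (mul_le_mul_of_nonneg_left h3 (Real.exp_pos _).le) hα₀.le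
  -- before the exit time, staying pays
  have hnonneg : ∀ r, 0 ≤ r → r ≤ T → 0 ≤ flow P σ t₁ r := by
    intro r hr hrT
    rcases lt_or_ge r t₁ with h | h
    · rw [flow_of_disclose hα₀ hα₁ hH hμ hT hr h ht₁T h₁]
      have h3 := hstay t₁ le_rfl ht₁T
      rw [sub_self, mul_zero, Real.exp_zero, one_mul] at h3
      have h4 : stayGain P (T - t₁) 0 ≤ P.H * (P.p₁ + P.p₂) - P.c := by
        have h5 := (waitValue_strictAnti hH hμ hp₁ hp₂).antitone hU₀
        rw [waitValue_zero] at h5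
        simp only [stayGain, sub_zero, mul_zero, Real.exp_zero, hiddenSuccess_zero]
        nlinarith
      have h5 : Real.exp (-2 * P.H * t₁) ≤ Real.exp (-2 * P.H * r) :=
        Real.exp_le_exp.2 (by nlinarith)
      have h6 : Real.exp (-2 * P.H * t₁) * stayGain P (T - t₁) 0 ≤
          Real.exp (-2 * P.H * r) * (P.H * (P.p₁ + P.p₂) - P.c) :=
        (mul_le_mul_of_nonneg_left h4 (Real.exp_pos _).le).trans
          (mul_le_mul_of_nonneg_right h5 (by linarith))
      have h7 := mul_le_mul_of_nonneg_left h6 hα₀.le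
      linarith
    · rcases hrT.eq_or_lt with rfl | hrT
      · rw [flow_of_exit hα₀ hα₁ hH hμ hT ht₁0 ht₁T le_rfl h₁ (h₂ _), sub_self, mul_zero,
          Real.exp_zero, one_mul, ← exitGain, hthr, sub_self]
      · rw [flow_of_withhold hα₀ hα₁ hH hμ hT ht₁0 h hrT h₁ (h₂ _)]
        linarith [hstay r h hrT.le]
  refine ⟨fun t ht τ d htτ hd hxd => ?_, fun s t hs hst d hd => ?_⟩
  · rcases eq_or_ne τ ⊤ with rfl | hτ
    · rw [unsolvedPayoff_top hα₀ hα₁ hH hμ hc]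
      exact bot_le
    lift τ to ℝ using ⟨hτ, ((EReal.bot_lt_coe t).trans_le htτ).ne'⟩
    rw [EReal.coe_le_coe_iff] at htτ
    have htm : t ≤ max t T := le_max_left _ _
    rw [hσ, next_exit_discloseWithholdExit ht₁T, ← hσ,
      unsolvedPayoff_le_iff hα₀ hα₁ hH hμ hc hT hT₀.le ht htτ htm hd hxd
        (σ.measurable_next _) (σ.le_next _)]
    refine (unsolvedGain_mono hα₀ hH hμ htτ hd (σ.measurable_next Action.disclose)
      fun x hx => hopt x (ht.trans hx) (d x) (hxd x)).trans ?_
    rw [integral_flow hα₀ hα₁ hH hμ hT ht htτ ht₁T h₁ (h₂ _),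
      integral_flow hα₀ hα₁ hH hμ hT ht htm ht₁T h₁ (h₂ _)]
    have hadd := intervalIntegral.integral_add_adjacent_intervals
      (intervalIntegrable_flow hα₀ hα₁ hH hμ σ t₁ t τ)
      (intervalIntegrable_flow hα₀ hα₁ hH hμ σ t₁ τ (max t T))
    have h3 : 0 ≤ ∫ r in τ..max t T, flow P σ t₁ r := by
      rcases le_total τ (max t T) with h | h
      · rcases le_total T t with h4 | h4
        · rw [max_eq_left h4] at h ⊢
          rw [le_antisymm h htτ, intervalIntegral.integral_same]
        · rw [max_eq_right h4] at h ⊢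
          exact intervalIntegral.integral_nonneg h fun r hr =>
            hnonneg r (ht.trans (htτ.trans hr.1)) hr.2
      · rw [intervalIntegral.integral_symm, ← intervalIntegral.integral_neg]
        refine intervalIntegral.integral_nonneg h fun r hr => neg_nonneg.2 (hneg r ?_)
        exact (le_max_right t T).trans hr.1
    linarith
  · have h := hopt t (hs.trans hst)
    rw [solvedPayoff_le_iff hH hμ hT hT₀.le hs hst hd (σ.le_next _ _)]
    exact h d hd

end

/-! ### Uniqueness -/

/-- A flow whose integral over every short interval to the left of `T` is nonnegative is nonnegative
at `T`. -/
lemma nonneg_of_integral_left_nonneg {f : ℝ → ℝ} {a T : ℝ} (haT : a < T) (hf : Continuous f)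
    (h : ∀ t, a ≤ t → t < T → 0 ≤ ∫ r in t..T, f r) : 0 ≤ f T := by
  by_contra hn
  obtain ⟨b, hb, hsub⟩ := (mem_nhdsLE_iff_exists_Ioc_subset).1
    (nhdsWithin_le_nhds (hf.continuousAt.eventually (gt_mem_nhds (not_le.1 hn))))
  have ht : max a b < T := max_lt haT hb
  have h1 := h (max a b) (le_max_left _ _) ht
  have h2 : 0 < ∫ r in max a b..T, -f r := by
    refine intervalIntegral.intervalIntegral_pos_of_pos_on
      (hf.neg.intervalIntegrable _ _) (fun r hr => ?_) ht
    exact neg_pos.2 (hsub ⟨(le_max_right a b).trans_lt hr.1, hr.2.le⟩)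
  rw [intervalIntegral.integral_neg] at h2
  linarith

/-- A flow whose integral over every short interval to the right of `T` is nonpositive is
nonpositive at `T`. -/
lemma nonpos_of_integral_right_nonpos {f : ℝ → ℝ} {T b : ℝ} (hTb : T < b) (hf : Continuous f)
    (h : ∀ t, T < t → t < b → ∫ r in T..t, f r ≤ 0) : f T ≤ 0 := by
  by_contra hn
  obtain ⟨a, ha, hsub⟩ := (mem_nhdsGE_iff_exists_Ico_subset).1
    (nhdsWithin_le_nhds (hf.continuousAt.eventually (lt_mem_nhds (not_le.1 hn))))
  obtain ⟨t, ht, ht'⟩ := exists_between (lt_min hTb ha)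
  have h1 := h t ht (ht'.trans_le (min_le_left _ _))
  have h2 : 0 < ∫ r in T..t, f r := by
    refine intervalIntegral.intervalIntegral_pos_of_pos_on
      (hf.intervalIntegrable _ _) (fun r hr => ?_) ht
    exact hsub ⟨hr.1.le, hr.2.trans (ht'.trans_le (min_le_right _ _))⟩
  linarith

variable {P : Params}

/-- In equilibrium, firms without a solution leave at some time. -/
lemma exists_exit_of_isEquilibrium (hα₀ : 0 < P.α) (hα₁ : P.α < 1) (hH : 0 < P.H) (hμ : 0 < P.μ)
    (hc : 0 < P.c) {σ : Strategy} (hσ : IsEquilibrium P σ) :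
    ∃ T : ℝ, 0 ≤ T ∧ σ.next Action.exit 0 = (T : EReal) := by
  have h0 : (0 : EReal) ≤ σ.next Action.exit 0 := σ.le_next _ _
  by_cases htop : σ.next Action.exit 0 = ⊤
  · exfalso
    have h := hσ.1 0 le_rfl 0 (σ.next Action.disclose) (by simp) (σ.measurable_next _)
      (σ.le_next _)
    rw [EReal.coe_zero, htop, unsolvedPayoff_top hα₀ hα₁ hH hμ hc, le_bot_iff] at h
    have hz : ∀ x a : EReal, 0 ≤ x → 0 ≤ a → stageOneTime 0 0 x a = 0 := by
      intro x a hx ha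
      rw [stageOneTime, min_eq_left ha, min_eq_right hx]
      simp
    have hl : ∫⁻ w, stageOneTime 0 0 w.1.1 (rivalAnnounce σ w.2)
        ∂(cond (prior P) (unsolvedInfo σ 0)) = 0 := by
      rw [ProbabilityTheory.cond, lintegral_smul_measure,
        setLIntegral_congr_fun (measurableSet_unsolvedInfo σ 0) (g := fun _ => 0)]
      · simp
      · intro w hw
        exact hz _ _ hw.1 hw.2
    rw [unsolvedPayoff, hl, mul_zero, EReal.coe_ennreal_zero, sub_zero] at h
    exact EReal.coe_ne_bot _ h
  · refine ⟨(σ.next Action.exit 0).toReal, EReal.toReal_nonneg h0, ?_⟩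
    exact (EReal.coe_toReal htop (lt_of_lt_of_le EReal.bot_lt_zero h0).ne').symm

/-- The optimality of disclosure determines an equilibrium strategy up to its exit time. -/
lemma act_eq_of_lt_exit (hH : 0 < P.H) (hμ : 0 < P.μ) (hp₁ : 0 < P.p₁) (hp₂ : 0 < P.p₂)
    (hA2 : P.p₂ * P.μ < P.p₁ * P.H) {σ : Strategy} (hσ : IsEquilibrium P σ) {T : ℝ} (hT₀ : 0 ≤ T)
    (hT : σ.next Action.exit 0 = (T : EReal)) :
    (∀ t, 0 ≤ t → t < max 0 (T - withholdLength P) → σ.act t = Action.disclose) ∧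
    (∀ t, max 0 (T - withholdLength P) ≤ t → t < T → σ.act t = Action.withhold) := by
  have hD := withholdLength_pos hH hμ hp₂ hA2
  have hopt : ∀ t : ℝ, 0 ≤ t → ∀ d : EReal, (t : EReal) ≤ d →
      solvedGain P σ t d ≤ solvedGain P σ t (σ.next Action.disclose t) := by
    intro t ht d hd
    exact (solvedPayoff_le_iff hH hμ hT hT₀ ht le_rfl hd (σ.le_next _ _)).1
      (hσ.2 t t ht le_rfl d hd)
  constructor
  · intro t ht htt
    have htD : t < T - withholdLength P := by
      rcases lt_max_iff.1 htt with h | h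
      · linarith
      · exact h
    have htT : t < T := by linarith
    refine σ.act_of_next_eq ht (s := (t : EReal)) (le_antisymm (le_of_not_gt fun hlt => ?_)
      (σ.le_next _ _))
    have h1 := hopt t ht t le_rfl
    rcases lt_or_ge (σ.next Action.disclose t) (T : EReal) with h | h
    · exact not_lt.2 h1 (solvedGain_lt_now hH hμ hA2 hT ht hlt h)
    · exact not_lt.2 h1 ((solvedGain_wait_lt_now_iff hH hμ hp₁ hp₂ hA2 hT ht htT h).2 (by linarith))
  · have key : ∀ t, 0 ≤ t → T - withholdLength P < t → t < T → σ.act t = Action.withhold := by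
      intro t ht htD htT
      have hne : σ.act t ≠ Action.exit := by
        refine σ.act_ne_of_lt_next (s := 0) (by exact_mod_cast ht) ?_
        rw [hT]
        exact_mod_cast htT
      have hne' : σ.act t ≠ Action.disclose := by
        intro h
        have h1 := hopt t ht ⊤ le_top
        rw [σ.next_eq_self h] at h1
        exact not_lt.2 h1
          ((solvedGain_now_lt_wait_iff hH hμ hp₁ hp₂ hA2 hT ht htT le_top).2 (by linarith))
      cases h : σ.act t with
      | disclose => exact absurd h hne'
      | withhold => rfl
      | exit => exact absurd h hne
    intro t ht htT
    have ht0 : 0 ≤ t := (le_max_left _ _).trans ht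
    have htD : T - withholdLength P ≤ t := (le_max_right _ _).trans ht
    -- the action at the cutoff itself is that of the region which starts there
    obtain ⟨ε, hε, hc⟩ := σ.exists_const_right ht0
    obtain ⟨u, hu, hu'⟩ := exists_between (lt_min htT (by linarith : t < t + ε))
    rw [← hc u hu.le (hu'.trans_le (min_le_right _ _))]
    exact key u (by linarith) (by linarith) (hu'.trans_le (min_le_left _ _))

/-- In equilibrium, the exit time satisfies the exit-indifference condition. -/
lemma threshold_of_isEquilibrium (hα₀ : 0 < P.α) (hα₁ : P.α < 1) (hH : 0 < P.H)
    (hμ : 0 < P.μ) (hp₁ : 0 < P.p₁) (hp₂ : 0 < P.p₂) (hc : 0 < P.c)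
    (hA1 : P.c < P.α * P.H * (P.p₁ + P.p₂)) (hA2 : P.p₂ * P.μ < P.p₁ * P.H)
    {σ : Strategy} (hσ : IsEquilibrium P σ) {T : ℝ} (hT₀ : 0 ≤ T)
    (hT : σ.next Action.exit 0 = (T : EReal)) : P.α * threshold P T = P.c * (1 - P.α) := by
  have hD := withholdLength_pos hH hμ hp₂ hA2
  obtain ⟨hdis, hwith⟩ := act_eq_of_lt_exit hH hμ hp₁ hp₂ hA2 hσ hT₀ hT
  have hthr := threshold_eq P T
  set t₁ := max 0 (T - withholdLength P) with ht₁
  have ht₁0 : 0 ≤ t₁ := le_max_left _ _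
  have ht₁T : t₁ ≤ T := max_le hT₀ (by linarith)
  have hexit : σ.act T = Action.exit := σ.act_of_next_eq hT₀ hT
  obtain ⟨ε, hε, hconst⟩ := σ.exists_const_right hT₀
  have h₁ : ∀ x : ℝ, 0 ≤ x → x < t₁ → σ.next Action.disclose x = x := fun x hx hx' =>
    σ.next_eq_self (hdis x hx hx')
  have h₂ : ∀ x : ℝ, t₁ ≤ x → x < T → ((T + ε : ℝ) : EReal) ≤ σ.next Action.disclose x := by
    intro x hx hxT
    refine σ.le_next_of_forall fun u hu hu' => ?_
    rw [EReal.coe_le_coe_iff] at hu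
    rw [EReal.coe_lt_coe_iff] at hu'
    rcases lt_or_ge u T with h | h
    · rw [hwith u (hx.trans hu) h]
      simp
    · rw [hconst u h hu', hexit]
      simp
  have h₂' : ∀ b : ℝ, b ≤ T + ε → ∀ x : ℝ, t₁ ≤ x → x < T →
      (b : EReal) ≤ σ.next Action.disclose x := fun b hb x hx hxT =>
    le_trans (by exact_mod_cast hb) (h₂ x hx hxT)
  have hown : ∀ t : ℝ, 0 ≤ t → t ≤ T → σ.next Action.exit t = (T : EReal) := by
    intro t ht htT
    rw [← hT]
    refine σ.next_eq_of_le (by exact_mod_cast ht) ?_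
    rw [hT]
    exact_mod_cast htT
  have hdev : ∀ t τ : ℝ, 0 ≤ t → t ≤ T → t ≤ τ → τ ≤ T + ε →
      ∫ r in t..τ, flow P σ t₁ r ≤ ∫ r in t..T, flow P σ t₁ r := by
    intro t τ ht htT htτ hτ
    have h := hσ.1 t ht τ (σ.next Action.disclose) (by exact_mod_cast htτ) (σ.measurable_next _)
      (σ.le_next _)
    rwa [hown t ht htT, unsolvedPayoff_le_iff hα₀ hα₁ hH hμ hc hT hT₀ ht htτ htT
      (σ.measurable_next _) (σ.le_next _) (σ.measurable_next _) (σ.le_next _),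
      integral_flow hα₀ hα₁ hH hμ hT ht htτ ht₁T h₁ (h₂' τ hτ),
      integral_flow hα₀ hα₁ hH hμ hT ht htT ht₁T h₁ (h₂' T (by linarith))] at h
  have hcW : Continuous (waitValue P) := by
    unfold waitValue
    fun_prop
  have hcI := continuous_hiddenSuccess P
  -- staying a little longer than `T` is not profitable
  have hle : P.α * threshold P T ≤ P.c * (1 - P.α) := by
    have h := nonpos_of_integral_right_nonpos (T := T) (b := T + ε) (by linarith)
      (f := fun r => P.α * (Real.exp (-2 * P.H * t₁) * (Real.exp (-P.H * (r - t₁)) *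
      ((P.H * (P.p₁ + P.p₂) - P.c) * Real.exp (-P.H * (T - t₁)) +
        (P.H * ((P.p₁ + P.p₂) / 2) - P.c) * (Real.exp (-P.μ * (r - T)) *
          hiddenSuccess P (T - t₁))))) - P.c * (1 - P.α)) (by fun_prop) ?_
    · simp only [sub_self, mul_zero, Real.exp_zero, one_mul] at h
      rw [← exitGain, ← hthr] at h
      linarith
    · intro τ hτ hτ'
      have h3 := hdev T τ hT₀ le_rfl hτ.le hτ'.le
      rw [intervalIntegral.integral_same] at h3
      refine le_trans (le_of_eq ?_) h3
      refine intervalIntegral.integral_congr fun r hr => ?_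
      rw [Set.uIcc_of_le hτ.le] at hr
      exact (flow_of_exit hα₀ hα₁ hH hμ hT ht₁0 ht₁T hr.1 h₁
        (h₂' r (hr.2.trans hτ'.le))).symm
  -- leaving a little earlier than `T` is not profitable
  have hge : P.c * (1 - P.α) ≤ P.α * threshold P T := by
    rcases hT₀.eq_or_lt with h0 | h0
    · exfalso
      rw [← h0, threshold, min_eq_left hD.le, max_eq_left (by linarith), exitGain_zero] at hle
      simp only [mul_zero, Real.exp_zero, one_mul] at hle
      linarith
    have ht₁T' : t₁ < T := max_lt h0 (by linarith)
    have h := nonneg_of_integral_left_nonneg ht₁T'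
      (f := fun r => P.α * (Real.exp (-2 * P.H * t₁) * (Real.exp (-P.H * (r - t₁)) *
      stayGain P (T - t₁) (r - t₁))) - P.c * (1 - P.α)) ?_ ?_
    · rw [stayGain_self, ← hthr] at h
      linarith
    · have : Continuous fun r => stayGain P (T - t₁) (r - t₁) := by
        unfold stayGain
        have h3 : Continuous fun r => waitValue P (T - t₁ - (r - t₁)) := hcW.comp (by fun_prop)
        have h4 : Continuous fun r => hiddenSuccess P (r - t₁) := hcI.comp (by fun_prop)
        fun_prop
      fun_prop
    · intro t ht htT
      have h3 := hdev t t (ht₁0.trans ht) htT.le le_rfl (by linarith)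
      rw [intervalIntegral.integral_same] at h3
      refine le_trans h3 (le_of_eq ?_)
      refine intervalIntegral.integral_congr fun r hr => ?_
      rw [Set.uIcc_of_le htT.le] at hr
      rcases hr.2.eq_or_lt with rfl | hrT
      · rw [flow_of_exit hα₀ hα₁ hH hμ hT ht₁0 ht₁T le_rfl h₁ (h₂' r (by linarith)),
          stayGain_self, sub_self, mul_zero, Real.exp_zero, one_mul, ← exitGain]
      · exact flow_of_withhold hα₀ hα₁ hH hμ hT ht₁0 (ht.trans hr.1) hrT h₁
          (h₂' T (by linarith))
  exact le_antisymm hle hge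

end RDGame

theorem theorem1 (P : RDGame.Params)
    (hα₀ : 0 < P.α) (hα₁ : P.α < 1) (hH : 0 < P.H) (hμ : 0 < P.μ)
    (hp₁ : 0 < P.p₁) (hp₂ : 0 < P.p₂) (hc : 0 < P.c)
    (hA1 : P.c < P.α * P.H * (P.p₁ + P.p₂))
    (hA2 : P.p₂ * P.μ < P.p₁ * P.H)
    (hA3 : RDGame.A3 P) :
    ∃ t₁ t₂ : ℝ, 0 ≤ t₁ ∧ t₁ < t₂ ∧
      -- the length of the withhold region
      t₁ = max 0 (t₂ - RDGame.withholdLength P) ∧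
      (1 / 2 ≤ P.α → t₂ - t₁ = RDGame.withholdLength P) ∧
      -- the exit-indifference condition determines the exit time
      (∀ t : ℝ, 0 ≤ t →
        (RDGame.ExitIndifference P (max 0 (t - RDGame.withholdLength P)) t ↔ t = t₂)) ∧
      -- existence
      RDGame.IsEquilibrium P (RDGame.discloseWithholdExit t₁ t₂) ∧
      -- uniqueness
      (∀ σ : RDGame.Strategy, RDGame.IsEquilibrium P σ →
        (∀ t : ℝ, 0 ≤ t → t ≤ t₂ →
          σ.act t = (RDGame.discloseWithholdExit t₁ t₂).act t) ∧
        (σ.ExitFinal → ∀ t : ℝ, 0 ≤ t →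
          σ.act t = (RDGame.discloseWithholdExit t₁ t₂).act t)) := by
  open RDGame in
  have hpc : P.c < P.H * (P.p₁ + P.p₂) := by
    have : 0 < P.H * (P.p₁ + P.p₂) := by positivity
    nlinarith
  have hD := withholdLength_pos hH hμ hp₂ hA2
  have hDc := cost_exp_le_exitGain_withholdLength hH hμ hp₂ hc hA2 hA3
  have hα : 0 < 1 - P.α := by linarith
  obtain ⟨T, hT₀, hTK⟩ := exists_threshold_eq hH hD (K := P.c * (1 - P.α) / P.α)
    (by positivity) (by rw [div_lt_iff₀ hα₀]; linarith)
  have hthr : P.α * threshold P T = P.c * (1 - P.α) := by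
    rw [hTK]
    field_simp
  have hanti := threshold_strictAnti hH hμ hc hpc.le hD hDc
  have huniq : ∀ t, 0 ≤ t → P.α * threshold P t = P.c * (1 - P.α) → t = T := by
    intro t ht h
    exact hanti.injOn ht hT₀.le (mul_left_cancel₀ hα₀.ne' (h.trans hthr.symm))
  have hmax : ∀ t, 0 ≤ t → max 0 (t - withholdLength P) ≤ t := fun t ht =>
    max_le ht (by linarith)
  refine ⟨max 0 (T - withholdLength P), T, le_max_left _ _, max_lt hT₀ (by linarith), rfl, ?_, ?_,
    isEquilibrium_discloseWithholdExit hα₀ hα₁ hH hμ hp₁ hp₂ hc hpc.le hA2 hDc hT₀ hthr, ?_⟩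
  · intro hhalf
    rw [sub_max_eq_min]
    refine min_eq_right (le_of_not_gt fun hlt => ?_)
    have h1 := hanti hT₀.le hD.le hlt
    have h2 := cost_le_exp_mul_exitGain hH hμ hc hpc.le hDc hD.le le_rfl
    have h3 : threshold P (withholdLength P) =
        Real.exp (-P.H * withholdLength P) * exitGain P (withholdLength P) := by
      rw [threshold, sub_self, max_self, mul_zero, Real.exp_zero, one_mul, min_self]
    rw [h3] at h1
    nlinarith
  · intro t ht
    rw [exitIndifference_iff hα₀ hα₁ hH (hmax t ht), ← threshold_eq]
    exact ⟨huniq t ht, fun h => h ▸ hthr⟩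
  · intro σ hσ
    obtain ⟨S, hS₀, hS⟩ := exists_exit_of_isEquilibrium hα₀ hα₁ hH hμ hc hσ
    obtain rfl := huniq S hS₀
      (threshold_of_isEquilibrium hα₀ hα₁ hH hμ hp₁ hp₂ hc hA1 hA2 hσ hS₀ hS)
    obtain ⟨hdis, hwith⟩ := act_eq_of_lt_exit hH hμ hp₁ hp₂ hA2 hσ hS₀ hS
    have hexit : σ.act S = Action.exit := σ.act_of_next_eq hS₀ hS
    have key : ∀ t : ℝ, 0 ≤ t → t ≤ S →
        σ.act t = (discloseWithholdExit (max 0 (S - withholdLength P)) S).act t := by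
      intro t ht htS
      simp only [discloseWithholdExit]
      split_ifs with h1 h2
      · exact hdis t ht h1
      · exact hwith t (not_lt.1 h1) h2
      · rw [le_antisymm htS (not_lt.1 h2), hexit]
    refine ⟨key, fun hfin t ht => ?_⟩
    rcases le_total t S with h | h
    · exact key t ht h
    · rw [hfin S t hS₀ h hexit]
      simp only [discloseWithholdExit]
      rw [if_neg (not_lt.2 ((hmax S hS₀).trans h)), if_neg (not_lt.2 h)]
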